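/- Let $q\in\mathbb C^\times$ with $|q|\ne1$, fix a square root $q^{1/2}$, and let $N\ge1$, $r\in\mathbb Z$, $\epsilon\in\{1,-1\}$. Let $T_q$ be the operator $f(z)\mapsto f(qz)$, and let $\mathcal S_{q,N}$ be the Lie algebra (under the commutator) of the associative algebra with basis $z^kT_q^mE_{ij}$ ($k,m\in\mathbb Z$, $1\le i,j\le N$) and product $$(z^kf(T_q)A)(z^lg(T_q)B)=z^{k+l}f(q^lT_q)g(T_q)AB .$$ Let $\sigma$ be its anti-involution $$\sigma\bigl(z^kh(T_q)E_{ij}\bigr)=\epsilon^kq^{rk(k-1)/2}z^kh(q^{1-k}T_q^{-1})T_q^{kr}E_{N+1-j,\,N+1-i},$$ let $\mathcal S^{\epsilon,r}=\{a\in\mathcal S_{q,N}:\sigma(a)=-a\}$, and let $\widehat{\mathcal S}=\mathcal S^{\epsilon,r}\oplus\mathbb CC$ be its central extension by the cocycle $$\psi(z^kf(T_q)A,z^lg(T_q)B)=\delta_{k,-l}\,k\,\mathrm{tr}_0\bigl(f(q^{-k}w)g(w)\bigr)\,\mathrm{tr}(AB),$$ where $\mathrm{tr}_0$ is the constant term of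 a Laurent polynomial in $w$. Grade $\widehat{\mathcal S}$ by $\deg z^kf(T_q)E_{ij}=kN+i-j$ and $\deg C=0$. For $\lambda\in(\widehat{\mathcal S}_0)^*$ let $L(\lambda)$ be the irreducible highest weight module, the quotient of the Verma module $M(\lambda)$ by its maximal proper graded submodule; it is called quasifinite if all its graded components are finite-dimensional. Put $c=\lambda(C)$ and, for $l\in\mathbb Z$, $$\Delta_{i,l}=\lambda\bigl((q^{-1/2}T_q)^lE_{ii}-(q^{-1/2}T_q)^{-l}E_{N+1-i,N+1-i}\bigr)\qquad(1\le i\le[N/2]+1,\ i\le N),$$ $$\Delta^\ast_{l}=\lambda\bigl((T_q^l+T_q^{-l})E_{NN}-((q^{-1}T_q)^l+(q^{-1}T_q)^{-l})E_{11}\bigr),$$ with generating series $\Delta_i(x)=\sum_{l\in\mathbb Z}\Delta_{i,l}x^{-l}$ and $\Delta^\ast(x)=\sum_{l\in\mathbb Z}\Delta^\ast_{l}x^{-l}$. A quasipolynomial is a linear combination of functions $p(x)q^{\alpha x}$ on $\mathbb C$ with $p$ a polynomial and $\alpha\in\mathbb C$; it is called even if it is annihilated by $B(d/dx)$ for some nonzero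 even polynomial $B$. Let $\delta_{N,\mathrm{even}}$ be $1$ if $N$ is even and $0$ otherwise. The following conditions are equivalent: 0. $L(\lambda)$ is quasifinite. 1. There are monic polynomials $b_i$ ($1\le i\le[N/2]-\delta_{N,\mathrm{even}}$) and $b^\epsilon_N$, and also $b_{N/2}$ if $N$ is even, such that $b_i(x)\,(\Delta_{i+1}(x)-\Delta_i(x))=0$ for these $i$, $b^\epsilon_N(x)\,(\Delta^\ast(x)-2c)=0$, and, if $N$ is even, $b_{N/2}(x)\,(\Delta_{1+N/2}(x)-\Delta_{N/2}(x))=0$. 2. There are quasipolynomials $P_i$ ($1\le i\le[N/2]-\delta_{N,\mathrm{even}}$) and an even quasipolynomial $P^\epsilon_N$, and also an even quasipolynomial $P_{N/2}$ if $N$ is even, such that for all $n\in\mathbb Z$: $P_i(n)=\Delta_{i,n}-\Delta_{i+1,n}$ for these $i$; $P^\epsilon_N(n)=\Delta^\ast_{n}$ if $n\ne0$, and $P^\epsilon_N(0)=\Delta^\ast_{0}-2c$; and, if $N$ is even, $P_{N/2}(n)=\Delta_{N/2,n}-\Delta_{N/2+1,n}$. 3. Condition 2 holds with $P^\epsilon_N$,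 and $P_{N/2}$ if $N$ is even, being moreover even functions of $x$. -/

import Mathlib

noncomputable section

/-! ### Quantum pseudo-differential operators -/

/-- The algebra of quantum pseudo-differential operators: Laurent polynomials in `z` and `T_q`, as
the free vector space on the monomials `z ^ k T_q ^ m`, `(k, m) : ℤ × ℤ`. -/
def QDiff (_q : ℂˣ) : Type := (ℤ × ℤ) →₀ ℂ

namespace QDiff

variable {q : ℂˣ}

instance : AddCommGroup (QDiff q) := inferInstanceAs (AddCommGroup ((ℤ × ℤ) →₀ ℂ))

instance : Module ℂ (QDiff q) := inferInstanceAs (Module ℂ ((ℤ × ℤ) →₀ ℂ))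

/-- The operator `c z ^ k T_q ^ m`. -/
def mono (q : ℂˣ) (k m : ℤ) (c : ℂ) : QDiff q := Finsupp.single (k, m) c

/-- The coefficient of `z ^ k T_q ^ m`. -/
def coeff (k m : ℤ) : QDiff q →ₗ[ℂ] ℂ := Finsupp.lapply (k, m)

/-- The linear map with given values on the monomials `z ^ k T_q ^ m`. -/
def lin {M : Type*} [AddCommGroup M] [Module ℂ M] (v : ℤ → ℤ → M) : QDiff q →ₗ[ℂ] M :=
  Finsupp.linearCombination ℂ (fun p : ℤ × ℤ => v p.1 p.2)

theorem lin_mono {M : Type*} [AddCommGroup M] [Module ℂ M] (v : ℤ → ℤ → M) (k m : ℤ) (c : ℂ) :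
    lin v (mono q k m c) = c • v k m :=
  Finsupp.linearCombination_single ℂ c (k, m)

theorem smul_mono (a : ℂ) (k m : ℤ) (c : ℂ) : a • mono q k m c = mono q k m (a * c) :=
  Finsupp.smul_single a (k, m) c

theorem mono_add (k m : ℤ) (c d : ℂ) : mono q k m (c + d) = mono q k m c + mono q k m d :=
  Finsupp.single_add (k, m) c d

theorem coeff_mono (k m k' m' : ℤ) (c : ℂ) :
    coeff k' m' (mono q k m c) = if k = k' ∧ m = m' then c else 0 := by
  change (Finsupp.single (k, m) c : (ℤ × ℤ) →₀ ℂ) (k', m') = _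
  rw [Finsupp.single_apply]
  simp only [Prod.mk.injEq]

theorem ext_lin {M : Type*} [AddCommGroup M] [Module ℂ M] {f g : QDiff q →ₗ[ℂ] M}
    (h : ∀ k m, f (mono q k m 1) = g (mono q k m 1)) : f = g :=
  Finsupp.lhom_ext' fun p => LinearMap.ext_ring (h p.1 p.2)

/-- The product, determined by `(z^k T_q^m) (z^l T_q^n) = q^(m l) z^(k + l) T_q^(m + n)`; that is,
`(z^k f(T_q)) (z^l g(T_q)) = z^(k + l) f(q^l T_q) g(T_q)`. -/
def mulLin : QDiff q →ₗ[ℂ] QDiff q →ₗ[ℂ] QDiff q :=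
  lin fun k m => lin fun l n => mono q (k + l) (m + n) ((q ^ (m * l) : ℂˣ) : ℂ)

instance : Mul (QDiff q) := ⟨fun x y => mulLin x y⟩

instance : One (QDiff q) := ⟨mono q 0 0 1⟩

theorem mul_def (x y : QDiff q) : x * y = mulLin x y := rfl

theorem mono_mul_mono (k m l n : ℤ) (c d : ℂ) :
    mono q k m c * mono q l n d
      = mono q (k + l) (m + n) (c * d * ((q ^ (m * l) : ℂˣ) : ℂ)) := by
  rw [mul_def, mulLin, lin_mono, LinearMap.smul_apply, lin_mono, smul_mono, smul_mono, mul_assoc]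

theorem one_def : (1 : QDiff q) = mono q 0 0 1 := rfl


theorem induction {p : QDiff q → Prop} (x : QDiff q) (h0 : p 0)
    (hadd : ∀ x y, p x → p y → p (x + y)) (hmono : ∀ k m c, p (mono q k m c)) : p x :=
  Finsupp.induction_linear x h0 hadd fun a c => hmono a.1 a.2 c

theorem add_mul' (x y w : QDiff q) : (x + y) * w = x * w + y * w := by
  simp only [mul_def, map_add, LinearMap.add_apply]

theorem mul_add' (x y w : QDiff q) : x * (y + w) = x * y + x * w := by
  simp only [mul_def, map_add]

theorem zero_mul' (x : QDiff q) : 0 * x = 0 := by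
  simp only [mul_def, map_zero, LinearMap.zero_apply]

theorem mul_zero' (x : QDiff q) : x * 0 = 0 := by
  simp only [mul_def, map_zero]

theorem mul_assoc' (x y w : QDiff q) : x * y * w = x * (y * w) := by
  induction x using induction with
  | h0 => simp only [zero_mul']
  | hadd x x' hx hx' => simp only [add_mul', hx, hx']
  | hmono k m c =>
    induction y using induction with
    | h0 => simp only [zero_mul', mul_zero']
    | hadd y y' hy hy' => simp only [add_mul', mul_add', hy, hy']
    | hmono l n d =>
      induction w using induction with
      | h0 => simp only [mul_zero']
      | hadd w w' hw hw' => simp only [mul_add', hw, hw']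
      | hmono j o e =>
        simp only [mono_mul_mono]
        have h : (q ^ (m * l) : ℂˣ) * q ^ ((m + n) * j) = q ^ (n * j) * q ^ (m * (l + j)) := by
          rw [← zpow_add, ← zpow_add]; congr 1; ring
        have h' := congrArg (fun u : ℂˣ => (u : ℂ)) h
        simp only [Units.val_mul] at h'
        rw [add_assoc, add_assoc]
        congr 1
        linear_combination (c * d * e) * h'

theorem one_mul' (x : QDiff q) : 1 * x = x := by
  induction x using induction with
  | h0 => exact mul_zero' 1
  | hadd x y hx hy => rw [mul_add', hx, hy]
  | hmono k m c => rw [one_def, mono_mul_mono]; simp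

theorem mul_one' (x : QDiff q) : x * 1 = x := by
  induction x using induction with
  | h0 => exact zero_mul' 1
  | hadd x y hx hy => rw [add_mul', hx, hy]
  | hmono k m c => rw [one_def, mono_mul_mono]; simp

instance : Ring (QDiff q) :=
  { (inferInstance : AddCommGroup (QDiff q)) with
    mul := fun x y => x * y
    one := 1
    left_distrib := mul_add'
    right_distrib := add_mul'
    zero_mul := zero_mul'
    mul_zero := mul_zero'
    mul_assoc := mul_assoc'
    one_mul := one_mul'
    mul_one := mul_one' }

instance : Algebra ℂ (QDiff q) :=
  Algebra.ofModule
    (fun a x y => by change mulLin (a • x) y = a • mulLin x y; rw [map_smul, LinearMap.smul_apply])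
    (fun a x y => by change mulLin x (a • y) = a • mulLin x y; rw [map_smul])

/-- The derivation `z d/dz`, multiplying `z ^ k T_q ^ m` by `k`. -/
def zDeg : QDiff q →ₗ[ℂ] QDiff q := lin fun k m => mono q k m (k : ℂ)

theorem zDeg_mono (k m : ℤ) (c : ℂ) : zDeg (mono q k m c) = mono q k m (c * k) := by
  rw [zDeg, lin_mono, smul_mono]

theorem zDeg_mul (x y : QDiff q) : zDeg (x * y) = zDeg x * y + x * zDeg y := by
  induction x using induction with
  | h0 => simp
  | hadd x x' hx hx' => simp only [add_mul, map_add, hx, hx']; abel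
  | hmono k m c =>
    induction y using induction with
    | h0 => simp
    | hadd y y' hy hy' => simp only [mul_add, map_add, hy, hy']; abel
    | hmono l n d =>
      simp only [zDeg_mono, mono_mul_mono, ← mono_add]
      congr 1
      push_cast
      ring

theorem coeff_mul_comm (x y : QDiff q) : coeff 0 0 (x * y) = coeff 0 0 (y * x) := by
  induction x using induction with
  | h0 => simp
  | hadd x x' hx hx' => simp only [add_mul, mul_add, map_add, hx, hx']
  | hmono k m c =>
    induction y using induction with
    | h0 => simp
    | hadd y y' hy hy' => simp only [mul_add, add_mul, map_add, hy, hy']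
    | hmono l n d =>
      simp only [mono_mul_mono, coeff_mono]
      by_cases h : k + l = 0 ∧ m + n = 0
      · have h' : l + k = 0 ∧ n + m = 0 := ⟨by omega, by omega⟩
        rw [if_pos h, if_pos h']
        have e : m * l = n * k := by
          have h1 : l = -k := by omega
          have h2 : n = -m := by omega
          rw [h1, h2]; ring
        rw [e]; ring
      · have h' : ¬(l + k = 0 ∧ n + m = 0) := fun h' => h ⟨by omega, by omega⟩
        rw [if_neg h, if_neg h']

theorem coeff_zDeg (x : QDiff q) : coeff 0 0 (zDeg x) = 0 := by
  induction x using induction with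
  | h0 => simp
  | hadd x y hx hy => simp only [map_add, hx, hy, add_zero]
  | hmono k m c =>
    rw [zDeg_mono, coeff_mono]
    split_ifs with h
    · simp [h.1]
    · rfl

/-- The scalar part of the anti-involution:
`z ^ k h(T_q) ↦ ε ^ k q ^ (r k (k - 1) / 2) z ^ k h(q ^ (1 - k) T_q⁻¹) T_q ^ (k r)`. -/
def sigma (ε : ℤˣ) (r : ℤ) : QDiff q →ₗ[ℂ] QDiff q :=
  lin fun k m => mono q k (k * r - m)
    ((((ε ^ k : ℤˣ) : ℤ) : ℂ) * ((q ^ (r * (k * (k - 1) / 2) + (1 - k) * m) : ℂˣ) : ℂ))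

theorem sigma_mono (ε : ℤˣ) (r k m : ℤ) (c : ℂ) :
    sigma ε r (mono q k m c) = mono q k (k * r - m)
      (c * ((((ε ^ k : ℤˣ) : ℤ) : ℂ) *
        ((q ^ (r * (k * (k - 1) / 2) + (1 - k) * m) : ℂˣ) : ℂ))) := by
  rw [sigma, lin_mono, smul_mono]

theorem triangle_add (k l : ℤ) :
    (k + l) * (k + l - 1) / 2 = k * (k - 1) / 2 + l * (l - 1) / 2 + k * l := by
  obtain ⟨a, ha⟩ := (Int.even_mul_pred_self k).two_dvd
  obtain ⟨b, hb⟩ := (Int.even_mul_pred_self l).two_dvd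
  have h : (k + l) * (k + l - 1) = 2 * (a + b + k * l) := by linear_combination ha + hb
  rw [h, ha, hb]
  simp

theorem sigma_mul (ε : ℤˣ) (r : ℤ) (x y : QDiff q) :
    sigma ε r (x * y) = sigma ε r y * sigma ε r x := by
  induction x using induction with
  | h0 => simp
  | hadd x x' hx hx' => simp only [add_mul, mul_add, map_add, hx, hx']
  | hmono k m c =>
    induction y using induction with
    | h0 => simp
    | hadd y y' hy hy' => simp only [mul_add, add_mul, map_add, hy, hy']
    | hmono l n d =>
      simp only [sigma_mono, mono_mul_mono]
      have h : (q ^ (m * l) : ℂˣ)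
            * q ^ (r * ((k + l) * (k + l - 1) / 2) + (1 - (k + l)) * (m + n))
          = q ^ (r * (l * (l - 1) / 2) + (1 - l) * n) * q ^ (r * (k * (k - 1) / 2) + (1 - k) * m)
            * q ^ ((l * r - n) * k) := by
        rw [← zpow_add, ← zpow_add, ← zpow_add, triangle_add]; congr 1; ring
      have h' := congrArg (fun u : ℂˣ => (u : ℂ)) h
      simp only [Units.val_mul] at h'
      have e1 : (k + l) * r - (m + n) = l * r - n + (k * r - m) := by ring
      have e2 : (((ε ^ (k + l) : ℤˣ) : ℤ) : ℂ)
          = (((ε ^ k : ℤˣ) : ℤ) : ℂ) * (((ε ^ l : ℤˣ) : ℤ) : ℂ) := by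
        rw [zpow_add, Units.val_mul, Int.cast_mul]
      rw [e1, e2, add_comm l k]
      congr 1
      linear_combination (c * d * (((ε ^ k : ℤˣ) : ℤ) : ℂ) * (((ε ^ l : ℤˣ) : ℤ) : ℂ)) * h'

end QDiff

/-! ### Matrices of operators, the anti-involution and its fixed algebra -/

/-- The algebra of `N × N` matrices of quantum pseudo-differential operators. The Lie bracket is the
commutator. -/
abbrev QMat (N : ℕ) (q : ℂˣ) : Type := Matrix (Fin N) (Fin N) (QDiff q)

namespace QMat

variable {N : ℕ} {q : ℂˣ}

instance : LieRing (QMat N q) := LieRing.ofAssociativeRing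

instance : LieAlgebra ℂ (QMat N q) := LieAlgebra.ofAssociativeAlgebra

/-- The anti-involution sending `x E_{ij}` to `sigma x E_{N + 1 - j, N + 1 - i}`. -/
def sigma (ε : ℤˣ) (r : ℤ) : QMat N q →ₗ[ℂ] QMat N q where
  toFun A := Matrix.of fun i j => QDiff.sigma ε r (A j.rev i.rev)
  map_add' A B := by ext1 i j; simp
  map_smul' a A := by ext1 i j; simp

theorem sigma_apply (ε : ℤˣ) (r : ℤ) (A : QMat N q) (i j : Fin N) :
    sigma ε r A i j = QDiff.sigma ε r (A j.rev i.rev) := rfl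

theorem sigma_mul (ε : ℤˣ) (r : ℤ) (A B : QMat N q) :
    sigma ε r (A * B) = sigma ε r B * sigma ε r A := by
  ext1 i j
  simp only [sigma_apply, Matrix.mul_apply, map_sum, QDiff.sigma_mul]
  exact (Equiv.sum_comp Fin.revPerm
    (fun k => QDiff.sigma ε r (B k i.rev) * QDiff.sigma ε r (A j.rev k))).symm

theorem sigma_single (ε : ℤˣ) (r : ℤ) (i j : Fin N) (x : QDiff q) :
    sigma ε r (Matrix.single i j x) = Matrix.single j.rev i.rev (QDiff.sigma ε r x) := by
  ext1 a b
  rw [sigma_apply, Matrix.single_apply, Matrix.single_apply]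
  by_cases h : i = b.rev ∧ j = a.rev
  · have h' : j.rev = a ∧ i.rev = b := ⟨by rw [h.2, Fin.rev_rev], by rw [h.1, Fin.rev_rev]⟩
    rw [if_pos h, if_pos h']
  · have h' : ¬(j.rev = a ∧ i.rev = b) := fun h' =>
      h ⟨by rw [← h'.2, Fin.rev_rev], by rw [← h'.1, Fin.rev_rev]⟩
    rw [if_neg h, if_neg h', map_zero]

/-- The bilinear form `ψ(z^m f(T_q) A, z^k g(T_q) B) = δ_{m,-k} m tr₀(f(q^(-m) T_q) g(T_q)) tr(AB)`,
written as `ψ(X, Y) = Tr ((z d/dz X) Y)`, where `Tr` takes the trace of the matrix and then the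
coefficient of `z ^ 0 T_q ^ 0`; see `psi_single`. -/
def psi (N : ℕ) (q : ℂˣ) : QMat N q →ₗ[ℂ] QMat N q →ₗ[ℂ] ℂ :=
  LinearMap.mk₂ ℂ (fun X Y => QDiff.coeff 0 0 (Matrix.trace (X.map QDiff.zDeg * Y)))
    (fun X X' Y => by
      simp only [Matrix.map_add _ (map_add QDiff.zDeg), add_mul, Matrix.trace_add, map_add])
    (fun a X Y => by
      have h : (a • X).map QDiff.zDeg = a • X.map QDiff.zDeg := by ext1 i j; simp
      rw [h, Matrix.smul_mul, Matrix.trace_smul, map_smul])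
    (fun X Y Y' => by simp only [mul_add, Matrix.trace_add, map_add])
    (fun a X Y => by rw [Matrix.mul_smul, Matrix.trace_smul, map_smul])

theorem psi_apply (X Y : QMat N q) :
    psi N q X Y = QDiff.coeff 0 0 (Matrix.trace (X.map QDiff.zDeg * Y)) := rfl

theorem psi_single (m a k b : ℤ) (i j i' j' : Fin N) :
    psi N q (Matrix.single i j (QDiff.mono q m a 1)) (Matrix.single i' j' (QDiff.mono q k b 1))
      = if m = -k ∧ a = -b ∧ j = i' ∧ i = j' then (m : ℂ) * ((q ^ (-m * a) : ℂˣ) : ℂ) else 0 := by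
  have h : (Matrix.single i j (QDiff.mono q m a 1)).map QDiff.zDeg
      = Matrix.single i j (QDiff.mono q m a (m : ℂ)) := by
    ext1 x y
    rw [Matrix.map_apply, Matrix.single_apply, Matrix.single_apply]
    split_ifs
    · rw [QDiff.zDeg_mono, one_mul]
    · rw [map_zero]
  rw [psi_apply, h]
  by_cases hj : j = i'
  · subst hj
    rw [Matrix.single_mul_single_same]
    by_cases hi : i = j'
    · subst hi
      rw [Matrix.trace_single_eq_same, QDiff.mono_mul_mono, QDiff.coeff_mono]
      by_cases hk : m = -k ∧ a = -b
      · have h1 : m + k = 0 ∧ a + b = 0 := ⟨by omega, by omega⟩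
        rw [if_pos h1, if_pos ⟨hk.1, hk.2, rfl, rfl⟩]
        have : a * k = -m * a := by rw [hk.1]; ring
        rw [this, mul_one]
      · have h1 : ¬(m + k = 0 ∧ a + b = 0) := fun h1 => hk ⟨by omega, by omega⟩
        rw [if_neg h1, if_neg fun h2 => hk ⟨h2.1, h2.2.1⟩]
    · rw [Matrix.trace_single_eq_of_ne _ _ _ hi, map_zero, if_neg fun h2 => hi h2.2.2.2]
  · rw [Matrix.single_mul_single_of_ne _ _ _ _ hj, Matrix.trace_zero, map_zero,
      if_neg fun h2 => hj h2.2.2.1]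

theorem tr_mul_comm (X Y : QMat N q) :
    QDiff.coeff 0 0 (Matrix.trace (X * Y)) = QDiff.coeff 0 0 (Matrix.trace (Y * X)) := by
  simp only [Matrix.trace, Matrix.diag_apply, Matrix.mul_apply, map_sum]
  rw [Finset.sum_comm]
  exact Finset.sum_congr rfl fun i _ => Finset.sum_congr rfl fun j _ => QDiff.coeff_mul_comm _ _

theorem map_zDeg_mul (X Y : QMat N q) :
    (X * Y).map QDiff.zDeg = X.map QDiff.zDeg * Y + X * Y.map QDiff.zDeg := by
  ext1 i j
  simp only [Matrix.map_apply, Matrix.mul_apply, Matrix.add_apply, map_sum, QDiff.zDeg_mul,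
    Finset.sum_add_distrib]

theorem tr_zDeg (X : QMat N q) : QDiff.coeff 0 0 (Matrix.trace (X.map QDiff.zDeg)) = 0 := by
  simp only [Matrix.trace, Matrix.diag_apply, Matrix.map_apply, map_sum, QDiff.coeff_zDeg,
    Finset.sum_const_zero]

theorem psi_skew (X Y : QMat N q) : psi N q X Y = -psi N q Y X := by
  have h := tr_zDeg (X * Y)
  rw [map_zDeg_mul, Matrix.trace_add, map_add, tr_mul_comm X] at h
  rw [psi_apply, psi_apply]
  exact eq_neg_of_add_eq_zero_left h

theorem psi_self (X : QMat N q) : psi N q X X = 0 := by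
  have h := psi_skew X X
  linear_combination h / 2

theorem psi_cocycle (X Y Z : QMat N q) :
    psi N q X ⁅Y, Z⁆ = psi N q ⁅X, Y⁆ Z + psi N q Y ⁅X, Z⁆ := by
  have hs : ∀ A B : QMat N q, (A - B).map QDiff.zDeg = A.map QDiff.zDeg - B.map QDiff.zDeg :=
    fun A B => by ext1 i j; simp
  have c1 := tr_mul_comm (X.map QDiff.zDeg * Z) Y
  have c2 := tr_mul_comm (Y.map QDiff.zDeg * Z) X
  rw [mul_assoc] at c1 c2
  rw [Ring.lie_def, Ring.lie_def, Ring.lie_def, psi_apply, psi_apply, psi_apply]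
  simp only [hs, map_zDeg_mul, mul_sub, sub_mul, add_mul,
    Matrix.trace_sub, Matrix.trace_add, map_sub, map_add, mul_assoc]
  linear_combination c2 - c1

/-- The Lie algebra of the matrices `a` with `sigma a = -a`. -/
def fixed (N : ℕ) (q : ℂˣ) (ε : ℤˣ) (r : ℤ) : LieSubalgebra ℂ (QMat N q) where
  carrier := {a | sigma ε r a = -a}
  add_mem' {a b} ha hb := by
    change sigma ε r (a + b) = -(a + b)
    rw [map_add, ha, hb, neg_add]
  zero_mem' := by
    change sigma ε r 0 = -0
    rw [map_zero, neg_zero]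
  smul_mem' c a ha := by
    change sigma ε r (c • a) = -(c • a)
    rw [map_smul, ha, smul_neg]
  lie_mem' {a b} ha hb := by
    change sigma ε r a = -a at ha
    change sigma ε r b = -b at hb
    change sigma ε r ⁅a, b⁆ = -⁅a, b⁆
    rw [Ring.lie_def, map_sub, sigma_mul, sigma_mul, ha, hb, neg_mul_neg, neg_mul_neg, neg_sub]

theorem mem_fixed {ε : ℤˣ} {r : ℤ} {a : QMat N q} : a ∈ fixed N q ε r ↔ sigma ε r a = -a := Iff.rfl

/-- The restriction of `psi` to the fixed algebra, as a 2-cocycle with trivial coefficients. -/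
def cocycle (N : ℕ) (q : ℂˣ) (ε : ℤˣ) (r : ℤ) :
    LieModule.Cohomology.twoCocycle ℂ (fixed N q ε r) (TrivialLieModule ℂ (fixed N q ε r) ℂ) :=
  ⟨⟨((psi N q).compl₁₂ (fixed N q ε r).toSubmodule.subtype
        (fixed N q ε r).toSubmodule.subtype).compr₂
      (TrivialLieModule.equiv ℂ (fixed N q ε r) ℂ).symm.toLinearMap,
    by intro x; exact psi_self (x : QMat N q)⟩,
   by
    rw [LieModule.Cohomology.mem_twoCocycle_iff_of_trivial]
    intro x y z
    exact psi_cocycle (x : QMat N q) (y : QMat N q) (z : QMat N q)⟩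

end QMat

/-- The central extension of the fixed algebra by `ℂ C` with the cocycle `psi`: the bracket of
`a + x C` and `b + y C` is `[a, b] + psi a b C`. -/
abbrev SHat (N : ℕ) (q : ℂˣ) (ε : ℤˣ) (r : ℤ) : Type :=
  LieAlgebra.ofTwoCocycle (QMat.cocycle N q ε r)

namespace SHat

variable {N : ℕ} {q : ℂˣ} {ε : ℤˣ} {r : ℤ}

/-- The element `a + x C`. -/
def mk (a : QMat.fixed N q ε r) (x : ℂ) : SHat N q ε r :=
  LieAlgebra.ofProd (QMat.cocycle N q ε r) (a, (TrivialLieModule.equiv ℂ _ ℂ).symm x)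

/-- The component `a` of `a + x C`. -/
def op (u : SHat N q ε r) : QMat N q :=
  ((LieAlgebra.ofProd (QMat.cocycle N q ε r)).symm u).1

/-- The coefficient `x` of `a + x C`. -/
def central (u : SHat N q ε r) : ℂ :=
  TrivialLieModule.equiv ℂ (QMat.fixed N q ε r) ℂ
    ((LieAlgebra.ofProd (QMat.cocycle N q ε r)).symm u).2

theorem op_lie (u v : SHat N q ε r) : op ⁅u, v⁆ = ⁅op u, op v⁆ := rfl

theorem central_lie (u v : SHat N q ε r) : central ⁅u, v⁆ = QMat.psi N q (op u) (op v) := by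
  change (QMat.psi N q (op u) (op v) + 0) - 0 = _
  rw [add_zero, sub_zero]

/-- The component of degree `d` of the principal gradation: `z ^ k f(T_q) E_{ij}` has degree
`k N + i - j` and `C` has degree `0`. -/
def grade (N : ℕ) (q : ℂˣ) (ε : ℤˣ) (r : ℤ) (d : ℤ) : Submodule ℂ (SHat N q ε r) where
  carrier := {u |
    (∀ (i j : Fin N) (k m : ℤ), QDiff.coeff k m (op u i j) ≠ 0 →
      k * N + ((i : ℕ) : ℤ) - ((j : ℕ) : ℤ) = d) ∧ (d ≠ 0 → central u = 0)}
  add_mem' {u v} hu hv := by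
    refine ⟨fun i j k m h => ?_, fun hd => ?_⟩
    · by_cases hu' : QDiff.coeff k m (op u i j) = 0
      · by_cases hv' : QDiff.coeff k m (op v i j) = 0
        · refine absurd ?_ h
          change QDiff.coeff k m (op u i j + op v i j) = 0
          rw [map_add, hu', hv', add_zero]
        · exact hv.1 i j k m hv'
      · exact hu.1 i j k m hu'
    · change central u + central v = 0
      rw [hu.2 hd, hv.2 hd, add_zero]
  zero_mem' := by
    refine ⟨fun i j k m h => absurd ?_ h, fun _ => rfl⟩
    change QDiff.coeff k m (0 : QDiff q) = 0
    exact map_zero _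
  smul_mem' c u hu := by
    refine ⟨fun i j k m h => hu.1 i j k m fun h' => h ?_, fun hd => ?_⟩
    · change QDiff.coeff k m (c • op u i j) = 0
      rw [map_smul, h', smul_zero]
    · change c * central u = 0
      rw [hu.2 hd, mul_zero]

/-- An element `a + x C` with `a` a combination of diagonal matrices of operators of degree `0` in
`z` has degree `0`. -/
theorem mk_mem_grade_zero (a : QMat.fixed N q ε r) (x : ℂ)
    (ha : ∀ i j k m, QDiff.coeff k m ((a : QMat N q) i j) ≠ 0 → k = 0 ∧ i = j) :
    mk a x ∈ grade N q ε r 0 := by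
  refine ⟨fun i j k m h => ?_, fun h => absurd rfl h⟩
  obtain ⟨hk, hij⟩ := ha i j k m h
  rw [hk, hij]; ring

theorem coeff_single_mono {i j₀ i₀ j : Fin N} {k m b : ℤ} {c : ℂ}
    (h : QDiff.coeff k m ((Matrix.single i₀ j₀ (QDiff.mono q 0 b c) : QMat N q) i j) ≠ 0) :
    k = 0 ∧ i = i₀ ∧ j = j₀ := by
  rw [Matrix.single_apply] at h
  split_ifs at h with h'
  · rw [QDiff.coeff_mono] at h
    split_ifs at h with h''
    · exact ⟨h''.1.symm, h'.1.symm, h'.2.symm⟩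
    · exact absurd rfl h
  · exact absurd (map_zero _) h

theorem diag_of_sub {A B : QMat N q} {i₀ j₀ : Fin N} {b b' d d' : ℤ} {c c' e e' : ℂ}
    (hA : A = Matrix.single i₀ i₀ (QDiff.mono q 0 b c) + Matrix.single i₀ i₀ (QDiff.mono q 0 b' c'))
    (hB : B = Matrix.single j₀ j₀ (QDiff.mono q 0 d e) + Matrix.single j₀ j₀ (QDiff.mono q 0 d' e'))
    (i j : Fin N) (k m : ℤ) (h : QDiff.coeff k m ((A - B) i j) ≠ 0) : k = 0 ∧ i = j := by
  by_contra hn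
  have key : ∀ (x : Fin N) (b : ℤ) (c : ℂ),
      QDiff.coeff k m ((Matrix.single x x (QDiff.mono q 0 b c) : QMat N q) i j) = 0 := by
    intro x b c
    by_contra hx
    obtain ⟨h1, h2, h3⟩ := coeff_single_mono hx
    exact hn ⟨h1, h2.trans h3.symm⟩
  apply h
  rw [Matrix.sub_apply, hA, hB, Matrix.add_apply, Matrix.add_apply, map_sub, map_add, map_add,
    key, key, key, key]
  simp

theorem single_eq_add (i : Fin N) (b : ℤ) (c : ℂ) :
    (Matrix.single i i (QDiff.mono q 0 b c) : QMat N q)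
      = Matrix.single i i (QDiff.mono q 0 b c) + Matrix.single i i (QDiff.mono q 0 0 0) := by
  have h : QDiff.mono q 0 0 0 = 0 := Finsupp.single_zero _
  rw [h, Matrix.single_zero, add_zero]

end SHat

/-! ### Irreducible highest weight modules -/

namespace HighestWeight

variable {g : Type*} [LieRing g] [LieAlgebra ℂ g] (G : ℤ → Submodule ℂ g)

/-- The component of degree `d` of the universal enveloping algebra of a graded Lie algebra: the span
of the products of homogeneous elements of total degree `d`. -/
def envGrade (d : ℤ) : Submodule ℂ (UniversalEnvelopingAlgebra ℂ g) :=
  Submodule.span ℂ {u | ∃ L : List (ℤ × g), (∀ p ∈ L, p.2 ∈ G p.1) ∧ (L.map Prod.fst).sum = d ∧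
    u = (L.map fun p => UniversalEnvelopingAlgebra.ι ℂ p.2).prod}

variable (lam : Module.Dual ℂ (G 0))

/-- The left ideal generated by the elements of positive degree and by the `h - lam h` with `h` of
degree `0`. -/
def vermaIdeal : Submodule (UniversalEnvelopingAlgebra ℂ g) (UniversalEnvelopingAlgebra ℂ g) :=
  Submodule.span (UniversalEnvelopingAlgebra ℂ g)
    ({u | ∃ d : ℤ, 0 < d ∧ ∃ x ∈ G d, u = UniversalEnvelopingAlgebra.ι ℂ x} ∪
     {u | ∃ h : G 0, u = UniversalEnvelopingAlgebra.ι ℂ (h : g) -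
        algebraMap ℂ (UniversalEnvelopingAlgebra ℂ g) (lam h)})

/-- The Verma module `M(lam)`, that is `U(g) ⊗ ℂ_lam` over `U(g₀ ⊕ g₊)`, as the quotient of `U(g)` by
the left ideal `vermaIdeal`. -/
abbrev Verma : Type _ := UniversalEnvelopingAlgebra ℂ g ⧸ vermaIdeal G lam

/-- The component of degree `d` of the Verma module; the highest weight vector has degree `0`. -/
def vermaGrade (d : ℤ) : Submodule ℂ (Verma G lam) :=
  (envGrade G d).map ((vermaIdeal G lam).mkQ.restrictScalars ℂ)

/-- A submodule is graded if it is spanned by its homogeneous elements. -/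
def IsGraded (W : Submodule (UniversalEnvelopingAlgebra ℂ g) (Verma G lam)) : Prop :=
  W.restrictScalars ℂ = ⨆ d : ℤ, W.restrictScalars ℂ ⊓ vermaGrade G lam d

/-- The maximal proper graded submodule: the sum of all proper graded submodules. -/
def maxProper : Submodule (UniversalEnvelopingAlgebra ℂ g) (Verma G lam) :=
  sSup {W | IsGraded G lam W ∧ W ≠ ⊤}

/-- The irreducible highest weight module `L(lam)`. -/
abbrev Irr : Type _ := Verma G lam ⧸ maxProper G lam

/-- The component of degree `d` of `L(lam)`. -/
def irrGrade (d : ℤ) : Submodule ℂ (Irr G lam) :=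
  (vermaGrade G lam d).map ((maxProper G lam).mkQ.restrictScalars ℂ)

/-- `L(lam)` is quasifinite: all its homogeneous components are finite-dimensional. -/
def IsQuasifinite : Prop := ∀ d : ℤ, FiniteDimensional ℂ (irrGrade G lam d)

end HighestWeight

/-! ### Labels -/

namespace SHat

variable {N : ℕ} [NeZero N] {q : ℂˣ} {ε : ℤˣ} {r : ℤ}

/-- The index `i` of `{1, …, N}` as an element of `Fin N`. -/
def pos (N : ℕ) [NeZero N] (i : ℕ) : Fin N := Fin.ofNat N (i - 1)

/-- `(q ^ (-1/2) T_q) ^ l E_{i,i} - (q ^ (-1/2) T_q) ^ (-l) E_{N + 1 - i, N + 1 - i}`, where `s` is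
the chosen square root `q ^ (1/2)`. -/
def cartan (N : ℕ) [NeZero N] (q s : ℂˣ) (i : ℕ) (l : ℤ) : QMat N q :=
  Matrix.single (pos N i) (pos N i) (QDiff.mono q 0 l ((s ^ (-l) : ℂˣ) : ℂ))
    - Matrix.single (pos N i).rev (pos N i).rev (QDiff.mono q 0 (-l) ((s ^ l : ℂˣ) : ℂ))

/-- `(T_q ^ l + T_q ^ (-l)) E_{N,N} - ((q⁻¹ T_q) ^ l + (q⁻¹ T_q) ^ (-l)) E_{1,1}`. -/
def cartanN (N : ℕ) [NeZero N] (q : ℂˣ) (l : ℤ) : QMat N q :=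
  Matrix.single (pos N N) (pos N N) (QDiff.mono q 0 l 1 + QDiff.mono q 0 (-l) 1)
    - Matrix.single (pos N 1) (pos N 1)
      (QDiff.mono q 0 l ((q ^ (-l) : ℂˣ) : ℂ) + QDiff.mono q 0 (-l) ((q ^ l : ℂˣ) : ℂ))


theorem cartan_mem {s : ℂˣ} (hs : s ^ 2 = q) (ε : ℤˣ) (r : ℤ) (i : ℕ) (l : ℤ) :
    cartan N q s i l ∈ QMat.fixed N q ε r := by
  have h1 : ((s ^ (-l) : ℂˣ) : ℂ) * ((q ^ l : ℂˣ) : ℂ) = ((s ^ l : ℂˣ) : ℂ) := by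
    rw [← Units.val_mul, ← hs, ← zpow_natCast, ← zpow_mul, ← zpow_add]
    congr 2; push_cast; ring
  have h2 : ((s ^ l : ℂˣ) : ℂ) * ((q ^ (-l) : ℂˣ) : ℂ) = ((s ^ (-l) : ℂˣ) : ℂ) := by
    rw [← Units.val_mul, ← hs, ← zpow_natCast, ← zpow_mul, ← zpow_add]
    congr 2; push_cast; ring
  rw [QMat.mem_fixed, cartan, map_sub, QMat.sigma_single, QMat.sigma_single, QDiff.sigma_mono,
    QDiff.sigma_mono]
  simp only [Fin.rev_rev, zero_mul, zero_sub, neg_neg, zpow_zero, Units.val_one, Int.cast_one,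
    one_mul, Int.zero_ediv, mul_zero, zero_add, sub_zero, h1, h2, neg_sub]

theorem pos_rev (N : ℕ) [NeZero N] : (pos N N).rev = pos N 1 := by
  have h : 0 < N := NeZero.pos N
  apply Fin.ext
  rw [Fin.val_rev]
  simp only [pos, Fin.val_ofNat, Nat.sub_self, Nat.zero_mod]
  rw [Nat.mod_eq_of_lt (by omega)]
  omega

theorem cartanN_mem (q : ℂˣ) (ε : ℤˣ) (r : ℤ) (l : ℤ) : cartanN N q l ∈ QMat.fixed N q ε r := by
  have h1 : ((q ^ (-l) : ℂˣ) : ℂ) * ((q ^ l : ℂˣ) : ℂ) = 1 := by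
    rw [← Units.val_mul, ← zpow_add, neg_add_cancel, zpow_zero, Units.val_one]
  have hr : (pos N 1).rev = pos N N := by rw [← pos_rev, Fin.rev_rev]
  rw [QMat.mem_fixed, cartanN, map_sub, QMat.sigma_single, QMat.sigma_single, map_add, map_add]
  simp only [QDiff.sigma_mono, pos_rev, hr, zero_mul, zero_sub, neg_neg, zpow_zero, Units.val_one,
    Int.cast_one, one_mul, Int.zero_ediv, mul_zero, zero_add, sub_zero, h1, neg_sub,
    mul_comm ((q ^ l : ℂˣ) : ℂ) ((q ^ (-l) : ℂˣ) : ℂ)]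
  rw [add_comm (QDiff.mono q 0 (-l) ((q ^ l : ℂˣ) : ℂ)),
    add_comm (QDiff.mono q 0 (-l) (1 : ℂ))]

/-- `cartan N q s i l` as an element of degree `0` of the central extension. -/
def cartanElt {s : ℂˣ} (hs : s ^ 2 = q) (ε : ℤˣ) (r : ℤ) (i : ℕ) (l : ℤ) : grade N q ε r 0 :=
  ⟨mk ⟨cartan N q s i l, cartan_mem hs ε r i l⟩ 0, mk_mem_grade_zero _ _
    (diag_of_sub (single_eq_add _ _ _) (single_eq_add _ _ _))⟩

/-- `cartanN N q l` as an element of degree `0` of the central extension. -/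
def cartanNElt (N : ℕ) [NeZero N] (q : ℂˣ) (ε : ℤˣ) (r : ℤ) (l : ℤ) : grade N q ε r 0 :=
  ⟨mk ⟨cartanN N q l, cartanN_mem q ε r l⟩ 0, mk_mem_grade_zero _ _
    (diag_of_sub (Matrix.single_add _ _ _ _) (Matrix.single_add _ _ _ _))⟩

/-- The central element `C`. -/
def centralElt (N : ℕ) [NeZero N] (q : ℂˣ) (ε : ℤˣ) (r : ℤ) : grade N q ε r 0 :=
  ⟨mk 0 1, mk_mem_grade_zero _ _ fun _ _ _ _ h => absurd (map_zero _) h⟩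

/-- The label `Δ_{i,l}`. -/
def label {s : ℂˣ} (hs : s ^ 2 = q) (lam : Module.Dual ℂ (grade N q ε r 0)) (i : ℕ) (l : ℤ) : ℂ :=
  lam (cartanElt hs ε r i l)

/-- The special label `Δ_{N,l}`. -/
def labelN (lam : Module.Dual ℂ (grade N q ε r 0)) (l : ℤ) : ℂ := lam (cartanNElt N q ε r l)

/-- The central charge `c`. -/
def charge (lam : Module.Dual ℂ (grade N q ε r 0)) : ℂ := lam (centralElt N q ε r)

end SHat

/-! ### Doubly infinite formal series and quasipolynomials -/

/-- The formal series `∑ a_l x ^ (-l)`, given as the function sending `n` to the coefficient of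
`x ^ n`. -/
def genSeries (a : ℤ → ℂ) : ℤ → ℂ := fun n => a (-n)

/-- The product of a polynomial with a doubly infinite formal series in the same variable. -/
def polyMulSeries (b : Polynomial ℂ) (F : ℤ → ℂ) : ℤ → ℂ :=
  fun n => b.sum fun k a => a * F (n - k)

/-- Quasipolynomials: linear combinations of functions `p(x) q ^ (α x)`, with `p` a polynomial and
`α ∈ ℂ`. -/
def IsQuasipolynomial (q : ℂˣ) (P : ℂ → ℂ) : Prop :=
  P ∈ Submodule.span ℂ {f : ℂ → ℂ | ∃ (p : Polynomial ℂ) (α : ℂ),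
    f = fun x => p.eval x * (q : ℂ) ^ (α * x)}

/-- Even quasipolynomials: quasipolynomials annihilated by `B(d/dx)` for a nonzero even
polynomial `B`. -/
def IsEvenQuasipolynomial (q : ℂˣ) (P : ℂ → ℂ) : Prop :=
  IsQuasipolynomial q P ∧ ∃ B : Polynomial ℂ, B ≠ 0 ∧ B.comp (-Polynomial.X) = B ∧
    ∀ x, (B.sum fun k b => b * iteratedDeriv k P x) = 0

end

/-!
Write `g` for the central extension with its principal gradation and `ℓ : g → ℂ` for the weight,
extended by zero to the components of nonzero degree. All conditions of the theorem are compared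
with the existence of linear recurrences for certain sequences of values of `ℓ`.

*Doubly infinite matrices.* The operators act on vector-valued Laurent polynomials, with basis
`z ^ κ e_a` at the position `κ N + a`, and replacing `T_q` by `q ^ κ T`, for a formal variable `T`,
at these positions turns a homogeneous operator of degree `d` into a matrix with entries in
`ℂ[T, T⁻¹]` at the places `(Q + d, Q)` (`QMat.ent`). In this picture `ℓ([E, X])`, for `E` and `X`
of opposite degrees, is a sum over `N` diagonal places in which the products of the entries of `E`
and `X` are paired with differences of diagonal values of `ℓ`; the cocycle is what makes these
differences compatible with translation by `N` (`SHat.apply_lie_eq_sum`). The consecutive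
differences form the sequences `SHat.rootSeq`, indexed by the positions. Translation by a period
and the anti-involution relate any of them to those given by the labels in the theorem
(`SHat.hasRec_rootSeq`). A sequence satisfies a linear recurrence if its annihilator in `ℂ[T, T⁻¹]`
(`LinRec.annIdeal`) is nonzero, hence of finite codimension.

*Quasifinite implies recurrences.* If the component of degree `-1` is finite-dimensional,
infinitely many elements with independent entries at a given place have a nontrivial combination
`x` that kills the highest weight vector of the irreducible module. Then `ℓ([e, x]) = 0` for all
`e` of degree `1`, and this says that the entry of `x` annihilates the sequence
(`SHat.hasRec_of_isQuasifinite`).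

*Recurrences imply quasifinite.* The elements of degree `-j` whose entry at each place `(P, P + j)`
annihilates all sequences with index in `[P, P + j)` have finite codimension in degree `-j`,
because of periodicity. They are stable under brackets with elements of nonnegative degree less
than `j`, and `ℓ` vanishes on their brackets with elements of degree `j`, so they kill the highest
weight vector of the irreducible module (`HighestWeight.smul_hwVector_mem_maxProper`). Hence each
`g_d v` is finite-dimensional for the highest weight vector `v`. The vectors `w` with all `g_d w`
finite-dimensional form a submodule, so all vectors have this property, and induction on the degree
gives quasifiniteness (`HighestWeight.isQuasifinite_of_orbit`).

*The highest weight vector.* Both directions use that the highest weight vector does not lie in the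
maximal proper graded submodule. Instead of the Poincaré–Birkhoff–Witt theorem this uses an action
of `g` on the enveloping algebra `U(n)` of its negative part, determined by the value at `1` and
`ρ(x)(f t) = f ρ(x) t + ρ([x, f]) t` for `f ∈ n` (`HighestWeight.act`). The Verma module maps to
`U(n)`, and the augmentation of `U(n)` gives a functional with value `1` on the highest weight
vector that vanishes on the maximal proper graded submodule (`HighestWeight.coeffTop_maxProper`).

*Quasipolynomials.* A sequence satisfies a linear recurrence if and only if it is a combination of
sequences `n ^ k μ ^ n` with `μ ≠ 0`. As `|q| ≠ 1`, the logarithm of `q` is nonzero, and `μ ^ n` is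
interpolated by some `q ^ (α x)`. Every quasipolynomial is annihilated by a nonzero even
differential operator `B(d/dx) B(-d/dx)`. The two special sequences of labels are even, so
replacing an interpolating quasipolynomial by its even part gives an even function
(`LinRec.HasRec.exists_even`).
-/

noncomputable section

/-! ### Universal enveloping algebras -/

namespace UniversalEnvelopingAlgebra

variable {L : Type*} [LieRing L] [LieAlgebra ℂ L]

theorem adjoin_range_ι :
    Algebra.adjoin ℂ (Set.range (ι ℂ : L → UniversalEnvelopingAlgebra ℂ L)) = ⊤ := by
  have hs : Function.Surjective (mkAlgHom ℂ L) := Quotient.mk_surjective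
  have h := congrArg (Subalgebra.map (mkAlgHom ℂ L))
    (TensorAlgebra.adjoin_range_ι (R := ℂ) (M := L))
  rw [AlgHom.map_adjoin, Algebra.map_top, (AlgHom.range_eq_top _).2 hs, ← Set.range_comp] at h
  exact h

/-- A subspace containing `1` and stable under left multiplication by the Lie algebra is the whole
enveloping algebra. -/
theorem induction_left {p : UniversalEnvelopingAlgebra ℂ L → Prop} (one : p 1)
    (ι_mul : ∀ x u, p u → p (ι ℂ x * u)) (add : ∀ u v, p u → p v → p (u + v))
    (smul : ∀ (a : ℂ) u, p u → p (a • u)) (u : UniversalEnvelopingAlgebra ℂ L) : p u := by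
  have key : ∀ w, ∀ u, p u → p (w * u) := by
    intro w
    have hw : w ∈ Algebra.adjoin ℂ (Set.range (ι ℂ : L → UniversalEnvelopingAlgebra ℂ L)) := by
      rw [adjoin_range_ι]; trivial
    induction hw using Algebra.adjoin_induction with
    | mem x hx =>
      obtain ⟨y, rfl⟩ := hx
      exact ι_mul y
    | algebraMap a =>
      intro u hu
      rw [← Algebra.smul_def]
      exact smul a u hu
    | add x y _ _ hx hy =>
      intro u hu
      rw [add_mul]
      exact add _ _ (hx u hu) (hy u hu)
    | mul x y _ _ hx hy =>
      intro u hu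
      rw [mul_assoc]
      exact hx _ (hy u hu)
  simpa using key u 1 one

end UniversalEnvelopingAlgebra

/-! ### The action of a graded Lie algebra on the enveloping algebra of its negative part -/

namespace HighestWeight

open UniversalEnvelopingAlgebra

attribute [local instance] LieRing.ofAssociativeRing

variable {g : Type*} [LieRing g] [LieAlgebra ℂ g] (G : ℤ → Submodule ℂ g)

/-- A gradation of a Lie algebra by the integers whose component of degree `0` is abelian. -/
structure IsLieGrading : Prop where
  internal : DirectSum.IsInternal G
  lie_mem : ∀ {d e : ℤ} {x y : g}, x ∈ G d → y ∈ G e → ⁅x, y⁆ ∈ G (d + e)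
  lie_zero : ∀ {x y : g}, x ∈ G 0 → y ∈ G 0 → ⁅x, y⁆ = 0

variable {G}

theorem IsLieGrading.induction (hG : IsLieGrading G) {p : g → Prop}
    (hom : ∀ d, ∀ x ∈ G d, p x) (add : ∀ x y, p x → p y → p (x + y)) (x : g) : p x := by
  have hx : x ∈ ⨆ d, G d := by rw [hG.internal.submodule_iSup_eq_top]; trivial
  exact Submodule.iSup_induction G (motive := p) hx hom (hom 0 0 (zero_mem _)) add

theorem mem_neg_induction {p : g → Prop} {x : g} (hx : x ∈ ⨆ (d : ℤ) (_ : d < 0), G d)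
    (hom : ∀ d < 0, ∀ x ∈ G d, p x) (add : ∀ x y, p x → p y → p (x + y)) : p x := by
  have h0 : p 0 := hom (-1) (by norm_num) 0 (zero_mem _)
  refine Submodule.iSup_induction _ (motive := p) hx (fun d y hy => ?_) h0 add
  by_cases hd : d < 0
  · rw [iSup_pos hd] at hy
    exact hom d hd y hy
  · rw [iSup_neg hd, Submodule.mem_bot] at hy
    rwa [hy]

theorem mem_neg {d : ℤ} (hd : d < 0) {x : g} (hx : x ∈ G d) :
    x ∈ ⨆ (d : ℤ) (_ : d < 0), G d :=
  Submodule.mem_iSup_of_mem d (Submodule.mem_iSup_of_mem hd hx)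

/-- The subalgebra of the elements of negative degree. -/
def neg (hG : IsLieGrading G) : LieSubalgebra ℂ g :=
  { (⨆ (d : ℤ) (_ : d < 0), G d : Submodule ℂ g) with
    lie_mem' := by
      intro x y hx hy
      refine mem_neg_induction (p := fun x => ⁅x, y⁆ ∈ ⨆ (d : ℤ) (_ : d < 0), G d) hx
        (fun d hd x hx => ?_) (fun x x' h h' => by rw [add_lie]; exact add_mem h h')
      refine mem_neg_induction (p := fun y => ⁅x, y⁆ ∈ ⨆ (d : ℤ) (_ : d < 0), G d) hy
        (fun e he y hy => ?_) (fun x x' h h' => by rw [lie_add]; exact add_mem h h')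
      exact mem_neg (by omega) (hG.lie_mem hx hy) }

/-- The linear map given on the components. -/
def ofComponents (hG : IsLieGrading G) {M : Type*} [AddCommGroup M] [Module ℂ M]
    (f : ∀ d, G d →ₗ[ℂ] M) : g →ₗ[ℂ] M :=
  DirectSum.toModule ℂ ℤ M f ∘ₗ
    (LinearEquiv.ofBijective (DirectSum.coeLinearMap G) hG.internal).symm.toLinearMap

theorem ofComponents_apply (hG : IsLieGrading G) {M : Type*} [AddCommGroup M] [Module ℂ M]
    (f : ∀ d, G d →ₗ[ℂ] M) {d : ℤ} {x : g} (hx : x ∈ G d) :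
    ofComponents hG f x = f d ⟨x, hx⟩ := by
  have h : (LinearEquiv.ofBijective (DirectSum.coeLinearMap G) hG.internal).symm x
      = DirectSum.lof ℂ ℤ (fun d => G d) d ⟨x, hx⟩ := by
    rw [LinearEquiv.symm_apply_eq]
    exact (DirectSum.coeLinearMap_lof G d ⟨x, hx⟩).symm
  rw [ofComponents, LinearMap.comp_apply, LinearEquiv.coe_coe, h, DirectSum.toModule_lof]

variable (hG : IsLieGrading G) (lam : Module.Dual ℂ (G 0))

/-- The extension of `lam` by zero on the components of nonzero degree. -/
def extend : g →ₗ[ℂ] ℂ := ofComponents hG fun d => if h : d = 0 then h ▸ lam else 0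

theorem extend_zero (x : G 0) : extend hG lam x = lam x := by
  rw [extend, ofComponents_apply hG _ x.2]; simp

theorem extend_of_ne {d : ℤ} (hd : d ≠ 0) {x : g} (hx : x ∈ G d) : extend hG lam x = 0 := by
  rw [extend, ofComponents_apply hG _ hx, dif_neg hd]; rfl

theorem extend_lie {d e : ℤ} (hd : 0 ≤ d) (he : 0 ≤ e) {x y : g} (hx : x ∈ G d) (hy : y ∈ G e) :
    extend hG lam ⁅x, y⁆ = 0 := by
  rcases eq_or_ne (d + e) 0 with h | h
  · obtain rfl : d = 0 := by omega
    obtain rfl : e = 0 := by omega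
    rw [hG.lie_zero hx hy, map_zero]
  · exact extend_of_ne hG lam h (hG.lie_mem hx hy)

/-- The values of the action of the graded Lie algebra at the highest weight vector `1`. -/
def actOne : g →ₗ[ℂ] UniversalEnvelopingAlgebra ℂ (neg hG) :=
  (ofComponents hG fun d => if h : d < 0 then
      (ι ℂ : neg hG →ₗ⁅ℂ⁆ _).toLinearMap ∘ₗ Submodule.inclusion
        (show G d ≤ (neg hG).toSubmodule from fun _ hx => mem_neg h hx) else 0)
    + (Algebra.linearMap ℂ _) ∘ₗ extend hG lam

theorem actOne_of_nonneg {d : ℤ} (hd : 0 ≤ d) {x : g} (hx : x ∈ G d) :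
    actOne hG lam x = algebraMap ℂ _ (extend hG lam x) := by
  rw [actOne, LinearMap.add_apply, ofComponents_apply hG _ hx, dif_neg (by omega)]
  simp

theorem actOne_neg (f : neg hG) : actOne hG lam f = ι ℂ f := by
  obtain ⟨f, hf⟩ := f
  have key : ∀ x ∈ ⨆ (d : ℤ) (_ : d < 0), G d, ∃ hx : x ∈ neg hG,
      actOne hG lam x = ι ℂ (⟨x, hx⟩ : neg hG) := by
    intro x hx
    refine mem_neg_induction (p := fun x => ∃ hx : x ∈ neg hG,
      actOne hG lam x = ι ℂ (⟨x, hx⟩ : neg hG)) hx (fun d hd x hx => ?_) ?_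
    · refine ⟨mem_neg hd hx, ?_⟩
      rw [actOne, LinearMap.add_apply, ofComponents_apply hG _ hx, dif_pos hd,
        LinearMap.comp_apply, LinearMap.comp_apply, extend_of_ne hG lam hd.ne hx, map_zero,
        add_zero]
      rfl
    · rintro x y ⟨hx, hx'⟩ ⟨hy, hy'⟩
      refine ⟨add_mem hx hy, ?_⟩
      rw [map_add, hx', hy', ← map_add]
      rfl
  exact (key f hf).2

/-- The action of the negative part on the linear maps from `g` to `U(n)`, the tensor product of
left multiplication on `U(n)` with the dual of the adjoint representation. -/
def homAct : neg hG →ₗ⁅ℂ⁆ Module.End ℂ (g →ₗ[ℂ] UniversalEnvelopingAlgebra ℂ (neg hG)) where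
  toFun f :=
    { toFun := fun F => LinearMap.mulLeft ℂ (ι ℂ f) ∘ₗ F - F ∘ₗ (LieAlgebra.ad ℂ g (f : g))
      map_add' := fun F F' => by ext x; simp [mul_add]; abel
      map_smul' := fun a F => by ext x; simp [smul_sub] }
  map_add' f f' := by ext F x; simp [add_mul]; abel
  map_smul' a f := by ext F x; simp [smul_sub]
  map_lie' := by
    intro f f'
    ext F x
    simp [Ring.lie_def, sub_mul, mul_sub, mul_assoc]
    abel

/-- The action of `g` on `U(n)`, for `n` the negative part. It is determined by `actOne` and
`ρ(x)(f t) = f ρ(x) t + ρ([x, f]) t` for `f ∈ n`. -/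
def act : g →ₗ[ℂ] Module.End ℂ (UniversalEnvelopingAlgebra ℂ (neg hG)) where
  toFun x :=
    { toFun := fun t => lift ℂ (homAct hG) t (actOne hG lam) x
      map_add' := fun t t' => by simp
      map_smul' := fun a t => by simp }
  map_add' x y := by ext t; simp
  map_smul' a x := by ext t; simp

theorem act_one (x : g) : act hG lam x 1 = actOne hG lam x := by
  simp [act]

theorem act_ι_mul (x : g) (f : neg hG) (t : UniversalEnvelopingAlgebra ℂ (neg hG)) :
    act hG lam x (ι ℂ f * t) = ι ℂ f * act hG lam x t + act hG lam ⁅x, (f : g)⁆ t := by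
  have h : lift ℂ (homAct hG) (ι ℂ f * t) (actOne hG lam)
      = homAct hG f (lift ℂ (homAct hG) t (actOne hG lam)) := by
    rw [map_mul, lift_ι_apply]; rfl
  change lift ℂ (homAct hG) (ι ℂ f * t) (actOne hG lam) x = _
  rw [h, ← lie_skew x (f : g), map_neg, LinearMap.neg_apply, ← sub_eq_add_neg]
  rfl

theorem act_neg (f : neg hG) (t : UniversalEnvelopingAlgebra ℂ (neg hG)) :
    act hG lam f t = ι ℂ f * t := by
  induction t using induction_left generalizing f with
  | one => rw [act_one, actOne_neg, mul_one]
  | ι_mul f' t ht =>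
    rw [act_ι_mul, ht, ← LieSubalgebra.coe_bracket, ht, LieHom.map_lie, Ring.lie_def]
    noncomm_ring
  | add u v hu hv => rw [map_add, hu, hv, mul_add]
  | smul a u hu => rw [map_smul, hu, mul_smul_comm]

theorem act_lie_one (x y : g) :
    act hG lam ⁅x, y⁆ 1 = act hG lam x (act hG lam y 1) - act hG lam y (act hG lam x 1) := by
  have hr : ∀ (x : g) (f : neg hG), act hG lam ⁅x, (f : g)⁆ 1
      = act hG lam x (act hG lam f 1) - act hG lam f (act hG lam x 1) := by
    intro x f
    rw [act_neg hG lam f, act_neg hG lam f, act_ι_mul]; abel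
  refine hG.induction (p := fun x => act hG lam ⁅x, y⁆ 1
      = act hG lam x (act hG lam y 1) - act hG lam y (act hG lam x 1)) (fun d x hx => ?_)
    (fun x x' h h' => by simp only [add_lie, map_add, LinearMap.add_apply, h, h']; abel) x
  refine hG.induction (p := fun y => act hG lam ⁅x, y⁆ 1
      = act hG lam x (act hG lam y 1) - act hG lam y (act hG lam x 1)) (fun e y hy => ?_)
    (fun y y' h h' => by simp only [lie_add, map_add, LinearMap.add_apply, h, h']; abel) y
  rcases lt_or_ge e 0 with he | he
  · exact hr x ⟨y, mem_neg he hy⟩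
  rcases lt_or_ge d 0 with hd | hd
  · have := hr y ⟨x, mem_neg hd hx⟩
    simp only at this
    rw [← lie_skew, map_neg, LinearMap.neg_apply, this, neg_sub]
  · have hs : ∀ (x : g) (a : ℂ), act hG lam x (algebraMap ℂ _ a) = a • actOne hG lam x := by
      intro x a
      rw [Algebra.algebraMap_eq_smul_one, map_smul, act_one]
    rw [act_one, act_one, act_one, actOne_of_nonneg hG lam hd hx, actOne_of_nonneg hG lam he hy,
      actOne_of_nonneg hG lam (by omega : 0 ≤ d + e) (hG.lie_mem hx hy),
      extend_lie hG lam hd he hx hy, hs, hs, actOne_of_nonneg hG lam hd hx,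
      actOne_of_nonneg hG lam he hy, Algebra.algebraMap_eq_smul_one, Algebra.algebraMap_eq_smul_one,
      Algebra.algebraMap_eq_smul_one, smul_comm, sub_self, zero_smul]

/-- The operators `act` form a representation of `g`. -/
theorem act_lie (x y : g) (t : UniversalEnvelopingAlgebra ℂ (neg hG)) :
    act hG lam ⁅x, y⁆ t = act hG lam x (act hG lam y t) - act hG lam y (act hG lam x t) := by
  induction t using induction_left generalizing x y with
  | one => exact act_lie_one hG lam x y
  | ι_mul f t ht =>
    have h : ⁅⁅x, y⁆, (f : g)⁆ = ⁅x, ⁅y, (f : g)⁆⁆ - ⁅y, ⁅x, (f : g)⁆⁆ := lie_lie x y (f : g)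
    rw [act_ι_mul, act_ι_mul, act_ι_mul, map_add, map_add, act_ι_mul, act_ι_mul, h, map_sub,
      LinearMap.sub_apply, ht x y, ht x ⁅y, _⁆, ht y ⁅x, _⁆, mul_sub]
    abel
  | add u v hu hv => simp only [map_add, hu, hv]; abel
  | smul a u hu => simp only [map_smul, hu, smul_sub]

/-- The representation `act` of the enveloping algebra. -/
def rep : UniversalEnvelopingAlgebra ℂ g →ₐ[ℂ] Module.End ℂ
    (UniversalEnvelopingAlgebra ℂ (neg hG)) :=
  lift ℂ { act hG lam with map_lie' := fun {x y} => LinearMap.ext fun t => act_lie hG lam x y t }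

theorem rep_ι (x : g) : rep hG lam (ι ℂ x) = act hG lam x := lift_ι_apply ℂ _ x

theorem rep_vermaIdeal {u : UniversalEnvelopingAlgebra ℂ g} (hu : u ∈ vermaIdeal G lam) :
    rep hG lam u 1 = 0 := by
  induction hu using Submodule.span_induction with
  | mem u hu =>
    rcases hu with ⟨d, hd, x, hx, rfl⟩ | ⟨h, rfl⟩
    · rw [rep_ι, act_one, actOne_of_nonneg hG lam hd.le hx, extend_of_ne hG lam hd.ne' hx, map_zero]
    · rw [map_sub, LinearMap.sub_apply, rep_ι, act_one, actOne_of_nonneg hG lam le_rfl h.2,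
        extend_zero, AlgHom.commutes, Module.algebraMap_end_apply, Algebra.algebraMap_eq_smul_one,
        sub_self]
  | zero => simp
  | add u v _ _ hu hv => rw [map_add, LinearMap.add_apply, hu, hv, add_zero]
  | smul a u _ hu => rw [smul_eq_mul, map_mul, Module.End.mul_apply, hu, map_zero]

/-- The augmentation of `U(n)`. -/
def aug : UniversalEnvelopingAlgebra ℂ (neg hG) →ₐ[ℂ] ℂ := lift ℂ (0 : neg hG →ₗ⁅ℂ⁆ ℂ)

theorem aug_ι (f : neg hG) : aug hG (ι ℂ f) = 0 := by rw [aug, lift_ι_apply]; rfl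

/-- The functional on the Verma module that takes the coefficient of the highest weight vector: a
vector is first mapped to `U(n)`. -/
def coeffTop : Verma G lam →ₗ[ℂ] ℂ :=
  (aug hG).toLinearMap ∘ₗ
    ((vermaIdeal G lam).restrictScalars ℂ).liftQ
      (LinearMap.applyₗ (R := ℂ) (1 : UniversalEnvelopingAlgebra ℂ (neg hG)) ∘ₗ
        (rep hG lam).toLinearMap) (fun _ hu => rep_vermaIdeal hG lam hu)

theorem coeffTop_mk (u : UniversalEnvelopingAlgebra ℂ g) :
    coeffTop hG lam ((vermaIdeal G lam).mkQ u) = aug hG (rep hG lam u 1) := rfl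

end HighestWeight

/-! ### The highest weight vector and the maximal proper graded submodule -/

namespace HighestWeight

open UniversalEnvelopingAlgebra

attribute [local instance] LieRing.ofAssociativeRing

variable {g : Type*} [LieRing g] [LieAlgebra ℂ g] {G : ℤ → Submodule ℂ g}

theorem ι_smul_smul {V : Type*} [AddCommGroup V] [Module (UniversalEnvelopingAlgebra ℂ g) V]
    (x y : g) (w : V) :
    ι ℂ x • ι ℂ y • w = ι ℂ y • ι ℂ x • w + ι ℂ ⁅x, y⁆ • w := by
  rw [LieHom.map_lie, Ring.lie_def, sub_smul, mul_smul, mul_smul]; abel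

section Orbit

variable {V : Type*} [AddCommGroup V] [Module ℂ V] [Module (UniversalEnvelopingAlgebra ℂ g) V]
  [IsScalarTower ℂ (UniversalEnvelopingAlgebra ℂ g) V]

/-- The map `x ↦ x w` from the Lie algebra to a module. -/
def orbitMap (w : V) : g →ₗ[ℂ] V where
  toFun x := ι ℂ x • w
  map_add' x y := by rw [map_add, add_smul]
  map_smul' a x := by rw [map_smul, smul_assoc, RingHom.id_apply]

theorem orbitMap_apply (w : V) (x : g) : orbitMap w x = ι ℂ x • w := rfl

theorem smul_comm_enveloping (a : ℂ) (u : UniversalEnvelopingAlgebra ℂ g) (w : V) :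
    u • a • w = a • u • w := by
  rw [← algebraMap_smul (UniversalEnvelopingAlgebra ℂ g) a w, smul_smul, ← Algebra.commutes,
    mul_smul, algebraMap_smul]

end Orbit

variable (G) (lam : Module.Dual ℂ (G 0))

/-- The highest weight vector of the Verma module. -/
def hwVector : Verma G lam := (vermaIdeal G lam).mkQ 1

theorem smul_hwVector (u : UniversalEnvelopingAlgebra ℂ g) :
    u • hwVector G lam = (vermaIdeal G lam).mkQ u := by
  rw [hwVector, ← map_smul, smul_eq_mul, mul_one]

theorem exists_smul_hwVector (w : Verma G lam) :
    ∃ u : UniversalEnvelopingAlgebra ℂ g, w = u • hwVector G lam := by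
  obtain ⟨u, rfl⟩ := (vermaIdeal G lam).mkQ_surjective w
  exact ⟨u, (smul_hwVector G lam u).symm⟩

theorem pos_smul_hwVector {d : ℤ} (hd : 0 < d) {x : g} (hx : x ∈ G d) :
    ι ℂ x • hwVector G lam = 0 := by
  rw [smul_hwVector]
  exact (Submodule.Quotient.mk_eq_zero _).2 (Submodule.subset_span (Or.inl ⟨d, hd, x, hx, rfl⟩))

theorem zero_smul_hwVector {x : g} (hx : x ∈ G 0) :
    ι ℂ x • hwVector G lam = lam ⟨x, hx⟩ • hwVector G lam := by
  rw [smul_hwVector, ← sub_eq_zero, hwVector, ← LinearMap.map_smul_of_tower, ← map_sub,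
    ← Algebra.algebraMap_eq_smul_one]
  exact (Submodule.Quotient.mk_eq_zero _).2 (Submodule.subset_span (Or.inr ⟨⟨x, hx⟩, rfl⟩))

/-- The span of the vectors obtained from the highest weight vector by applying elements of negative
degrees, of total degree `d`. -/
def negSpan (d : ℤ) : Submodule ℂ (Verma G lam) :=
  Submodule.span ℂ {w | ∃ L : List (ℤ × g), (∀ p ∈ L, p.1 < 0 ∧ p.2 ∈ G p.1) ∧
    (L.map Prod.fst).sum = d ∧ w = (L.map fun p => ι ℂ p.2).prod • hwVector G lam}

variable {G}

theorem ι_smul_negSpan_of_neg {d e : ℤ} (he : e < 0) {x : g} (hx : x ∈ G e) {w : Verma G lam}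
    (hw : w ∈ negSpan G lam d) : ι ℂ x • w ∈ negSpan G lam (e + d) := by
  induction hw using Submodule.span_induction with
  | mem w hw =>
    obtain ⟨L, hL, rfl, rfl⟩ := hw
    refine Submodule.subset_span ⟨(e, x) :: L, ?_, by simp, by simp [mul_smul]⟩
    intro p hp
    rcases List.mem_cons.1 hp with rfl | hp
    · exact ⟨he, hx⟩
    · exact hL p hp
  | zero => rw [smul_zero]; exact zero_mem _
  | add u v _ _ hu hv => rw [smul_add]; exact add_mem hu hv
  | smul a u _ hu => rw [smul_comm_enveloping]; exact Submodule.smul_mem _ a hu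

theorem hwVector_mem_negSpan : hwVector G lam ∈ negSpan G lam 0 :=
  Submodule.subset_span ⟨[], by simp, rfl, by simp⟩

theorem ι_smul_negSpan (hG : IsLieGrading G) {d e : ℤ} {x : g} (hx : x ∈ G e) {w : Verma G lam}
    (hw : w ∈ negSpan G lam d) : ι ℂ x • w ∈ negSpan G lam (e + d) := by
  induction hw using Submodule.span_induction with
  | mem w hw =>
    obtain ⟨L, hL, rfl, rfl⟩ := hw
    induction L generalizing x e with
    | nil =>
      simp only [List.map_nil, List.prod_nil, List.sum_nil, one_smul, add_zero]
      rcases lt_trichotomy e 0 with he | rfl | he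
      · simpa using ι_smul_negSpan_of_neg lam he hx (hwVector_mem_negSpan lam)
      · rw [zero_smul_hwVector G lam hx]
        exact Submodule.smul_mem _ _ (hwVector_mem_negSpan lam)
      · rw [pos_smul_hwVector G lam he hx]
        exact zero_mem _
    | cons p L ih =>
      have hp := hL p List.mem_cons_self
      have hL' : ∀ p ∈ L, p.1 < 0 ∧ p.2 ∈ G p.1 := fun p hp => hL p (List.mem_cons_of_mem _ hp)
      simp only [List.map_cons, List.prod_cons, List.sum_cons, mul_smul]
      rw [ι_smul_smul]
      refine add_mem ?_ ?_
      · have := ι_smul_negSpan_of_neg lam hp.1 hp.2 (ih hx hL')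
        rwa [add_left_comm] at this
      · have := ih (hG.lie_mem hx hp.2) hL'
        rwa [add_assoc] at this
  | zero => rw [smul_zero]; exact zero_mem _
  | add u v _ _ hu hv => rw [smul_add]; exact add_mem hu hv
  | smul a u _ hu => rw [smul_comm_enveloping]; exact Submodule.smul_mem _ a hu

theorem vermaGrade_le_negSpan (hG : IsLieGrading G) (d : ℤ) :
    vermaGrade G lam d ≤ negSpan G lam d := by
  rw [vermaGrade, envGrade, Submodule.map_span, Submodule.span_le]
  rintro _ ⟨_, ⟨L, hL, rfl, rfl⟩, rfl⟩
  change (vermaIdeal G lam).mkQ _ ∈ _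
  rw [← smul_hwVector]
  induction L with
  | nil => simpa using hwVector_mem_negSpan lam
  | cons p L ih =>
    simp only [List.map_cons, List.prod_cons, List.sum_cons, mul_smul]
    exact ι_smul_negSpan lam hG (hL p List.mem_cons_self)
      (ih fun p hp => hL p (List.mem_cons_of_mem _ hp))

theorem ι_smul_vermaGrade {d e : ℤ} {x : g} (hx : x ∈ G e) {w : Verma G lam}
    (hw : w ∈ vermaGrade G lam d) : ι ℂ x • w ∈ vermaGrade G lam (e + d) := by
  obtain ⟨u, hu, rfl⟩ := hw
  refine ⟨ι ℂ x * u, ?_, rfl⟩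
  change u ∈ envGrade G d at hu
  change ι ℂ x * u ∈ envGrade G (e + d)
  induction hu using Submodule.span_induction with
  | mem u hu =>
    obtain ⟨L, hL, rfl, rfl⟩ := hu
    refine Submodule.subset_span ⟨(e, x) :: L, ?_, by simp, by simp⟩
    intro p hp
    rcases List.mem_cons.1 hp with rfl | hp
    · exact hx
    · exact hL p hp
  | zero => rw [mul_zero]; exact zero_mem _
  | add u v _ _ hu hv => rw [mul_add]; exact add_mem hu hv
  | smul a u _ hu => rw [mul_smul_comm]; exact Submodule.smul_mem _ a hu

theorem hwVector_mem_vermaGrade : hwVector G lam ∈ vermaGrade G lam 0 :=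
  ⟨1, Submodule.subset_span ⟨[], by simp, rfl, by simp⟩, rfl⟩

theorem sum_neg_of_ne_nil {L : List (ℤ × g)} (hL : ∀ p ∈ L, p.1 < 0 ∧ p.2 ∈ G p.1) (h : L ≠ []) :
    (L.map Prod.fst).sum < 0 := by
  have hle : ∀ L : List (ℤ × g), (∀ p ∈ L, p.1 < 0 ∧ p.2 ∈ G p.1) → (L.map Prod.fst).sum ≤ 0 := by
    intro L hL
    induction L with
    | nil => simp
    | cons p L ih =>
      have h1 := (hL p List.mem_cons_self).1
      have h2 := ih fun p hp => hL p (List.mem_cons_of_mem _ hp)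
      simp only [List.map_cons, List.sum_cons]
      omega
  cases L with
  | nil => exact absurd rfl h
  | cons p L =>
    have h1 := (hL p List.mem_cons_self).1
    have h2 := hle L fun p hp => hL p (List.mem_cons_of_mem _ hp)
    simp only [List.map_cons, List.sum_cons]
    omega

theorem negSpan_of_pos {d : ℤ} (hd : 0 < d) : negSpan G lam d = ⊥ := by
  rw [negSpan, Submodule.span_eq_bot]
  rintro w ⟨L, hL, hs, rfl⟩
  rcases eq_or_ne L [] with rfl | h
  · simp at hs; omega
  · have := sum_neg_of_ne_nil hL h; omega

theorem negSpan_zero : negSpan G lam 0 = Submodule.span ℂ {hwVector G lam} := by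
  apply le_antisymm
  · rw [negSpan, Submodule.span_le]
    rintro w ⟨L, hL, hs, rfl⟩
    rcases eq_or_ne L [] with rfl | h
    · simp
    · have := sum_neg_of_ne_nil hL h; omega
  · rw [Submodule.span_singleton_le_iff_mem]
    exact hwVector_mem_negSpan lam

variable (hG : IsLieGrading G)

theorem coeffTop_smul_hwVector (u : UniversalEnvelopingAlgebra ℂ g) :
    coeffTop hG lam (u • hwVector G lam) = aug hG (rep hG lam u 1) := by
  rw [smul_hwVector, coeffTop_mk]

theorem coeffTop_hwVector : coeffTop hG lam (hwVector G lam) = 1 := by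
  rw [← one_smul (UniversalEnvelopingAlgebra ℂ g) (hwVector G lam), coeffTop_smul_hwVector,
    map_one (rep hG lam), Module.End.one_apply, map_one]

theorem coeffTop_neg_smul {d : ℤ} (hd : d < 0) {x : g} (hx : x ∈ G d) (w : Verma G lam) :
    coeffTop hG lam (ι ℂ x • w) = 0 := by
  obtain ⟨u, rfl⟩ := exists_smul_hwVector G lam w
  rw [← mul_smul, coeffTop_smul_hwVector, map_mul, Module.End.mul_apply, rep_ι,
    act_neg hG lam ⟨x, mem_neg hd hx⟩, map_mul, aug_ι, zero_mul]

theorem coeffTop_vermaGrade {d : ℤ} (hd : d ≠ 0) {w : Verma G lam} (hw : w ∈ vermaGrade G lam d) :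
    coeffTop hG lam w = 0 := by
  replace hw := vermaGrade_le_negSpan lam hG d hw
  induction hw using Submodule.span_induction with
  | mem w hw =>
    obtain ⟨L, hL, hs, rfl⟩ := hw
    cases L with
    | nil => exact absurd hs.symm hd
    | cons p L =>
      simp only [List.map_cons, List.prod_cons, mul_smul]
      have hp := hL p List.mem_cons_self
      exact coeffTop_neg_smul lam hG hp.1 hp.2 _
  | zero => exact map_zero _
  | add u v _ _ hu hv => rw [map_add, hu, hv, add_zero]
  | smul a u _ hu => rw [map_smul, hu, smul_zero]

/-- The highest weight vector does not occur in elements of the maximal proper graded submodule. -/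
theorem coeffTop_maxProper {w : Verma G lam} (hw : w ∈ maxProper G lam) :
    coeffTop hG lam w = 0 := by
  have key : ∀ W : Submodule (UniversalEnvelopingAlgebra ℂ g) (Verma G lam),
      IsGraded G lam W ∧ W ≠ ⊤ → ∀ w ∈ W, coeffTop hG lam w = 0 := by
    rintro W ⟨hW, hW'⟩ w hw
    have hw : w ∈ W.restrictScalars ℂ := hw
    rw [hW] at hw
    refine Submodule.iSup_induction _ (motive := fun w => coeffTop hG lam w = 0) hw
      (fun d w hw => ?_) (map_zero _) fun u v hu hv => by rw [map_add, hu, hv, add_zero]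
    rcases eq_or_ne d 0 with rfl | hd
    · have h0 := vermaGrade_le_negSpan lam hG 0 hw.2
      rw [negSpan_zero, Submodule.mem_span_singleton] at h0
      obtain ⟨a, rfl⟩ := h0
      rw [map_smul, coeffTop_hwVector, smul_eq_mul, mul_one]
      by_contra ha
      -- a proper submodule cannot contain the generator
      apply hW'
      have hv : hwVector G lam ∈ W := by
        have := (W.restrictScalars ℂ).smul_mem a⁻¹ hw.1
        rwa [smul_smul, inv_mul_cancel₀ ha, one_smul] at this
      rw [eq_top_iff]
      intro w _
      obtain ⟨u, rfl⟩ := exists_smul_hwVector G lam w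
      exact W.smul_mem u hv
    · exact coeffTop_vermaGrade lam hG hd hw.2
  rw [maxProper, sSup_eq_iSup'] at hw
  refine Submodule.iSup_induction _ (motive := fun w => coeffTop hG lam w = 0) hw
    (fun W w hw => key W.1 W.2 w hw) (map_zero _)
    fun u v hu hv => by rw [map_add, hu, hv, add_zero]

theorem extend_smul_hwVector {x : g} (hx : x ∈ G 0) :
    ι ℂ x • hwVector G lam = extend hG lam x • hwVector G lam := by
  rw [zero_smul_hwVector G lam hx, ← extend_zero hG]

/-- If `x` of degree `-1` maps the highest weight vector into the maximal proper submodule, then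
`lam` vanishes on the brackets of `x` with elements of degree `1`. -/
theorem extend_lie_eq_zero {x e : g} (hx : x ∈ G (-1)) (he : e ∈ G 1)
    (h : ι ℂ x • hwVector G lam ∈ maxProper G lam) : extend hG lam ⁅e, x⁆ = 0 := by
  have h' := coeffTop_maxProper lam hG ((maxProper G lam).smul_mem (ι ℂ e) h)
  have h0 : ⁅e, x⁆ ∈ G 0 := by simpa using hG.lie_mem he hx
  rwa [ι_smul_smul, pos_smul_hwVector G lam one_pos he, smul_zero, zero_add,
    extend_smul_hwVector lam hG h0, map_smul, coeffTop_hwVector, smul_eq_mul, mul_one] at h'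

/-- In a quasifinite module, infinitely many elements of degree `-1` applied to the highest weight
vector are linearly dependent. -/
theorem IsQuasifinite.exists_combination (hfin : IsQuasifinite G lam) {x : ℕ → g}
    (hx : ∀ n, x n ∈ G (-1)) : ∃ c : ℕ →₀ ℂ, c ≠ 0 ∧
      ∀ e ∈ G 1, extend hG lam ⁅e, Finsupp.linearCombination ℂ x c⁆ = 0 := by
  have hmem : ∀ n,
      (maxProper G lam).mkQ (ι ℂ (x n) • hwVector G lam) ∈ irrGrade G lam (-1) := fun n =>
    ⟨_, by simpa using ι_smul_vermaGrade lam (hx n) (hwVector_mem_vermaGrade lam), rfl⟩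
  have hfin := hfin (-1)
  have hdep : ¬ LinearIndependent ℂ
      (fun n => (⟨_, hmem n⟩ : irrGrade G lam (-1))) := fun hli =>
    not_finite_iff_infinite.2 (inferInstance : Infinite ℕ) hli.finite_of_isNoetherian
  rw [linearIndependent_iff] at hdep
  push Not at hdep
  obtain ⟨c, hc, hc'⟩ := hdep
  have hcx : Finsupp.linearCombination ℂ x c ∈ G (-1) := by
    rw [Finsupp.linearCombination_apply]
    exact Submodule.sum_mem _ fun n _ => Submodule.smul_mem _ _ (hx n)
  refine ⟨c, hc', fun e he => extend_lie_eq_zero lam hG hcx he ?_⟩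
  rw [← Submodule.Quotient.mk_eq_zero]
  have h1 := congrArg (irrGrade G lam (-1)).subtype hc
  rw [Finsupp.apply_linearCombination, map_zero] at h1
  let f : g →ₗ[ℂ] Irr G lam := ((maxProper G lam).mkQ.restrictScalars ℂ) ∘ₗ
    orbitMap (hwVector G lam)
  have h2 : f (Finsupp.linearCombination ℂ x c) = 0 := by
    rw [Finsupp.apply_linearCombination]
    exact h1
  exact h2

/-- A family of subspaces of the negative components which is stable under the nonnegative part,
modulo elements of degree `0` on which `lam` vanishes, kills the highest weight vector of the
irreducible quotient. -/
theorem smul_hwVector_mem_maxProper {K : ℤ → Set g} (hK : ∀ j > 0, K j ⊆ G (-j))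
    (hlie : ∀ i j, 0 ≤ i → i < j → ∀ e ∈ G i, ∀ x ∈ K j, ⁅e, x⁆ ∈ K (j - i))
    (hlam : ∀ j > 0, ∀ e ∈ G j, ∀ x ∈ K j, extend hG lam ⁅e, x⁆ = 0) {j : ℤ} (hj : 0 < j) {x : g}
    (hx : x ∈ K j) : ι ℂ x • hwVector G lam ∈ maxProper G lam := by
  have hn : ∀ j > 0, ∀ x ∈ K j, x ∈ neg hG := fun j hj x hx => mem_neg (by omega) (hK j hj hx)
  -- the left ideal of `U(n)` generated by the family is stable under the action of `g`
  let Q : Submodule (UniversalEnvelopingAlgebra ℂ (neg hG))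
    (UniversalEnvelopingAlgebra ℂ (neg hG)) :=
    Submodule.span _ {t | ∃ j > 0, ∃ x : neg hG, (x : g) ∈ K j ∧ t = ι ℂ x}
  have hQ : ∀ t ∈ Q, ∀ y : g, act hG lam y t ∈ Q := by
    intro t ht
    induction ht using Submodule.span_induction with
    | mem t ht =>
      obtain ⟨j, hj, ⟨x, hxn⟩, hx, rfl⟩ := ht
      have hxQ : ∀ j > 0, ∀ x : g, ∀ hx : x ∈ K j, actOne hG lam x ∈ Q := fun j hj x hx => by
        rw [actOne_neg hG lam ⟨x, hn j hj x hx⟩]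
        exact Submodule.subset_span ⟨j, hj, ⟨x, hn j hj x hx⟩, hx, rfl⟩
      have hxQ' := hxQ j hj x hx
      rw [actOne_neg hG lam ⟨x, hxn⟩] at hxQ'
      refine hG.induction (fun i y hy => ?_) fun y y' h h' => by
        rw [map_add, LinearMap.add_apply]; exact add_mem h h'
      rcases lt_or_ge i 0 with hi | hi
      · rw [act_neg hG lam ⟨y, mem_neg hi hy⟩]
        exact Q.smul_mem _ hxQ'
      · rw [← mul_one (ι ℂ _), act_ι_mul, act_one, act_one, actOne_of_nonneg hG lam hi hy,
          ← Algebra.commutes]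
        refine add_mem (Q.smul_mem _ hxQ') ?_
        rcases lt_trichotomy i j with hij | rfl | hij
        · exact hxQ (j - i) (by omega) _ (hlie i j hi hij y hy x hx)
        · have h0 : ⁅y, x⁆ ∈ G 0 := by simpa using hG.lie_mem hy (hK i hj hx)
          rw [actOne_of_nonneg hG lam le_rfl h0, hlam i hj y hy x hx, map_zero]
          exact zero_mem _
        · have h0 := hG.lie_mem hy (hK j hj hx)
          rw [actOne_of_nonneg hG lam (by omega) h0, extend_of_ne hG lam (by omega) h0, map_zero]
          exact zero_mem _
    | zero => intro y; rw [map_zero]; exact zero_mem _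
    | add u v _ _ hu hv => intro y; rw [map_add]; exact add_mem (hu y) (hv y)
    | smul a t ht ih =>
      rw [smul_eq_mul]
      induction a using induction_left with
      | one => simpa using ih
      | ι_mul f a ha =>
        intro y
        rw [mul_assoc, act_ι_mul]
        exact add_mem (Q.smul_mem _ (ha y)) (ha _)
      | add u v hu hv => intro y; rw [add_mul, map_add]; exact add_mem (hu y) (hv y)
      | smul c u hu =>
        intro y; rw [smul_mul_assoc, map_smul]; exact (Q.restrictScalars ℂ).smul_mem c (hu y)
  have hrep : ∀ u : UniversalEnvelopingAlgebra ℂ g, ∀ t ∈ Q, rep hG lam u t ∈ Q := by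
    intro u
    induction u using induction_left with
    | one => intro t ht; simpa using ht
    | ι_mul y u hu =>
      intro t ht
      rw [map_mul, Module.End.mul_apply, rep_ι]
      exact hQ _ (hu t ht) y
    | add u v hu hv =>
      intro t ht; rw [map_add, LinearMap.add_apply]; exact add_mem (hu t ht) (hv t ht)
    | smul c u hu =>
      intro t ht; rw [map_smul, LinearMap.smul_apply]
      exact (Q.restrictScalars ℂ).smul_mem c (hu t ht)
  have haug : ∀ t ∈ Q, aug hG t = 0 := by
    intro t ht
    induction ht using Submodule.span_induction with
    | mem t ht => obtain ⟨j, hj, x, hx, rfl⟩ := ht; exact aug_ι hG x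
    | zero => exact map_zero _
    | add u v _ _ hu hv => rw [map_add, hu, hv, add_zero]
    | smul a t _ ih => rw [smul_eq_mul, map_mul, ih, mul_zero]
  have hker : ∀ u : UniversalEnvelopingAlgebra ℂ g,
      coeffTop hG lam (u • ι ℂ x • hwVector G lam) = 0 := by
    intro u
    rw [← mul_smul, coeffTop_smul_hwVector, map_mul, Module.End.mul_apply, rep_ι, act_one,
      actOne_neg hG lam ⟨x, hn j hj x hx⟩]
    exact haug _ (hrep u _ (Submodule.subset_span ⟨j, hj, ⟨x, hn j hj x hx⟩, hx, rfl⟩))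
  -- the submodule generated by `x` times the highest weight vector is graded and proper
  let W : Submodule (UniversalEnvelopingAlgebra ℂ g) (Verma G lam) :=
    Submodule.span _ {ι ℂ x • hwVector G lam}
  have hxW : ι ℂ x • hwVector G lam ∈ W := Submodule.mem_span_singleton_self _
  have hgr : IsGraded G lam W := by
    apply le_antisymm
    · intro w hw
      obtain ⟨u, rfl⟩ := Submodule.mem_span_singleton.1 hw
      clear hw
      induction u using induction_left with
      | one =>
        rw [one_smul]
        refine Submodule.mem_iSup_of_mem (-j + 0) ⟨hxW, ?_⟩
        exact ι_smul_vermaGrade lam (hK j hj hx) (hwVector_mem_vermaGrade lam)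
      | ι_mul y u hu =>
        rw [mul_smul]
        refine hG.induction (p := fun y => ι ℂ y • u • ι ℂ x • hwVector G lam
          ∈ ⨆ d : ℤ, W.restrictScalars ℂ ⊓ vermaGrade G lam d)
            (fun e y hy => ?_) (fun y y' h h' => by
            rw [map_add, add_smul]; exact add_mem h h') y
        refine Submodule.iSup_induction _ (motive := fun w => ι ℂ y • w
          ∈ ⨆ d : ℤ, W.restrictScalars ℂ ⊓ vermaGrade G lam d) hu (fun d w hw => ?_)
          (by rw [smul_zero]; exact zero_mem _)
          fun w w' h h' => by rw [smul_add]; exact add_mem h h'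
        exact Submodule.mem_iSup_of_mem (e + d) ⟨W.smul_mem _ hw.1, ι_smul_vermaGrade lam hy hw.2⟩
      | add u v hu hv => rw [add_smul]; exact add_mem hu hv
      | smul c u hu => rw [smul_assoc]; exact Submodule.smul_mem _ c hu
    · exact iSup_le fun d => inf_le_left
  have hne : W ≠ ⊤ := by
    intro h
    have hv : hwVector G lam ∈ W := by rw [h]; trivial
    obtain ⟨u, hu⟩ := Submodule.mem_span_singleton.1 hv
    have := hker u
    rw [hu, coeffTop_hwVector] at this
    exact one_ne_zero this
  exact (le_sSup (show W ∈ {W | IsGraded G lam W ∧ W ≠ ⊤} from ⟨hgr, hne⟩)) hxW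

/-! ### A criterion for quasifiniteness -/

section Finite

variable {V : Type*} [AddCommGroup V] [Module ℂ V] [Module (UniversalEnvelopingAlgebra ℂ g) V]
  [IsScalarTower ℂ (UniversalEnvelopingAlgebra ℂ g) V]

/-- The vectors `w` such that all the spaces `G d • w` are finite-dimensional form a submodule. -/
theorem finite_orbit (hG : IsLieGrading G) {v : V}
    (hv : ∀ d, FiniteDimensional ℂ ((G d).map (orbitMap v)))
    (u : UniversalEnvelopingAlgebra ℂ g) (d : ℤ) :
    FiniteDimensional ℂ ((G d).map (orbitMap (u • v))) := by
  induction u using induction_left generalizing d with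
  | one => rw [one_smul]; exact hv d
  | ι_mul x u hu =>
    rw [mul_smul]
    refine hG.induction
      (p := fun x => ∀ d, FiniteDimensional ℂ ((G d).map (orbitMap (ι ℂ x • u • v))))
      (fun e x hx d => ?_) (fun x y hx hy d => ?_) x d
    · let f : V →ₗ[ℂ] V :=
        { toFun := fun w => ι ℂ x • w
          map_add' := fun w w' => smul_add _ w w'
          map_smul' := fun a w => smul_comm_enveloping a _ w }
      have := hu d
      have := hu (d + e)
      have : FiniteDimensional ℂ (((G d).map (orbitMap (u • v))).map f) := inferInstance
      refine Submodule.finiteDimensional_of_le (S₂ := ((G d).map (orbitMap (u • v))).map f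
        ⊔ (G (d + e)).map (orbitMap (u • v))) ?_
      rintro _ ⟨y, hy, rfl⟩
      rw [orbitMap_apply, ι_smul_smul]
      exact Submodule.add_mem_sup ⟨_, ⟨y, hy, rfl⟩, rfl⟩ ⟨_, hG.lie_mem hy hx, rfl⟩
    · have := hx d
      have := hy d
      refine Submodule.finiteDimensional_of_le (S₂ := (G d).map (orbitMap (ι ℂ x • u • v))
        ⊔ (G d).map (orbitMap (ι ℂ y • u • v))) ?_
      rintro _ ⟨z, hz, rfl⟩
      rw [orbitMap_apply, map_add, add_smul, smul_add]
      exact Submodule.add_mem_sup ⟨z, hz, rfl⟩ ⟨z, hz, rfl⟩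
  | add u u' hu hu' =>
    have := hu d
    have := hu' d
    refine Submodule.finiteDimensional_of_le (S₂ := (G d).map (orbitMap (u • v))
      ⊔ (G d).map (orbitMap (u' • v))) ?_
    rintro _ ⟨z, hz, rfl⟩
    rw [orbitMap_apply, add_smul, smul_add]
    exact Submodule.add_mem_sup ⟨z, hz, rfl⟩ ⟨z, hz, rfl⟩
  | smul c u hu =>
    have := hu d
    refine Submodule.finiteDimensional_of_le (S₂ := (G d).map (orbitMap (u • v))) ?_
    rintro _ ⟨z, hz, rfl⟩
    rw [orbitMap_apply, smul_assoc, smul_comm_enveloping]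
    exact Submodule.smul_mem _ _ ⟨z, hz, rfl⟩

theorem exists_finiteDimensional_of_orbit {d : ℤ}
    (hv : ∀ w : V, FiniteDimensional ℂ ((G d).map (orbitMap w))) (F : Submodule ℂ V)
    [FiniteDimensional ℂ F] : ∃ F' : Submodule ℂ V, FiniteDimensional ℂ F' ∧
      ∀ x ∈ G d, ∀ w ∈ F, ι ℂ x • w ∈ F' := by
  obtain ⟨t, rfl⟩ := Module.Finite.iff_fg.1 (inferInstance : Module.Finite ℂ F)
  have := hv
  refine ⟨t.sup fun w => (G d).map (orbitMap w), inferInstance, fun x hx w hw => ?_⟩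
  induction hw using Submodule.span_induction with
  | mem w hw =>
    exact (Finset.le_sup (f := fun w => (G d).map (orbitMap w)) hw) ⟨x, hx, rfl⟩
  | zero => rw [smul_zero]; exact zero_mem _
  | add u v _ _ hu hv => rw [smul_add]; exact add_mem hu hv
  | smul a u _ hu => rw [smul_comm_enveloping]; exact Submodule.smul_mem _ a hu

end Finite

/-- If the negative components of `g` applied to the highest weight vector of the irreducible module
give finite-dimensional spaces, then the module is quasifinite. -/
theorem isQuasifinite_of_orbit (hG : IsLieGrading G) (lam : Module.Dual ℂ (G 0))
    (h : ∀ d < 0, FiniteDimensional ℂ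
      ((G d).map (orbitMap ((maxProper G lam).mkQ (hwVector G lam))))) : IsQuasifinite G lam := by
  set v : Irr G lam := (maxProper G lam).mkQ (hwVector G lam) with hvdef
  have hv : ∀ d, FiniteDimensional ℂ ((G d).map (orbitMap v)) := by
    intro d
    rcases lt_or_ge d 0 with hd | hd
    · exact h d hd
    · refine Submodule.finiteDimensional_of_le (S₂ := Submodule.span ℂ {v}) ?_
      rintro _ ⟨x, hx, rfl⟩
      rw [orbitMap_apply, hvdef, ← map_smul]
      rcases hd.eq_or_lt with rfl | hd
      · rw [zero_smul_hwVector G lam hx, LinearMap.map_smul_of_tower]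
        exact Submodule.smul_mem _ _ (Submodule.mem_span_singleton_self _)
      · rw [pos_smul_hwVector G lam hd hx, map_zero]
        exact zero_mem _
  have hall : ∀ (d : ℤ) (w : Irr G lam), FiniteDimensional ℂ ((G d).map (orbitMap w)) := by
    intro d w
    obtain ⟨w, rfl⟩ := (maxProper G lam).mkQ_surjective w
    obtain ⟨u, rfl⟩ := exists_smul_hwVector G lam w
    rw [map_smul]
    exact finite_orbit hG hv u d
  have hneg : ∀ n : ℕ, FiniteDimensional ℂ
      ((negSpan G lam (-n)).map ((maxProper G lam).mkQ.restrictScalars ℂ)) := by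
    intro n
    induction n using Nat.strong_induction_on with
    | _ n ih =>
    rcases Nat.eq_zero_or_pos n with rfl | hn
    · have : (-((0 : ℕ) : ℤ)) = 0 := rfl
      rw [this, negSpan_zero]
      infer_instance
    -- every spanning vector starts with a factor of degree `-(n - m)`, applied to degree `-m`
    have hF : ∀ m : Fin n, ∃ F' : Submodule ℂ (Irr G lam), FiniteDimensional ℂ F' ∧
        ∀ x ∈ G ((m : ℤ) - n),
          ∀ w ∈ (negSpan G lam (-(m : ℕ))).map ((maxProper G lam).mkQ.restrictScalars ℂ),
          ι ℂ x • w ∈ F' := fun m => by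
      have := ih m m.2
      exact exists_finiteDimensional_of_orbit (hall _) _
    choose F' hF' hF using hF
    refine Submodule.finiteDimensional_of_le (S₂ := ⨆ m, F' m) ?_
    rw [negSpan, Submodule.map_span, Submodule.span_le]
    rintro _ ⟨_, ⟨L, hL, hs, rfl⟩, rfl⟩
    cases L with
    | nil => simp at hs; omega
    | cons p L =>
      have hp := hL p List.mem_cons_self
      have hL' : ∀ p ∈ L, p.1 < 0 ∧ p.2 ∈ G p.1 := fun p hp => hL p (List.mem_cons_of_mem _ hp)
      have hle : (L.map Prod.fst).sum ≤ 0 := by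
        rcases eq_or_ne L [] with rfl | hne
        · simp
        · exact (sum_neg_of_ne_nil hL' hne).le
      simp only [List.map_cons, List.sum_cons] at hs
      obtain ⟨m, hm⟩ := Int.eq_ofNat_of_zero_le (neg_nonneg.2 hle)
      have hmn : m < n := by omega
      refine Submodule.mem_iSup_of_mem ⟨m, hmn⟩ ?_
      have h1 : p.2 ∈ G ((m : ℤ) - n) := by
        have : p.1 = (m : ℤ) - n := by omega
        rw [← this]; exact hp.2
      have h2 := hF ⟨m, hmn⟩ p.2 h1 ((maxProper G lam).mkQ
        ((L.map fun p => ι ℂ p.2).prod • hwVector G lam))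
        ⟨_, Submodule.subset_span ⟨L, hL', by simp only; omega, rfl⟩, rfl⟩
      simp only [List.map_cons, List.prod_cons, mul_smul]
      exact h2
  intro d
  have hle : irrGrade G lam d ≤
      (negSpan G lam d).map ((maxProper G lam).mkQ.restrictScalars ℂ) :=
    Submodule.map_mono (vermaGrade_le_negSpan lam hG d)
  rcases lt_or_ge 0 d with hd | hd
  · rw [negSpan_of_pos lam hd, Submodule.map_bot] at hle
    exact Submodule.finiteDimensional_of_le hle
  · obtain ⟨n, hn⟩ := Int.eq_ofNat_of_zero_le (neg_nonneg.2 hd)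
    obtain rfl : d = -n := by omega
    have := hneg n
    exact Submodule.finiteDimensional_of_le hle

end HighestWeight

/-! ### Linear recurrences as ideals of Laurent polynomials -/

namespace LinRec

open LaurentPolynomial Polynomial

/-- The linear map on Laurent polynomials with given values on the powers of the variable. -/
def lin {M : Type*} [AddCommGroup M] [Module ℂ M] (f : ℤ → M) : ℂ[T;T⁻¹] →ₗ[ℂ] M where
  toFun y := Finsupp.linearCombination ℂ f y.coeff
  map_add' x y := by rw [AddMonoidAlgebra.coeff_add, map_add]
  map_smul' a x := by rw [AddMonoidAlgebra.coeff_smul, map_smul, RingHom.id_apply]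

theorem lin_T {M : Type*} [AddCommGroup M] [Module ℂ M]
    (f : ℤ → M) (n : ℤ) : lin f (T n) = f n := by
  change Finsupp.linearCombination ℂ f (Finsupp.single n 1) = _
  rw [Finsupp.linearCombination_single, one_smul]

theorem induction {p : ℂ[T;T⁻¹] → Prop} (y : ℂ[T;T⁻¹]) (T : ∀ n, p (T n))
    (add : ∀ x y, p x → p y → p (x + y)) (smul : ∀ (a : ℂ) x, p x → p (a • x)) : p y :=
  LaurentPolynomial.induction_on' y add fun n a => by
    rw [← LaurentPolynomial.smul_eq_C_mul]; exact smul a _ (T n)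

theorem ext_lin {M : Type*} [AddCommGroup M] [Module ℂ M] {f g : ℂ[T;T⁻¹] →ₗ[ℂ] M}
    (h : ∀ n, f (T n) = g (T n)) : f = g := by
  refine LinearMap.ext fun y => ?_
  induction y using induction with
  | T n => exact h n
  | add x y hx hy => rw [map_add, map_add, hx, hy]
  | smul a x hx => rw [map_smul, map_smul, hx]

/-- The ideal of the recurrences satisfied by a doubly infinite sequence. -/
def annIdeal (f : ℤ → ℂ) : Ideal ℂ[T;T⁻¹] where
  carrier := {y | ∀ z, lin f (z * y) = 0}
  add_mem' hx hy z := by rw [mul_add, map_add, hx, hy, add_zero]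
  zero_mem' z := by rw [mul_zero, map_zero]
  smul_mem' c x hx z := by rw [smul_eq_mul, ← mul_assoc]; exact hx _

theorem mem_annIdeal {f : ℤ → ℂ} {y : ℂ[T;T⁻¹]} :
    y ∈ annIdeal f ↔ ∀ n, lin f (T n * y) = 0 := by
  refine ⟨fun h n => h _, fun h z => ?_⟩
  induction z using induction with
  | T n => exact h n
  | add x y hx hy => rw [add_mul, map_add, hx, hy, add_zero]
  | smul a x hx => rw [smul_mul_assoc, map_smul, hx, smul_zero]

/-- The sequence satisfies a nontrivial linear recurrence with constant coefficients. -/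
def HasRec (f : ℤ → ℂ) : Prop := ∃ y ∈ annIdeal f, y ≠ 0

theorem HasRec.add {f g : ℤ → ℂ} (hf : HasRec f) (hg : HasRec g) : HasRec (f + g) := by
  obtain ⟨y, hy, hy0⟩ := hf
  obtain ⟨z, hz, hz0⟩ := hg
  refine ⟨y * z, fun w => ?_, mul_ne_zero hy0 hz0⟩
  have h : lin (f + g) = lin f + lin g :=
    ext_lin fun n => by rw [LinearMap.add_apply, lin_T, lin_T, lin_T, Pi.add_apply]
  rw [h, LinearMap.add_apply, ← mul_assoc, hz, add_zero, mul_right_comm]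
  exact hy _

theorem HasRec.smul {f : ℤ → ℂ} (a : ℂ) (hf : HasRec f) : HasRec (a • f) := by
  obtain ⟨y, hy, hy0⟩ := hf
  refine ⟨y, fun w => ?_, hy0⟩
  have h : lin (a • f) = a • lin f :=
    ext_lin fun n => by rw [LinearMap.smul_apply, lin_T, lin_T, Pi.smul_apply]
  rw [h, LinearMap.smul_apply, hy, smul_zero]

theorem hasRec_zero : HasRec 0 := by
  refine ⟨1, fun w => ?_, one_ne_zero⟩
  have h : lin (0 : ℤ → ℂ) = 0 := ext_lin fun n => by rw [lin_T]; rfl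
  rw [h, LinearMap.zero_apply]

theorem HasRec.neg {f : ℤ → ℂ} (hf : HasRec f) : HasRec (-f) := by
  have := hf.smul (-1)
  rwa [neg_one_smul] at this

theorem HasRec.sum {ι : Type*} {s : Finset ι} {f : ι → ℤ → ℂ} (h : ∀ i ∈ s, HasRec (f i)) :
    HasRec (∑ i ∈ s, f i) :=
  Finset.sum_induction f HasRec (fun _ _ => HasRec.add) hasRec_zero h

/-- The automorphism `T ↦ u T` of the Laurent polynomials. -/
def twist (u : ℂˣ) : ℂ[T;T⁻¹] →ₗ[ℂ] ℂ[T;T⁻¹] := lin fun n => ((u ^ n : ℂˣ) : ℂ) • T n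

theorem twist_T (u : ℂˣ) (n : ℤ) : twist u (T n) = ((u ^ n : ℂˣ) : ℂ) • T n := lin_T _ n

theorem twist_twist_inv (u : ℂˣ) (y : ℂ[T;T⁻¹]) : twist u⁻¹ (twist u y) = y := by
  have h : twist u⁻¹ ∘ₗ twist u = LinearMap.id := ext_lin fun n => by
    rw [LinearMap.comp_apply, twist_T, map_smul, twist_T, smul_smul, ← Units.val_mul, inv_zpow,
      mul_inv_cancel, Units.val_one, one_smul, LinearMap.id_apply]
  exact LinearMap.congr_fun h y

theorem twist_T_mul (u : ℂˣ) (n : ℤ) (y : ℂ[T;T⁻¹]) :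
    twist u (T n * y) = ((u ^ n : ℂˣ) : ℂ) • (T n * twist u y) := by
  induction y using induction with
  | T m => rw [← T_add, twist_T, twist_T, mul_smul_comm, ← T_add, smul_smul, ← Units.val_mul,
      zpow_add]
  | add x y hx hy => rw [mul_add, map_add, hx, hy, map_add, mul_add, smul_add]
  | smul a x hx => rw [mul_smul_comm, map_smul, hx, map_smul, mul_smul_comm, smul_comm]

theorem lin_twist (u : ℂˣ) (f : ℤ → ℂ) (y : ℂ[T;T⁻¹]) :
    lin f (twist u y) = lin (fun n => ((u ^ n : ℂˣ) : ℂ) * f n) y := by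
  have h : lin f ∘ₗ twist u = lin (fun n => ((u ^ n : ℂˣ) : ℂ) * f n) := ext_lin fun n => by
    rw [LinearMap.comp_apply, twist_T, map_smul, lin_T, lin_T, smul_eq_mul]
  exact LinearMap.congr_fun h y

theorem twist_mem_annIdeal {u : ℂˣ} {f : ℤ → ℂ} {y : ℂ[T;T⁻¹]}
    (hy : y ∈ annIdeal fun n => ((u ^ n : ℂˣ) : ℂ) * f n) : twist u y ∈ annIdeal f := by
  rw [mem_annIdeal] at hy ⊢
  intro n
  have h := hy n
  rw [← lin_twist, twist_T_mul, map_smul, smul_eq_mul] at h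
  exact (mul_eq_zero.1 h).resolve_left (Units.ne_zero _)

theorem hasRec_twist {u : ℂˣ} {f : ℤ → ℂ} :
    HasRec (fun n => ((u ^ n : ℂˣ) : ℂ) * f n) ↔ HasRec f := by
  have key : ∀ (u : ℂˣ) (f : ℤ → ℂ), HasRec (fun n => ((u ^ n : ℂˣ) : ℂ) * f n) → HasRec f := by
    rintro u f ⟨y, hy, hy0⟩
    refine ⟨twist u y, twist_mem_annIdeal hy, fun h => hy0 ?_⟩
    rw [← twist_twist_inv u y, h, map_zero]
  refine ⟨key u f, fun h => key u⁻¹ _ ?_⟩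
  convert h using 2 with n
  rw [← mul_assoc, ← Units.val_mul, inv_zpow, inv_mul_cancel, Units.val_one, one_mul]

theorem HasRec.comp_neg {f : ℤ → ℂ} (hf : HasRec f) : HasRec fun n => f (-n) := by
  obtain ⟨y, hy, hy0⟩ := hf
  have h : lin (fun n => f (-n)) ∘ₗ (invert (R := ℂ)).toLinearMap = lin f := ext_lin fun n => by
    rw [LinearMap.comp_apply, AlgEquiv.toLinearMap_apply, invert_T, lin_T, lin_T, neg_neg]
  refine ⟨invert y, fun z => ?_, (map_ne_zero_iff _ invert.injective).2 hy0⟩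
  have h' := hy (invert z)
  rw [← h, LinearMap.comp_apply, AlgEquiv.toLinearMap_apply, map_mul, involutive_invert z] at h'
  exact h'

/-- A sequence satisfies a recurrence if its image under `S - μ`, for the shift `S`, does. -/
theorem HasRec.of_shift {f : ℤ → ℂ} (μ : ℂ) (hf : HasRec fun n => f (n + 1) - μ * f n) :
    HasRec f := by
  obtain ⟨y, hy, hy0⟩ := hf
  have h : lin (fun n => f (n + 1) - μ * f n)
      = lin f ∘ₗ LinearMap.mulRight ℂ (T 1 - LaurentPolynomial.C μ) := ext_lin fun n => by
    rw [LinearMap.comp_apply, LinearMap.mulRight_apply, mul_sub, ← T_add, map_sub, mul_comm,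
      ← LaurentPolynomial.smul_eq_C_mul, map_smul, lin_T, lin_T, lin_T, smul_eq_mul]
  refine ⟨y * (T 1 - LaurentPolynomial.C μ), fun z => ?_, mul_ne_zero hy0 fun h0 => ?_⟩
  · have h' := hy z
    rwa [h, LinearMap.comp_apply, LinearMap.mulRight_apply, mul_assoc] at h'
  · have := congrArg (fun y : ℂ[T;T⁻¹] => y.coeff 1) h0
    simp at this

theorem exists_toLaurent {f : ℤ → ℂ} (hf : HasRec f) :
    ∃ p : ℂ[X], p.Monic ∧ toLaurent p ∈ annIdeal f := by
  obtain ⟨y, hy, hy0⟩ := hf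
  obtain ⟨n, p, hp⟩ := exists_T_pow y
  have hp0 : p ≠ 0 := by
    rintro rfl
    rw [map_zero] at hp
    exact mul_ne_zero hy0 (isUnit_T _).ne_zero hp.symm
  refine ⟨p * Polynomial.C p.leadingCoeff⁻¹, Polynomial.monic_mul_leadingCoeff_inv hp0, ?_⟩
  rw [map_mul, hp, mul_right_comm, mul_comm, mul_comm]
  exact Ideal.mul_mem_right _ _ (Ideal.mul_mem_right _ _ hy)

/-- The classes of `T` and `T⁻¹` are integral over `ℂ`, by the recurrence and the reversed one. -/
theorem finite_quotient {f : ℤ → ℂ} (hf : HasRec f) : Module.Finite ℂ (ℂ[T;T⁻¹] ⧸ annIdeal f) := by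
  obtain ⟨p, hp, hpf⟩ := exists_toLaurent hf
  let π := Ideal.Quotient.mkₐ ℂ (annIdeal f)
  have hT : Polynomial.aeval (T 1 : ℂ[T;T⁻¹]) p = toLaurent p := by
    have h : Polynomial.aeval (T 1 : ℂ[T;T⁻¹]) = Polynomial.toLaurentAlg := by
      ext; simp
    rw [h]; rfl
  have h1 : IsIntegral ℂ (π (T 1)) := by
    refine ⟨p, hp, ?_⟩
    rw [← Polynomial.aeval_def, Polynomial.aeval_algHom_apply, hT]
    exact Ideal.Quotient.eq_zero_iff_mem.2 hpf
  have h2 : IsIntegral ℂ (π (T (-1))) := by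
    refine IsAlgebraic.isIntegral ⟨p.reverse, fun h0 => hp.ne_zero (by simpa using h0), ?_⟩
    rw [Polynomial.aeval_algHom_apply]
    refine Ideal.Quotient.eq_zero_iff_mem.2 ?_
    have h := Polynomial.eval₂_reverse_mul_pow (algebraMap ℂ ℂ[T;T⁻¹]) (T 1) p
    rw [← Polynomial.aeval_def, ← Polynomial.aeval_def, invOf_T, hT, T_pow] at h
    have h' := Ideal.mul_mem_right (T (-(p.natDegree * 1))) (annIdeal f) hpf
    rwa [← h, mul_assoc, ← T_add, add_neg_cancel, T_zero, mul_one] at h'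
  have : Algebra.IsIntegral ℂ (ℂ[T;T⁻¹] ⧸ annIdeal f) := by
    refine ⟨fun x => ?_⟩
    obtain ⟨y, rfl⟩ := Ideal.Quotient.mkₐ_surjective ℂ (annIdeal f) x
    change IsIntegral ℂ (π y)
    induction y using induction with
    | T n =>
      obtain ⟨m, rfl | rfl⟩ := n.eq_nat_or_neg
      · have : (T (m : ℤ) : ℂ[T;T⁻¹]) = T 1 ^ m := by rw [T_pow, mul_one]
        rw [this, map_pow]
        exact h1.pow m
      · have : (T (-(m : ℤ)) : ℂ[T;T⁻¹]) = T (-1) ^ m := by rw [T_pow]; congr 1; ring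
        rw [this, map_pow]
        exact h2.pow m
    | add x y hx hy => rw [map_add]; exact hx.add hy
    | smul a x hx => rw [map_smul]; exact hx.smul a
  have : Algebra.FiniteType ℂ (ℂ[T;T⁻¹] ⧸ annIdeal f) :=
    Algebra.FiniteType.of_surjective π (Ideal.Quotient.mkₐ_surjective ℂ (annIdeal f))
  exact Algebra.IsIntegral.finite

theorem polyMulSeries_genSeries (b : ℂ[X]) (f : ℤ → ℂ) (n : ℤ) :
    polyMulSeries b (genSeries f) n = lin f (T (-n) * toLaurent b) := by
  have h : toLaurent b = ∑ k ∈ b.support, b.coeff k • (T (k : ℤ) : ℂ[T;T⁻¹]) := by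
    conv_lhs => rw [b.as_sum_support_C_mul_X_pow, map_sum]
    refine Finset.sum_congr rfl fun k _ => ?_
    rw [toLaurent_C_mul_X_pow, LaurentPolynomial.smul_eq_C_mul]
  rw [h, Finset.mul_sum, map_sum, polyMulSeries, Polynomial.sum]
  refine Finset.sum_congr rfl fun k _ => ?_
  rw [mul_smul_comm, ← T_add, map_smul, lin_T, genSeries, smul_eq_mul]
  congr 2
  ring

theorem hasRec_iff_exists_monic {f : ℤ → ℂ} :
    HasRec f ↔ ∃ b : ℂ[X], b.Monic ∧ polyMulSeries b (genSeries f) = 0 := by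
  constructor
  · intro h
    obtain ⟨p, hp, hpf⟩ := exists_toLaurent h
    exact ⟨p, hp, funext fun n => by rw [polyMulSeries_genSeries]; exact hpf _⟩
  · rintro ⟨b, hb, h⟩
    refine ⟨toLaurent b, mem_annIdeal.2 fun n => ?_, toLaurent_ne_zero.2 hb.ne_zero⟩
    have := congrFun h (-n)
    rwa [polyMulSeries_genSeries, neg_neg] at this

/-! ### Sequences with a recurrence and quasipolynomials -/

theorem succ_pow_sub (k : ℕ) (x : ℂ) :
    (x + 1) ^ k = x ^ k + ∑ i ∈ Finset.range k, (k.choose i : ℂ) * x ^ i := by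
  rw [add_pow, Finset.sum_range_succ, add_comm]
  simp [mul_comm]

theorem hasRec_pow (k : ℕ) : HasRec fun n => (n : ℂ) ^ k := by
  induction k using Nat.strong_induction_on with
  | _ k ih =>
  refine HasRec.of_shift 1 ?_
  have h : (fun n : ℤ => ((n + 1 : ℤ) : ℂ) ^ k - 1 * (n : ℂ) ^ k)
      = ∑ i ∈ Finset.range k, (k.choose i : ℂ) • fun n : ℤ => (n : ℂ) ^ i := by
    ext n
    rw [Finset.sum_apply]
    push_cast
    rw [succ_pow_sub]
    simp
  rw [h]
  exact HasRec.sum fun i hi => (ih i (Finset.mem_range.1 hi)).smul _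

theorem hasRec_of_isQuasipolynomial {q : ℂˣ} {P : ℂ → ℂ} (hP : IsQuasipolynomial q P) :
    HasRec fun n : ℤ => P n := by
  induction hP using Submodule.span_induction with
  | mem P hP =>
    obtain ⟨p, α, rfl⟩ := hP
    have hu : (q : ℂ) ^ α ≠ 0 := by simp [Complex.cpow_eq_zero_iff]
    have h : (fun n : ℤ => p.eval (n : ℂ) * (q : ℂ) ^ (α * (n : ℂ)))
        = fun n : ℤ => (((Units.mk0 _ hu) ^ n : ℂˣ) : ℂ) *
          (∑ k ∈ Finset.range (p.natDegree + 1), p.coeff k • fun n : ℤ => (n : ℂ) ^ k) n := by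
      ext n
      rw [Complex.cpow_mul_int, Polynomial.eval_eq_sum_range, mul_comm]
      simp
    rw [h, hasRec_twist]
    exact HasRec.sum fun k _ => (hasRec_pow k).smul _
  | zero => exact hasRec_zero
  | add P Q _ _ hP hQ => exact hP.add hQ
  | smul a P _ hP => exact hP.smul a

/-- The span of the sequences `n ^ k μ ^ n`. -/
def expPoly : Submodule ℂ (ℤ → ℂ) :=
  Submodule.span ℂ {f | ∃ (k : ℕ) (μ : ℂˣ), f = fun n : ℤ => (n : ℂ) ^ k * ((μ ^ n : ℂˣ) : ℂ)}

theorem mem_expPoly (k : ℕ) (μ : ℂˣ) :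
    (fun n : ℤ => (n : ℂ) ^ k * ((μ ^ n : ℂˣ) : ℂ)) ∈ expPoly :=
  Submodule.subset_span ⟨k, μ, rfl⟩

/-- The operator `S - μ`, with `S` the shift. -/
def shiftSub (μ : ℂ) : Module.End ℂ (ℤ → ℂ) where
  toFun f n := f (n + 1) - μ * f n
  map_add' f g := by ext n; simp only [Pi.add_apply]; ring
  map_smul' a f := by ext n; simp only [Pi.smul_apply, smul_eq_mul, RingHom.id_apply]; ring

theorem shiftSub_apply (μ : ℂ) (f : ℤ → ℂ) (n : ℤ) : shiftSub μ f n = f (n + 1) - μ * f n := rfl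

theorem shiftSub_expPoly_gen (μ : ℂ) (k : ℕ) (ν : ℂˣ) :
    shiftSub μ (fun n : ℤ => (n : ℂ) ^ k * ((ν ^ n : ℂˣ) : ℂ))
      = (ν - μ : ℂ) • (fun n : ℤ => (n : ℂ) ^ k * ((ν ^ n : ℂˣ) : ℂ))
        + ∑ i ∈ Finset.range k, ((ν : ℂ) * (k.choose i : ℂ)) •
          (fun n : ℤ => (n : ℂ) ^ i * ((ν ^ n : ℂˣ) : ℂ)) := by
  ext n
  rw [shiftSub_apply, Pi.add_apply, Finset.sum_apply]
  simp only [Pi.smul_apply, smul_eq_mul]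
  push_cast
  rw [zpow_add_one₀ ν.ne_zero, succ_pow_sub, add_mul, Finset.sum_mul, sub_mul]
  have : ∀ i, (k.choose i : ℂ) * (n : ℂ) ^ i * ((ν : ℂ) ^ n * (ν : ℂ))
      = (ν : ℂ) * (k.choose i : ℂ) * ((n : ℂ) ^ i * (ν : ℂ) ^ n) := fun i => by ring
  simp only [this]
  ring

/-- The operator `S - μ` is surjective on the combinations of the sequences `n ^ k ν ^ n`. -/
theorem exists_shiftSub_eq (μ : ℂ) {f : ℤ → ℂ} (hf : f ∈ expPoly) :
    ∃ h ∈ expPoly, shiftSub μ h = f := by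
  change f ∈ (expPoly.map (shiftSub μ))
  induction hf using Submodule.span_induction with
  | mem f hf =>
    obtain ⟨k, ν, rfl⟩ := hf
    induction k using Nat.strong_induction_on with
    | _ k ih =>
    by_cases hμ : (ν : ℂ) = μ
    · -- the leading term of `S - μ` applied to `n ^ (k + 1) μ ^ n` is `(k + 1) μ n ^ k μ ^ n`
      have h := shiftSub_expPoly_gen μ (k + 1) ν
      rw [Finset.sum_range_succ, hμ, sub_self, zero_smul, zero_add] at h
      have hk : (μ * ((k + 1).choose k : ℂ)) ≠ 0 := by
        rw [← hμ, Nat.choose_succ_self_right]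
        exact mul_ne_zero ν.ne_zero (Nat.cast_ne_zero.2 k.succ_ne_zero)
      rw [← Submodule.smul_mem_iff _ hk, ← sub_eq_iff_eq_add'.2 h]
      exact sub_mem ⟨_, mem_expPoly (k + 1) ν, rfl⟩
        (Submodule.sum_mem _ fun i hi => Submodule.smul_mem _ _ (ih i (Finset.mem_range.1 hi)))
    · have h := shiftSub_expPoly_gen μ k ν
      rw [← Submodule.smul_mem_iff _ (sub_ne_zero.2 hμ), ← sub_eq_iff_eq_add.2 h]
      exact sub_mem ⟨_, mem_expPoly k ν, rfl⟩
        (Submodule.sum_mem _ fun i hi => Submodule.smul_mem _ _ (ih i (Finset.mem_range.1 hi)))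
  | zero => exact zero_mem _
  | add f g _ _ hf hg => exact add_mem hf hg
  | smul a f _ hf => exact Submodule.smul_mem _ a hf

theorem mem_expPoly_of_shiftSub (μ : ℂ) {f : ℤ → ℂ} (hf : shiftSub μ f ∈ expPoly) :
    f ∈ expPoly := by
  by_cases hμ : μ = 0
  · have h : ∀ g ∈ expPoly, (fun n => g (n - 1)) ∈ expPoly := by
      intro g hg
      -- `S` maps the combinations of the `n ^ k ν ^ n` onto themselves
      obtain ⟨h, hh, rfl⟩ := exists_shiftSub_eq 0 hg
      convert hh using 1
      ext n
      rw [shiftSub_apply, zero_mul, sub_zero, sub_add_cancel]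
    convert h _ hf using 1
    ext n
    rw [shiftSub_apply, hμ, zero_mul, sub_zero, sub_add_cancel]
  · obtain ⟨h, hh, hfh⟩ := exists_shiftSub_eq μ hf
    have h0 : shiftSub μ (f - h) = 0 := by rw [map_sub, hfh, sub_self]
    have hrec : ∀ n : ℤ, (f - h) (n + 1) = μ * (f - h) n := fun n =>
      sub_eq_zero.1 (congrFun h0 n)
    have hgeo : ∀ n : ℤ, (f - h) n = (f - h) 0 * μ ^ n := by
      intro n
      induction n using Int.induction_on with
      | zero => simp
      | succ n ih => rw [hrec, ih, zpow_add_one₀ hμ]; ring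
      | pred n ih =>
        have := hrec (-(n : ℤ) - 1)
        rw [sub_add_cancel, ih] at this
        apply mul_left_cancel₀ hμ
        rw [← this, zpow_sub_one₀ hμ]
        field_simp
    have hmem : f - h ∈ expPoly := by
      have := Submodule.smul_mem expPoly ((f - h) 0) (mem_expPoly 0 (Units.mk0 μ hμ))
      convert this using 1
      ext n
      rw [hgeo]
      simp
    simpa using add_mem hmem hh

/-- The recurrence splits into linear factors `S - μ`, which are removed one at a time. -/
theorem HasRec.mem_expPoly {f : ℤ → ℂ} (hf : HasRec f) : f ∈ expPoly := by
  obtain ⟨p, hp, hpf⟩ := exists_toLaurent hf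
  have hs := (IsAlgClosed.splits p).eq_prod_roots
  rw [hp.leadingCoeff, Polynomial.C_1, one_mul] at hs
  rw [hs] at hpf
  generalize p.roots = s at hpf
  clear hs hp hf
  induction s using Multiset.induction_on generalizing f with
  | empty =>
    have h := fun n => hpf (T n)
    simp only [Multiset.map_zero, Multiset.prod_zero, map_one, mul_one, lin_T] at h
    have : f = 0 := funext h
    rw [this]
    exact zero_mem _
  | cons a s ih =>
    refine mem_expPoly_of_shiftSub a (ih (mem_annIdeal.2 fun n => ?_))
    have h := hpf (T n)
    rw [Multiset.map_cons, Multiset.prod_cons, map_mul toLaurent, mul_left_comm, mul_comm,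
      map_sub toLaurent, toLaurent_X, toLaurent_C] at h
    have hl : lin (shiftSub a f) = lin f ∘ₗ LinearMap.mulRight ℂ (T 1 - LaurentPolynomial.C a) :=
      ext_lin fun n => by
        rw [LinearMap.comp_apply, LinearMap.mulRight_apply, mul_sub, ← T_add, map_sub,
          mul_comm (T n), ← LaurentPolynomial.smul_eq_C_mul, map_smul, lin_T, lin_T, lin_T,
          smul_eq_mul]
        rfl
    rw [hl, LinearMap.comp_apply, LinearMap.mulRight_apply]
    exact h

theorem log_ne_zero {q : ℂˣ} (hq : ‖(q : ℂ)‖ ≠ 1) : Complex.log q ≠ 0 := by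
  intro h
  apply hq
  have h' := congrArg Complex.re h
  rw [Complex.log_re, Complex.zero_re] at h'
  exact Real.eq_one_of_pos_of_log_eq_zero (norm_pos_iff.2 q.ne_zero) h'

theorem HasRec.exists_isQuasipolynomial {q : ℂˣ} (hq : ‖(q : ℂ)‖ ≠ 1) {f : ℤ → ℂ} (hf : HasRec f) :
    ∃ P : ℂ → ℂ, IsQuasipolynomial q P ∧ ∀ n : ℤ, P n = f n := by
  replace hf := hf.mem_expPoly
  induction hf using Submodule.span_induction with
  | mem f hf =>
    obtain ⟨k, μ, rfl⟩ := hf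
    refine ⟨_, Submodule.subset_span ⟨Polynomial.X ^ k, Complex.log μ / Complex.log q, rfl⟩,
      fun n => ?_⟩
    have h : (q : ℂ) ^ (Complex.log μ / Complex.log q) = μ := by
      rw [Complex.cpow_def_of_ne_zero q.ne_zero, mul_div_cancel₀ _ (log_ne_zero hq),
        Complex.exp_log μ.ne_zero]
    simp only
    rw [Complex.cpow_mul_int, h]
    simp
  | zero => exact ⟨0, zero_mem _, fun _ => rfl⟩
  | add f g _ _ hf hg =>
    obtain ⟨P, hP, h⟩ := hf
    obtain ⟨Q, hQ, h'⟩ := hg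
    exact ⟨P + Q, add_mem hP hQ, fun n => by rw [Pi.add_apply, Pi.add_apply, h, h']⟩
  | smul a f _ hf =>
    obtain ⟨P, hP, h⟩ := hf
    exact ⟨a • P, Submodule.smul_mem _ a hP, fun n => by rw [Pi.smul_apply, Pi.smul_apply, h]⟩

theorem hasRec_iff_exists_isQuasipolynomial {q : ℂˣ} (hq : ‖(q : ℂ)‖ ≠ 1) {f : ℤ → ℂ} :
    HasRec f ↔ ∃ P : ℂ → ℂ, IsQuasipolynomial q P ∧ ∀ n : ℤ, P n = f n := by
  refine ⟨fun h => h.exists_isQuasipolynomial hq, ?_⟩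
  rintro ⟨P, hP, h⟩
  have := hasRec_of_isQuasipolynomial hP
  rwa [show (fun n : ℤ => P n) = f from funext h] at this

/-! ### Even quasipolynomials -/

/-- The space of quasipolynomials. -/
def quasiSpace (q : ℂˣ) : Submodule ℂ (ℂ → ℂ) :=
  Submodule.span ℂ {f : ℂ → ℂ | ∃ (p : ℂ[X]) (α : ℂ), f = fun x => p.eval x * (q : ℂ) ^ (α * x)}

theorem hasDerivAt_gen (q : ℂˣ) (p : ℂ[X]) (α x : ℂ) :
    HasDerivAt (fun x => p.eval x * (q : ℂ) ^ (α * x))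
      ((derivative p + Polynomial.C (α * Complex.log q) * p).eval x * (q : ℂ) ^ (α * x)) x := by
  have h1 : HasDerivAt (fun x : ℂ => α * x) α x := by
    simpa using (hasDerivAt_id x).const_mul α
  have h2 := (p.hasDerivAt x).mul (h1.const_cpow (c := (q : ℂ)) (Or.inl q.ne_zero))
  refine h2.congr_deriv ?_
  rw [eval_add, eval_mul, eval_C]
  ring

theorem deriv_mem_quasiSpace {q : ℂˣ} {P : ℂ → ℂ} (hP : P ∈ quasiSpace q) :
    Differentiable ℂ P ∧ deriv P ∈ quasiSpace q := by
  induction hP using Submodule.span_induction with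
  | mem P hP =>
    obtain ⟨p, α, rfl⟩ := hP
    refine ⟨fun x => (hasDerivAt_gen q p α x).differentiableAt, Submodule.subset_span
      ⟨derivative p + Polynomial.C (α * Complex.log q) * p, α, funext fun x => ?_⟩⟩
    exact (hasDerivAt_gen q p α x).deriv
  | zero =>
    refine ⟨differentiable_const 0, ?_⟩
    have : deriv (0 : ℂ → ℂ) = 0 := deriv_const' (0 : ℂ)
    rw [this]
    exact zero_mem _
  | add P Q _ _ hP hQ =>
    refine ⟨hP.1.add hQ.1, ?_⟩
    have : deriv (P + Q) = deriv P + deriv Q := funext fun x => deriv_add (hP.1 x) (hQ.1 x)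
    rw [this]
    exact add_mem hP.2 hQ.2
  | smul a P _ hP =>
    refine ⟨hP.1.const_smul a, ?_⟩
    have : deriv (a • P) = a • deriv P := funext fun x => deriv_const_smul a (hP.1 x)
    rw [this]
    exact Submodule.smul_mem _ a hP.2

/-- The operator `d/dx` on the quasipolynomials. -/
def diff (q : ℂˣ) : Module.End ℂ (quasiSpace q) where
  toFun P := ⟨deriv P, (deriv_mem_quasiSpace P.2).2⟩
  map_add' P Q := Subtype.ext <| funext fun x =>
    deriv_add ((deriv_mem_quasiSpace P.2).1 x) ((deriv_mem_quasiSpace Q.2).1 x)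
  map_smul' a P := Subtype.ext <| funext fun x =>
    deriv_const_smul a ((deriv_mem_quasiSpace P.2).1 x)

theorem iteratedDeriv_eq {q : ℂˣ} (k : ℕ) (P : quasiSpace q) :
    iteratedDeriv k (P : ℂ → ℂ) = ((diff q ^ k) P : quasiSpace q) := by
  induction k with
  | zero => rw [iteratedDeriv_zero, pow_zero, Module.End.one_apply]
  | succ k ih => rw [iteratedDeriv_succ, ih, pow_succ', Module.End.mul_apply]; rfl

theorem sum_iteratedDeriv {q : ℂˣ} (B : ℂ[X]) (P : quasiSpace q) (x : ℂ) :
    (B.sum fun k b => b * iteratedDeriv k (P : ℂ → ℂ) x)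
      = (aeval (diff q) B P : quasiSpace q).1 x := by
  rw [aeval_eq_sum_range, Polynomial.sum_over_range _ (fun n => by rw [zero_mul]),
    LinearMap.sum_apply, AddSubmonoidClass.coe_finsetSum, Finset.sum_apply]
  refine Finset.sum_congr rfl fun k _ => ?_
  rw [iteratedDeriv_eq]
  rfl

theorem exists_aeval_diff {q : ℂˣ} (P : quasiSpace q) :
    ∃ B : ℂ[X], B ≠ 0 ∧ aeval (diff q) B P = 0 := by
  have hadd : ∀ P Q : quasiSpace q, (∃ B : ℂ[X], B ≠ 0 ∧ aeval (diff q) B P = 0) →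
      (∃ B : ℂ[X], B ≠ 0 ∧ aeval (diff q) B Q = 0) →
      ∃ B : ℂ[X], B ≠ 0 ∧ aeval (diff q) B (P + Q) = 0 := by
    rintro P Q ⟨B, hB, h⟩ ⟨B', hB', h'⟩
    refine ⟨B * B', mul_ne_zero hB hB', ?_⟩
    rw [map_add]
    nth_rw 1 [mul_comm]
    rw [map_mul, map_mul, Module.End.mul_apply, Module.End.mul_apply, h, h', map_zero, map_zero,
      add_zero]
  have hsmul : ∀ (a : ℂ) (P : quasiSpace q), (∃ B : ℂ[X], B ≠ 0 ∧ aeval (diff q) B P = 0) →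
      ∃ B : ℂ[X], B ≠ 0 ∧ aeval (diff q) B (a • P) = 0 := by
    rintro a P ⟨B, hB, h⟩
    exact ⟨B, hB, by rw [map_smul, h, smul_zero]⟩
  have hgen : ∀ (p : ℂ[X]) (α : ℂ) (hP : (fun x => p.eval x * (q : ℂ) ^ (α * x)) ∈ quasiSpace q),
      ∃ B : ℂ[X], B ≠ 0 ∧ aeval (diff q) B (⟨_, hP⟩ : quasiSpace q) = 0 := by
    intro p α
    -- `d/dx - α log q` differentiates the polynomial factor
    induction hn : p.natDegree using Nat.strong_induction_on generalizing p with
    | _ n ih =>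
    intro hP
    have hmem : (fun x => (derivative p).eval x * (q : ℂ) ^ (α * x)) ∈ quasiSpace q :=
      Submodule.subset_span ⟨_, _, rfl⟩
    have hstep : aeval (diff q) (X - Polynomial.C (α * Complex.log q)) (⟨_, hP⟩ : quasiSpace q)
        = ⟨_, hmem⟩ := by
      rw [map_sub, aeval_X, aeval_C, LinearMap.sub_apply, Module.algebraMap_end_apply]
      refine Subtype.ext (funext fun x => ?_)
      change deriv (fun x => p.eval x * (q : ℂ) ^ (α * x)) x
        - α * Complex.log q * (p.eval x * (q : ℂ) ^ (α * x)) = _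
      rw [(hasDerivAt_gen q p α x).deriv, eval_add, eval_mul, eval_C]
      ring
    rcases Nat.eq_zero_or_pos p.natDegree with h0 | hpos
    · refine ⟨_, X_sub_C_ne_zero (α * Complex.log q), ?_⟩
      rw [hstep]
      have hd : derivative p = 0 := by rw [eq_C_of_natDegree_eq_zero h0, derivative_C]
      refine Subtype.ext (funext fun x => ?_)
      change (derivative p).eval x * _ = 0
      rw [hd, eval_zero, zero_mul]
    · have hlt := natDegree_derivative_lt hpos.ne'
      obtain ⟨B, hB, h⟩ := ih _ (hn ▸ hlt) (derivative p) rfl hmem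
      refine ⟨B * (X - Polynomial.C (α * Complex.log q)), mul_ne_zero hB (X_sub_C_ne_zero _), ?_⟩
      rw [map_mul, Module.End.mul_apply, hstep, h]
  obtain ⟨P, hP⟩ := P
  have key : ∃ hP : P ∈ quasiSpace q,
      ∃ B : ℂ[X], B ≠ 0 ∧ aeval (diff q) B (⟨P, hP⟩ : quasiSpace q) = 0 := by
    induction hP using Submodule.span_induction with
    | mem P hP =>
      obtain ⟨p, α, rfl⟩ := hP
      exact ⟨Submodule.subset_span ⟨p, α, rfl⟩, hgen p α _⟩
    | zero => exact ⟨zero_mem _, 1, one_ne_zero, by rw [map_one]; rfl⟩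
    | add P Q _ _ hP hQ =>
      obtain ⟨hP, hB⟩ := hP
      obtain ⟨hQ, hB'⟩ := hQ
      exact ⟨add_mem hP hQ, hadd _ _ hB hB'⟩
    | smul a P _ hP =>
      obtain ⟨hP, hB⟩ := hP
      exact ⟨Submodule.smul_mem _ a hP, hsmul a _ hB⟩
  exact key.2

/-- Every quasipolynomial is even in the sense of being annihilated by `B(d/dx)` for an even
`B ≠ 0`: if `B(d/dx)` annihilates it, then so does the operator given by `B(x) B(-x)`. -/
theorem isEvenQuasipolynomial {q : ℂˣ} {P : ℂ → ℂ} (hP : IsQuasipolynomial q P) :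
    IsEvenQuasipolynomial q P := by
  obtain ⟨B, hB, h⟩ := exists_aeval_diff (⟨P, hP⟩ : quasiSpace q)
  have hcomp : ∀ B : ℂ[X], (B.comp (-X)).comp (-X) = B := fun B => by
    rw [comp_assoc, neg_comp, X_comp, neg_neg, comp_X]
  refine ⟨hP, B.comp (-X) * B, mul_ne_zero (fun h0 => hB ?_) hB, ?_, fun x => ?_⟩
  · rw [← hcomp B, h0, zero_comp]
  · rw [mul_comp, hcomp, mul_comm]
  · rw [sum_iteratedDeriv _ (⟨P, hP⟩ : quasiSpace q), map_mul, Module.End.mul_apply, h, map_zero]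
    rfl

theorem isQuasipolynomial_comp_neg {q : ℂˣ} {P : ℂ → ℂ} (hP : IsQuasipolynomial q P) :
    IsQuasipolynomial q fun x => P (-x) := by
  induction hP using Submodule.span_induction with
  | mem P hP =>
    obtain ⟨p, α, rfl⟩ := hP
    exact Submodule.subset_span ⟨p.comp (-X), -α, funext fun x => by simp⟩
  | zero => exact zero_mem _
  | add P Q _ _ hP hQ => exact add_mem hP hQ
  | smul a P _ hP => exact Submodule.smul_mem _ a hP

/-- An even sequence with a recurrence is interpolated by a quasipolynomial that is an even
function: the even part of any interpolating one. -/
theorem HasRec.exists_even {q : ℂˣ} (hq : ‖(q : ℂ)‖ ≠ 1) {f : ℤ → ℂ} (hf : HasRec f)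
    (heven : ∀ n, f (-n) = f n) :
    ∃ P : ℂ → ℂ, IsEvenQuasipolynomial q P ∧ (∀ x, P (-x) = P x) ∧ ∀ n : ℤ, P n = f n := by
  obtain ⟨P, hP, h⟩ := hf.exists_isQuasipolynomial hq
  refine ⟨fun x => 2⁻¹ * (P x + P (-x)), isEvenQuasipolynomial ?_, fun x => ?_, fun n => ?_⟩
  · exact Submodule.smul_mem _ (2⁻¹ : ℂ) (add_mem hP (isQuasipolynomial_comp_neg hP))
  · simp only
    rw [neg_neg, add_comm]
  · have h' := h (-n)
    rw [Int.cast_neg] at h'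
    simp only
    rw [h, h', heven]
    ring

end LinRec

/-! ### Homogeneous matrices of operators -/

theorem QDiff.sum_mono {q : ℂˣ} (x : QDiff q) :
    x = ∑ p ∈ Finsupp.support x, QDiff.mono q p.1 p.2 (QDiff.coeff p.1 p.2 x) :=
  (Finsupp.sum_single x).symm

namespace QMat

open LaurentPolynomial

variable {N : ℕ} {q : ℂˣ}

/-- The operator `z ^ k T_q ^ m E_{ij}`. -/
def el (q : ℂˣ) (i j : Fin N) (k m : ℤ) : QMat N q := Matrix.single i j (QDiff.mono q k m 1)

theorem single_mono (i j : Fin N) (k m : ℤ) (c : ℂ) :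
    (Matrix.single i j (QDiff.mono q k m c) : QMat N q) = c • el q i j k m := by
  rw [el, Matrix.smul_single, QDiff.smul_mono, mul_one]

/-- The homogeneous matrices of degree `d` for the principal gradation. -/
def hom (N : ℕ) (q : ℂˣ) (d : ℤ) : Submodule ℂ (QMat N q) where
  carrier := {X | ∀ (i j : Fin N) (k m : ℤ), QDiff.coeff k m (X i j) ≠ 0 →
    k * N + ((i : ℕ) : ℤ) - ((j : ℕ) : ℤ) = d}
  add_mem' {X Y} hX hY i j k m h := by
    by_cases hX' : QDiff.coeff k m (X i j) = 0
    · by_cases hY' : QDiff.coeff k m (Y i j) = 0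
      · exact absurd (by rw [Matrix.add_apply, map_add, hX', hY', add_zero]) h
      · exact hY i j k m hY'
    · exact hX i j k m hX'
  zero_mem' i j k m h := absurd (map_zero _) h
  smul_mem' c X hX i j k m h := hX i j k m fun h' => h <| by
    rw [Matrix.smul_apply, map_smul, h', smul_zero]

theorem el_mem_hom {d : ℤ} {i j : Fin N} {k : ℤ} (m : ℤ)
    (h : k * N + ((i : ℕ) : ℤ) - ((j : ℕ) : ℤ) = d) : el q i j k m ∈ hom N q d := by
  intro i' j' k' m' h'
  rw [el, Matrix.single_apply] at h'
  split_ifs at h' with hij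
  · rw [QDiff.coeff_mono] at h'
    split_ifs at h' with hkm
    · rw [← hij.1, ← hij.2, ← hkm.1, h]
    · exact absurd rfl h'
  · exact absurd (map_zero _) h'

theorem eq_sum_el (X : QMat N q) : X = ∑ i, ∑ j, ∑ p ∈ Finsupp.support (X i j),
    QDiff.coeff p.1 p.2 (X i j) • el q i j p.1 p.2 := by
  conv_lhs => rw [Matrix.matrix_eq_sum_single X]
  refine Finset.sum_congr rfl fun i _ => Finset.sum_congr rfl fun j _ => ?_
  conv_lhs => rw [QDiff.sum_mono (X i j)]
  rw [← Matrix.singleAddMonoidHom_apply, map_sum]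
  exact Finset.sum_congr rfl fun p _ => single_mono _ _ _ _ _

theorem hom_induction {d : ℤ} {p : QMat N q → Prop} {X : QMat N q} (hX : X ∈ hom N q d)
    (zero : p 0) (el : ∀ (i j : Fin N) (k m : ℤ),
      k * N + ((i : ℕ) : ℤ) - ((j : ℕ) : ℤ) = d → p (el q i j k m))
    (add : ∀ X Y, p X → p Y → p (X + Y)) (smul : ∀ (a : ℂ) X, p X → p (a • X)) : p X := by
  rw [eq_sum_el X]
  refine Finset.sum_induction _ p add zero fun i _ => Finset.sum_induction _ p add zero fun j _ =>
    Finset.sum_induction _ p add zero fun a ha => smul _ _ (el _ _ _ _ ?_)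
  exact hX i j a.1 a.2 (Finsupp.mem_support_iff.1 ha)

theorem induction_el {p : QMat N q → Prop} (X : QMat N q)
    (zero : p 0) (el : ∀ (i j : Fin N) (k m : ℤ), p (el q i j k m))
    (add : ∀ X Y, p X → p Y → p (X + Y)) (smul : ∀ (a : ℂ) X, p X → p (a • X)) : p X := by
  rw [eq_sum_el X]
  exact Finset.sum_induction _ p add zero fun i _ => Finset.sum_induction _ p add zero fun j _ =>
    Finset.sum_induction _ p add zero fun a ha => smul _ _ (el _ _ _ _)

theorem el_mul_el_same (i j l : Fin N) (k m k' m' : ℤ) :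
    el q i j k m * el q j l k' m'
      = ((q ^ (m * k') : ℂˣ) : ℂ) • el q i l (k + k') (m + m') := by
  rw [el, el, Matrix.single_mul_single_same, QDiff.mono_mul_mono, one_mul, one_mul, single_mono]

theorem el_mul_el_of_ne {i j j' l : Fin N} (h : j ≠ j') (k m k' m' : ℤ) :
    el q i j k m * el q j' l k' m' = 0 := by
  rw [el, el, Matrix.single_mul_single_of_ne _ _ _ _ h]

theorem sigma_el (ε : ℤˣ) (r : ℤ) (i j : Fin N) (k m : ℤ) :
    sigma ε r (el q i j k m) = ((((ε ^ k : ℤˣ) : ℤ) : ℂ) *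
        ((q ^ (r * (k * (k - 1) / 2) + (1 - k) * m) : ℂˣ) : ℂ)) •
      el q j.rev i.rev k (k * r - m) := by
  rw [el, sigma_single, QDiff.sigma_mono, one_mul, single_mono]

theorem sigma_sigma (ε : ℤˣ) (r : ℤ) (X : QMat N q) : sigma ε r (sigma ε r X) = X := by
  induction X using induction_el with
  | zero => rw [map_zero, map_zero]
  | el i j k m =>
    rw [sigma_el, map_smul, sigma_el, smul_smul, Fin.rev_rev, Fin.rev_rev, sub_sub_cancel]
    obtain ⟨a, ha⟩ := (Int.even_mul_pred_self k).two_dvd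
    have h1 : (((ε ^ k : ℤˣ) : ℤ) : ℂ) * (((ε ^ k : ℤˣ) : ℤ) : ℂ) = 1 := by
      rw [← Int.cast_mul, ← Units.val_mul, Int.units_mul_self, Units.val_one, Int.cast_one]
    have h2 : (q ^ (r * (k * (k - 1) / 2) + (1 - k) * m) : ℂˣ)
        * q ^ (r * (k * (k - 1) / 2) + (1 - k) * (k * r - m)) = 1 := by
      rw [← zpow_add, ha, Int.mul_ediv_cancel_left _ two_ne_zero, ← zpow_zero q]
      congr 1
      linear_combination (-r) * ha
    have h2' := congrArg (fun u : ℂˣ => (u : ℂ)) h2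
    simp only [Units.val_mul, Units.val_one] at h2'
    rw [mul_mul_mul_comm, h1, h2', one_mul, one_smul]
  | add X Y hX hY => rw [map_add, map_add, hX, hY]
  | smul a X hX => rw [map_smul, map_smul, hX]

theorem sub_sigma_mem_fixed (ε : ℤˣ) (r : ℤ) (X : QMat N q) :
    X - sigma ε r X ∈ fixed N q ε r := by
  rw [mem_fixed, map_sub, sigma_sigma, neg_sub]

theorem sigma_mem_hom {ε : ℤˣ} {r d : ℤ} {X : QMat N q} (hX : X ∈ hom N q d) :
    sigma ε r X ∈ hom N q d := by
  refine hom_induction (p := fun X => sigma ε r X ∈ hom N q d) hX ?_ (fun i j k m h => ?_) ?_ ?_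
  · rw [map_zero]; exact zero_mem _
  · rw [sigma_el]
    refine Submodule.smul_mem _ _ (el_mem_hom _ ?_)
    rw [Fin.val_rev, Fin.val_rev]
    omega
  · intro X Y hX hY; rw [map_add]; exact add_mem hX hY
  · intro a X hX; rw [map_smul]; exact Submodule.smul_mem _ a hX

/-- A degree and one index determine the other index and the power of `z`. -/
theorem eq_of_degree {a b : Fin N} {k l d : ℤ} (ha : k * N + ((a : ℕ) : ℤ) = d)
    (hb : l * N + ((b : ℕ) : ℤ) = d) : a = b ∧ k = l := by
  have hN : 0 < N := a.pos
  have ha' := a.2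
  have hb' := b.2
  have e1 : d / N = k := by
    rw [← ha, mul_comm, Int.mul_add_ediv_left _ _ (by omega),
      Int.ediv_eq_zero_of_lt (by omega) (by omega)]
    ring
  have e2 : d / N = l := by
    rw [← hb, mul_comm, Int.mul_add_ediv_left _ _ (by omega),
      Int.ediv_eq_zero_of_lt (by omega) (by omega)]
    ring
  have hkl : k = l := e1.symm.trans e2
  subst hkl
  exact ⟨Fin.ext (by omega), rfl⟩

theorem mul_mem_hom {d e : ℤ} {X Y : QMat N q} (hX : X ∈ hom N q d) (hY : Y ∈ hom N q e) :
    X * Y ∈ hom N q (d + e) := by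
  refine hom_induction (p := fun X => X * Y ∈ hom N q (d + e)) hX ?_ (fun i j k m h => ?_) ?_ ?_
  · rw [zero_mul]; exact zero_mem _
  · refine hom_induction (p := fun Y => el q i j k m * Y ∈ hom N q (d + e)) hY ?_
      (fun i' j' k' m' h' => ?_) ?_ ?_
    · rw [mul_zero]; exact zero_mem _
    · by_cases hj : j = i'
      · subst hj
        rw [el_mul_el_same]
        refine Submodule.smul_mem _ _ (el_mem_hom _ ?_)
        rw [← h, ← h']; ring
      · rw [el_mul_el_of_ne hj]; exact zero_mem _
    · intro X Y hX hY; rw [mul_add]; exact add_mem hX hY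
    · intro a X hX; rw [mul_smul_comm]; exact Submodule.smul_mem _ a hX
  · intro X Y hX hY; rw [add_mul]; exact add_mem hX hY
  · intro a X hX; rw [smul_mul_assoc]; exact Submodule.smul_mem _ a hX

theorem lie_mem_hom {d e : ℤ} {X Y : QMat N q} (hX : X ∈ hom N q d) (hY : Y ∈ hom N q e) :
    ⁅X, Y⁆ ∈ hom N q (d + e) := by
  rw [Ring.lie_def]
  refine sub_mem (mul_mem_hom hX hY) ?_
  rw [add_comm]
  exact mul_mem_hom hY hX

theorem psi_el (m a k b : ℤ) (i j i' j' : Fin N) :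
    psi N q (el q i j m a) (el q i' j' k b)
      = if m = -k ∧ a = -b ∧ j = i' ∧ i = j' then (m : ℂ) * ((q ^ (-m * a) : ℂˣ) : ℂ) else 0 :=
  psi_single m a k b i j i' j'

theorem psi_eq_zero_of_hom {d e : ℤ} (hde : d + e ≠ 0) {X Y : QMat N q} (hX : X ∈ hom N q d)
    (hY : Y ∈ hom N q e) : psi N q X Y = 0 := by
  refine hom_induction (p := fun X => psi N q X Y = 0) hX (by simp) (fun i j k m h => ?_)
    (fun X Y hX hY => by rw [map_add, LinearMap.add_apply, hX, hY, add_zero])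
    (fun a X hX => by rw [map_smul, LinearMap.smul_apply, hX, smul_zero])
  refine hom_induction (p := fun Y => psi N q (el q i j k m) Y = 0) hY (by simp)
    (fun i' j' k' m' h' => ?_) (fun X Y hX hY => by rw [map_add, hX, hY, add_zero])
    (fun a X hX => by rw [map_smul, hX, smul_zero])
  rw [psi_el, if_neg]
  rintro ⟨rfl, -, rfl, rfl⟩
  apply hde
  rw [← h, ← h']
  ring

theorem hom_zero_commute {X Y : QMat N q} (hX : X ∈ hom N q 0) (hY : Y ∈ hom N q 0) :
    ⁅X, Y⁆ = 0 ∧ psi N q X Y = 0 := by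
  refine hom_induction (p := fun X => ⁅X, Y⁆ = 0 ∧ psi N q X Y = 0) hX (by simp)
    (fun i j k m h => ?_)
    (fun X Y hX hY => by rw [map_add, LinearMap.add_apply, hX.2, hY.2, add_lie, hX.1, hY.1]; simp)
    (fun a X hX => by rw [map_smul, LinearMap.smul_apply, hX.2, smul_lie, hX.1]; simp)
  refine hom_induction (p := fun Y => ⁅el q i j k m, Y⁆ = 0 ∧ psi N q (el q i j k m) Y = 0) hY
    (by simp) (fun i' j' k' m' h' => ?_)
    (fun X Y hX hY => by rw [map_add, hX.2, hY.2, lie_add, hX.1, hY.1]; simp)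
    (fun a X hX => by rw [map_smul, hX.2, lie_smul, hX.1]; simp)
  obtain ⟨rfl, rfl⟩ := eq_of_degree (a := i) (b := j) (k := k) (l := 0) (d := ((j : ℕ) : ℤ))
    (by omega) (by omega)
  obtain ⟨rfl, rfl⟩ := eq_of_degree (a := i') (b := j') (k := k') (l := 0) (d := ((j' : ℕ) : ℤ))
    (by omega) (by omega)
  constructor
  · rw [Ring.lie_def]
    by_cases hij : i = i'
    · subst hij
      rw [el_mul_el_same, el_mul_el_same, mul_zero, mul_zero, add_comm m, sub_self]
    · rw [el_mul_el_of_ne hij, el_mul_el_of_ne (Ne.symm hij), sub_self]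
  · rw [psi_el]
    split_ifs <;> simp

theorem psi_sigma (ε : ℤˣ) (r : ℤ) (X Y : QMat N q) :
    psi N q (sigma ε r X) (sigma ε r Y) = psi N q X Y := by
  have h1 : ∀ X : QMat N q, (sigma ε r X).map QDiff.zDeg = sigma ε r (X.map QDiff.zDeg) := by
    intro X
    ext1 i j
    rw [Matrix.map_apply, sigma_apply, sigma_apply, Matrix.map_apply]
    generalize X j.rev i.rev = x
    induction x using QDiff.induction with
    | h0 => simp
    | hadd x y hx hy => simp only [map_add, hx, hy]
    | hmono k m c =>
      rw [QDiff.sigma_mono, QDiff.zDeg_mono, QDiff.zDeg_mono, QDiff.sigma_mono]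
      congr 1; ring
  have h2 : ∀ x : QDiff q, QDiff.coeff 0 0 (QDiff.sigma ε r x) = QDiff.coeff 0 0 x := by
    intro x
    induction x using QDiff.induction with
    | h0 => simp
    | hadd x y hx hy => simp only [map_add, hx, hy]
    | hmono k m c =>
      rw [QDiff.sigma_mono, QDiff.coeff_mono, QDiff.coeff_mono]
      by_cases h : k = 0 ∧ m = 0
      · obtain ⟨rfl, rfl⟩ := h
        simp
      · rw [if_neg h, if_neg]
        rintro ⟨rfl, h'⟩
        exact h ⟨rfl, by omega⟩
  have h3 : ∀ X : QMat N q, QDiff.coeff 0 0 (Matrix.trace (sigma ε r X))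
      = QDiff.coeff 0 0 (Matrix.trace X) := by
    intro X
    simp only [Matrix.trace, Matrix.diag_apply, map_sum, sigma_apply, h2]
    exact Equiv.sum_comp Fin.revPerm (fun k => QDiff.coeff 0 0 (X k k))
  rw [psi_apply, psi_apply, h1, ← sigma_mul, h3, tr_mul_comm]

/-! ### The realization by doubly infinite matrices -/

variable [NeZero N]

/-- The residue of a position `P = κ N + a`, with `0 ≤ a < N`. -/
def idx (N : ℕ) [NeZero N] (P : ℤ) : Fin N :=
  ⟨(P % N).toNat, by
    have h : (0 : ℤ) < N := by exact_mod_cast NeZero.pos N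
    have := Int.emod_nonneg P h.ne'
    have := Int.emod_lt_of_pos P h
    omega⟩

theorem ediv_mul_add_idx (P : ℤ) : P / N * N + ((idx N P : ℕ) : ℤ) = P := by
  have h : (0 : ℤ) < N := by exact_mod_cast NeZero.pos N
  have := Int.emod_nonneg P h.ne'
  have h' := Int.mul_ediv_add_emod P N
  simp only [idx]
  rw [mul_comm]
  omega

theorem idx_eq {P κ : ℤ} {a : Fin N} (h : κ * N + ((a : ℕ) : ℤ) = P) : idx N P = a ∧ P / N = κ :=
  eq_of_degree (ediv_mul_add_idx P) h

/-- The entry at the positions `P`, `Q` of the doubly infinite matrix of an operator. The vector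
`z ^ κ e_a` stands at the position `κ N + a`, and `T_q` acts on it as `q ^ κ T`, where `T` is a
formal variable. -/
def ent (P Q : ℤ) : QMat N q →ₗ[ℂ] ℂ[T;T⁻¹] :=
  QDiff.lin (fun k m => if k = P / N - Q / N then ((q ^ (Q / N * m) : ℂˣ) : ℂ) • T m else 0)
    ∘ₗ Matrix.entryLinearMap ℂ (QDiff q) (idx N P) (idx N Q)

theorem ent_el (P Q : ℤ) (i j : Fin N) (k m : ℤ) :
    ent P Q (el q i j k m) = if i = idx N P ∧ j = idx N Q ∧ k = P / N - Q / N then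
      ((q ^ (Q / N * m) : ℂˣ) : ℂ) • T m else 0 := by
  rw [ent, LinearMap.comp_apply, Matrix.entryLinearMap_apply, el, Matrix.single_apply]
  by_cases h : i = idx N P ∧ j = idx N Q
  · rw [if_pos h, QDiff.lin_mono, one_smul]
    simp only [h, true_and]
  · rw [if_neg h, map_zero, if_neg fun h' => h ⟨h'.1, h'.2.1⟩]

/-- The entries of a product with a homogeneous right factor. -/
theorem ent_mul {d : ℤ} (X : QMat N q) {Y : QMat N q} (hY : Y ∈ hom N q d) (P Q : ℤ) :
    ent P Q (X * Y) = ent P (Q + d) X * ent (Q + d) Q Y := by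
  refine hom_induction (p := fun Y => ent P Q (X * Y) = ent P (Q + d) X * ent (Q + d) Q Y) hY
    (by simp) (fun i j k m h => ?_) (fun X Y hX hY => by simp only [mul_add, map_add, hX, hY])
    (fun a X hX => by simp only [mul_smul_comm, map_smul, hX])
  induction X using induction_el with
  | zero => simp
  | add X Y hX hY => simp only [add_mul, map_add, hX, hY]
  | smul a X hX => simp only [smul_mul_assoc, map_smul, hX]
  | el i' j' k' m' =>
    by_cases hQ : j = idx N Q
    · obtain ⟨hi, hk⟩ := idx_eq (P := Q + d) (κ := Q / N + k) (a := i) (by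
        have := ediv_mul_add_idx (N := N) Q
        rw [← hQ] at this
        rw [add_mul]; omega)
      by_cases hj : j' = i
      · subst hj
        rw [el_mul_el_same, map_smul, ent_el, ent_el, ent_el, hi, hk]
        simp only [hQ, true_and, add_sub_cancel_left, if_true]
        by_cases hc : i' = idx N P ∧ k' + k = P / N - Q / N
        · rw [if_pos hc, if_pos ⟨hc.1, by omega⟩, smul_mul_smul_comm, ← T_add, smul_smul,
            ← Units.val_mul, ← Units.val_mul, ← zpow_add, ← zpow_add]
          congr 3
          ring
        · rw [if_neg hc, if_neg fun h' => hc ⟨h'.1, by omega⟩, smul_zero, zero_mul]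
      · rw [el_mul_el_of_ne hj, map_zero, ent_el P, if_neg (fun h' => hj (h'.2.1.trans hi)),
          zero_mul]
    · rw [ent_el (Q + d), if_neg fun h' => hQ h'.2.1, mul_zero]
      by_cases hj : j' = i
      · subst hj
        rw [el_mul_el_same, map_smul, ent_el, if_neg fun h' => hQ h'.2.1, smul_zero]
      · rw [el_mul_el_of_ne hj, map_zero]

theorem ent_translate (P Q κ : ℤ) (X : QMat N q) :
    ent (P + κ * N) (Q + κ * N) X = LinRec.twist (q ^ κ) (ent P Q X) := by
  have h : ∀ P : ℤ, idx N (P + κ * N) = idx N P ∧ (P + κ * N) / N = P / N + κ := fun P =>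
    idx_eq (by have := ediv_mul_add_idx (N := N) P; rw [add_mul]; omega)
  induction X using induction_el with
  | zero => simp
  | add X Y hX hY => rw [map_add, hX, hY, map_add, map_add]
  | smul a X hX => rw [map_smul, hX, map_smul, map_smul]
  | el i j k m =>
    rw [ent_el, ent_el, (h P).1, (h P).2, (h Q).1, (h Q).2, add_sub_add_right_eq_sub]
    split_ifs with hc
    · rw [map_smul, LinRec.twist_T, smul_smul, ← Units.val_mul, ← zpow_mul, ← zpow_add]
      congr 3
      ring
    · rw [map_zero]

end QMat

/-! ### The gradation of the central extension -/

namespace SHat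

open LaurentPolynomial QMat LinRec

variable {N : ℕ} {q : ℂˣ} {ε : ℤˣ} {r : ℤ}

theorem ext {u v : SHat N q ε r} (h : op u = op v) (h' : central u = central v) : u = v := by
  apply (LieAlgebra.ofProd (QMat.cocycle N q ε r)).symm.injective
  exact Prod.ext (Subtype.ext h) ((TrivialLieModule.equiv ℂ (QMat.fixed N q ε r) ℂ).injective h')

theorem op_add (u v : SHat N q ε r) : op (u + v) = op u + op v := rfl
theorem op_smul (a : ℂ) (u : SHat N q ε r) : op (a • u) = a • op u := rfl
theorem central_add (u v : SHat N q ε r) : central (u + v) = central u + central v := rfl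
theorem central_smul (a : ℂ) (u : SHat N q ε r) : central (a • u) = a * central u := rfl
theorem op_mk (a : QMat.fixed N q ε r) (x : ℂ) : op (mk a x) = a := rfl
theorem central_mk (a : QMat.fixed N q ε r) (x : ℂ) : central (mk a x) = x := rfl

theorem sigma_op (u : SHat N q ε r) : sigma ε r (op u) = -op u :=
  ((LieAlgebra.ofProd (QMat.cocycle N q ε r)).symm u).1.2

/-- The operator part, as a linear map. -/
def opLin : SHat N q ε r →ₗ[ℂ] QMat N q where
  toFun := op
  map_add' := op_add
  map_smul' := op_smul

theorem opLin_apply (u : SHat N q ε r) : opLin u = op u := rfl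

/-- The map sending `Y` to `Y - σ Y`. -/
def antisym (ε : ℤˣ) (r : ℤ) : QMat N q →ₗ[ℂ] SHat N q ε r where
  toFun Y := mk ⟨Y - sigma ε r Y, sub_sigma_mem_fixed ε r Y⟩ 0
  map_add' Y Z := ext (by rw [op_add, op_mk, op_mk, op_mk]; simp only [map_add]; abel)
    (by rw [central_add, central_mk, central_mk, central_mk, add_zero])
  map_smul' a Y := ext
    (by rw [RingHom.id_apply, op_smul, op_mk, op_mk]; simp only [map_smul, smul_sub])
    (by rw [RingHom.id_apply, central_smul, central_mk, central_mk, mul_zero])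

theorem op_antisym (Y : QMat N q) : op (antisym ε r Y) = Y - sigma ε r Y := rfl
theorem central_antisym (Y : QMat N q) : central (antisym ε r Y) = 0 := rfl

theorem eq_antisym (u : SHat N q ε r) :
    u = (2⁻¹ : ℂ) • antisym ε r (op u) + central u • mk 0 1 := by
  refine ext ?_ ?_
  · rw [op_add, op_smul, op_smul, op_antisym, sigma_op, sub_neg_eq_add, op_mk, ← two_smul ℂ (op u),
      smul_smul]
    simp
  · rw [central_add, central_smul, central_smul, central_antisym, central_mk, mul_zero, zero_add,
      mul_one]

theorem lie_antisym (E : QMat N q) (u : SHat N q ε r) :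
    ⁅antisym ε r E, u⁆ = antisym ε r ⁅E, op u⁆ + (2 * psi N q E (op u)) • mk 0 1 := by
  refine ext ?_ ?_
  · rw [op_lie, op_add, op_smul, op_antisym, op_antisym, op_mk]
    simp only [Ring.lie_def, map_sub, sigma_mul, sigma_op]
    simp only [ZeroMemClass.coe_zero, smul_zero, add_zero]
    noncomm_ring
  · have h : psi N q (sigma ε r E) (op u) = -psi N q E (op u) := by
      have := psi_sigma ε r E (op u)
      rw [sigma_op, map_neg] at this
      rw [← this, neg_neg]
    rw [central_lie, central_add, central_smul, central_antisym, central_mk, op_antisym, map_sub,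
      LinearMap.sub_apply, h]
    ring

theorem mem_grade {d : ℤ} {u : SHat N q ε r} :
    u ∈ grade N q ε r d ↔ op u ∈ hom N q d ∧ (d ≠ 0 → central u = 0) := Iff.rfl

theorem antisym_mem_grade {d : ℤ} {Y : QMat N q} (hY : Y ∈ hom N q d) :
    antisym ε r Y ∈ grade N q ε r d :=
  mem_grade.2 ⟨sub_mem hY (sigma_mem_hom hY), fun _ => rfl⟩

theorem mk_zero_mem_grade (x : ℂ) : mk 0 x ∈ grade N q ε r 0 :=
  mem_grade.2 ⟨zero_mem _, fun h => absurd rfl h⟩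

theorem iSup_grade : ⨆ d, grade N q ε r d = ⊤ := by
  rw [eq_top_iff]
  intro u _
  rw [eq_antisym u]
  refine add_mem (Submodule.smul_mem _ _ ?_) (Submodule.smul_mem _ _
    (Submodule.mem_iSup_of_mem 0 (mk_zero_mem_grade 1)))
  induction op u using induction_el with
  | zero => rw [map_zero]; exact zero_mem _
  | el i j k m => exact Submodule.mem_iSup_of_mem _ (antisym_mem_grade (el_mem_hom m rfl))
  | add X Y hX hY => rw [map_add]; exact add_mem hX hY
  | smul a X hX => rw [map_smul]; exact Submodule.smul_mem _ a hX

theorem iSupIndep_grade : iSupIndep (grade N q ε r) := by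
  intro d
  rw [Submodule.disjoint_def]
  intro u hu hu'
  rw [mem_grade] at hu
  -- coefficients of degree `d` vanish on the other components
  have key : (∀ (i j : Fin N) (k m : ℤ), k * N + ((i : ℕ) : ℤ) - ((j : ℕ) : ℤ) = d →
      QDiff.coeff k m (op u i j) = 0) ∧ (d = 0 → central u = 0) := by
    refine Submodule.iSup_induction _ (motive := fun u =>
      (∀ (i j : Fin N) (k m : ℤ), k * N + ((i : ℕ) : ℤ) - ((j : ℕ) : ℤ) = d →
        QDiff.coeff k m (op u i j) = 0) ∧ (d = 0 → central u = 0)) hu' (fun e u hu => ?_) ?_ ?_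
    · by_cases hed : e = d
      · rw [iSup_neg (by simpa using hed), Submodule.mem_bot] at hu
        rw [hu]
        exact ⟨fun i j k m _ => map_zero _, fun _ => rfl⟩
      · rw [iSup_pos hed, mem_grade] at hu
        refine ⟨fun i j k m h => ?_, fun h => hu.2 (by omega)⟩
        by_contra hne
        exact hed ((hu.1 i j k m hne).symm.trans h)
    · exact ⟨fun i j k m _ => map_zero _, fun _ => rfl⟩
    · intro u v hu hv
      refine ⟨fun i j k m h => ?_, fun h => ?_⟩
      · rw [op_add, Matrix.add_apply, map_add, hu.1 i j k m h, hv.1 i j k m h, add_zero]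
      · rw [central_add, hu.2 h, hv.2 h, add_zero]
  refine ext ?_ ?_
  · ext1 i j
    refine Finsupp.ext fun p => ?_
    by_contra hne
    exact hne (key.1 i j p.1 p.2 (hu.1 i j p.1 p.2 hne))
  · by_cases hd : d = 0
    · exact key.2 hd
    · exact hu.2 hd

theorem isLieGrading : HighestWeight.IsLieGrading (grade N q ε r) where
  internal := (DirectSum.isInternal_submodule_iff_iSupIndep_and_iSup_eq_top _).2
    ⟨iSupIndep_grade, iSup_grade⟩
  lie_mem {d e x y} hx hy := by
    rw [mem_grade] at hx hy ⊢
    rw [op_lie, central_lie]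
    exact ⟨lie_mem_hom hx.1 hy.1, fun h => psi_eq_zero_of_hom h hx.1 hy.1⟩
  lie_zero {x y} hx hy := by
    rw [mem_grade] at hx hy
    obtain ⟨h1, h2⟩ := hom_zero_commute hx.1 hy.1
    exact ext (by rw [op_lie, h1]; rfl) (by rw [central_lie, h2]; rfl)

/-! ### The weight as a family of sequences -/

variable (ℓ : SHat N q ε r →ₗ[ℂ] ℂ)

theorem apply_lie_antisym (E : QMat N q) (u : SHat N q ε r) :
    ℓ ⁅antisym ε r E, u⁆ = ℓ (antisym ε r ⁅E, op u⁆) + 2 * psi N q E (op u) * ℓ (mk 0 1) := by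
  rw [lie_antisym, map_add, map_smul, smul_eq_mul]

variable [NeZero N]

/-- The value of a linear functional on `T ^ n` at the diagonal place `P` of the doubly infinite
matrices: `P = κ N + a` contributes the antisymmetrization of `(q ^ (-κ) T_q) ^ n E_{aa}` and, if
`n = 0`, `2 κ` times the central element, where the factor `2` is the one of `lie_antisym`. -/
def diagSeq (P n : ℤ) : ℂ :=
  ((q ^ (-(P / N * n)) : ℂˣ) : ℂ) * ℓ (antisym ε r (el q (idx N P) (idx N P) 0 n))
    + if n = 0 then 2 * ((P / N : ℤ) : ℂ) * ℓ (mk 0 1) else 0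

/-- The differences of consecutive diagonal sequences, the values on the simple coroots. -/
def rootSeq (P n : ℤ) : ℂ := diagSeq ℓ (P + 1) n - diagSeq ℓ P n

theorem lin_sub (f g : ℤ → ℂ) : lin (fun n => f n - g n) = lin f - lin g :=
  ext_lin fun n => by rw [LinearMap.sub_apply, lin_T, lin_T, lin_T]

/-- The form `ℓ([E, X])`, for `E` and `X` of opposite degrees, in terms of the doubly infinite
matrices: the diagonal entries of the product are paired with the differences of the diagonal
sequences. -/
theorem apply_lie_eq_sum {d : ℤ} {E X : QMat N q} (hE : E ∈ hom N q d) (hX : X ∈ hom N q (-d)) :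
    ℓ (antisym ε r ⁅E, X⁆) + 2 * psi N q E X * ℓ (mk 0 1)
      = ∑ b : Fin N, lin (fun n => diagSeq ℓ (((b : ℕ) : ℤ) + d) n - diagSeq ℓ ((b : ℕ) : ℤ) n)
        (ent (((b : ℕ) : ℤ) + d) ((b : ℕ) : ℤ) E * ent ((b : ℕ) : ℤ) (((b : ℕ) : ℤ) + d) X) := by
  refine hom_induction (p := fun E => ℓ (antisym ε r ⁅E, X⁆) + 2 * psi N q E X * ℓ (mk 0 1)
      = ∑ b : Fin N, lin (fun n => diagSeq ℓ (((b : ℕ) : ℤ) + d) n - diagSeq ℓ ((b : ℕ) : ℤ) n)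
        (ent (((b : ℕ) : ℤ) + d) ((b : ℕ) : ℤ) E * ent ((b : ℕ) : ℤ) (((b : ℕ) : ℤ) + d) X)) hE
    (by simp) (fun a b k m hE => ?_)
    (fun E F hE hF => by
      simp only [add_lie, map_add, LinearMap.add_apply, add_mul, Finset.sum_add_distrib, ← hE, ← hF]
      ring)
    (fun c E hE => by
      simp only [smul_lie, map_smul, LinearMap.smul_apply, smul_mul_assoc, ← Finset.smul_sum, ← hE]
      simp only [smul_eq_mul]; ring)
  refine hom_induction (p := fun X => ℓ (antisym ε r ⁅el q a b k m, X⁆)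
        + 2 * psi N q (el q a b k m) X * ℓ (mk 0 1)
      = ∑ c : Fin N, lin (fun n => diagSeq ℓ (((c : ℕ) : ℤ) + d) n - diagSeq ℓ ((c : ℕ) : ℤ) n)
        (ent (((c : ℕ) : ℤ) + d) ((c : ℕ) : ℤ) (el q a b k m)
          * ent ((c : ℕ) : ℤ) (((c : ℕ) : ℤ) + d) X)) hX
    (by simp) (fun b' a' k' n hX => ?_)
    (fun E F hE hF => by
      simp only [lie_add, map_add, mul_add, add_mul, Finset.sum_add_distrib, ← hE, ← hF]
      ring)
    (fun c E hE => by
      simp only [lie_smul, map_smul, mul_smul_comm, ← Finset.smul_sum, ← hE]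
      simp only [smul_eq_mul]; ring)
  have hidx : ∀ c : Fin N, idx N ((c : ℕ) : ℤ) = c ∧ ((c : ℕ) : ℤ) / N = 0 := fun c =>
    idx_eq (by rw [zero_mul, zero_add])
  have hbd : idx N (((b : ℕ) : ℤ) + d) = a ∧ (((b : ℕ) : ℤ) + d) / N = k := idx_eq (by omega)
  rw [Finset.sum_eq_single b]
  · by_cases hb : b = b'
    · subst hb
      obtain ⟨rfl, hk⟩ := eq_of_degree (a := a) (b := a') (k := k) (l := -k')
        (d := ((b : ℕ) : ℤ) + d) (by omega) (by rw [neg_mul]; omega)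
      obtain rfl : k' = -k := by omega
      rw [ent_el, ent_el, hbd.1, hbd.2, (hidx b).1, (hidx b).2, if_pos ⟨rfl, rfl, by ring⟩,
        if_pos ⟨rfl, rfl, by ring⟩, smul_mul_smul_comm, ← T_add, map_smul, lin_T, psi_el,
        Ring.lie_def, el_mul_el_same, el_mul_el_same, map_sub, map_sub, map_smul, map_smul,
        map_smul, map_smul,
        add_neg_cancel, neg_add_cancel, add_comm n m, diagSeq, diagSeq, hbd.1, hbd.2, (hidx b).1,
        (hidx b).2]
      simp only [smul_eq_mul, zero_mul, zpow_zero, Units.val_one, one_mul, neg_zero, Int.cast_zero,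
        mul_zero, ite_self, add_zero, neg_neg, and_self, and_true, true_and]
      have h1 : ((q ^ (m * -k) : ℂˣ) : ℂ)
          = ((q ^ (k * n) : ℂˣ) : ℂ) * ((q ^ (-(k * (m + n))) : ℂˣ) : ℂ) := by
        rw [← Units.val_mul, ← zpow_add]; congr 2; ring
      rw [h1, mul_comm n k]
      by_cases hmn : m = -n
      · subst hmn
        have h2 : (q : ℂˣ) ^ (-k * -n) = q ^ (k * n) := by congr 1; ring
        rw [if_pos rfl, if_pos (neg_add_cancel n), h2]
        ring
      · rw [if_neg hmn, if_neg (by omega)]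
        ring
    · have ha : a' ≠ a := by
        rintro rfl
        exact hb (eq_of_degree (a := b) (b := b') (k := -k) (l := k') (d := ((a' : ℕ) : ℤ) - d)
          (by rw [neg_mul]; omega) (by omega)).1
      rw [Ring.lie_def, el_mul_el_of_ne hb, el_mul_el_of_ne ha, psi_el, if_neg fun h => hb h.2.2.1,
        ent_el ((b : ℕ) : ℤ), if_neg fun h => hb ((hidx b).1.symm.trans h.1.symm)]
      simp
  · intro c _ hc
    rw [ent_el, if_neg fun h => hc (by rw [h.2.1, (hidx c).1]), zero_mul, map_zero]
  · intro h
    exact absurd (Finset.mem_univ b) h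

theorem diagSeq_translate (P κ n : ℤ) : diagSeq ℓ (P + κ * N) n
    = ((q ^ (-(κ * n)) : ℂˣ) : ℂ) * diagSeq ℓ P n
      + if n = 0 then 2 * (κ : ℂ) * ℓ (mk 0 1) else 0 := by
  have h : idx N (P + κ * N) = idx N P ∧ (P + κ * N) / N = P / N + κ :=
    idx_eq (by have := ediv_mul_add_idx (N := N) P; rw [add_mul]; omega)
  rw [diagSeq, diagSeq, h.1, h.2]
  have h1 : ((q ^ (-((P / N + κ) * n)) : ℂˣ) : ℂ)
      = ((q ^ (-(κ * n)) : ℂˣ) : ℂ) * ((q ^ (-(P / N * n)) : ℂˣ) : ℂ) := by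
    rw [← Units.val_mul, ← zpow_add]; congr 2; ring
  rw [h1]
  by_cases hn : n = 0
  · subst hn
    simp
    ring
  · rw [if_neg hn, if_neg hn, if_neg hn]
    ring

theorem rootSeq_translate (P κ n : ℤ) :
    rootSeq ℓ (P + κ * N) n = ((q ^ (-(κ * n)) : ℂˣ) : ℂ) * rootSeq ℓ P n := by
  rw [rootSeq, rootSeq, add_right_comm, diagSeq_translate, diagSeq_translate]
  ring

theorem diagSeq_reflect (P n : ℤ) :
    diagSeq ℓ (N - 1 - P) (-n) = -(((q ^ (-n) : ℂˣ) : ℂ) * diagSeq ℓ P n) := by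
  have h : idx N (N - 1 - P) = (idx N P).rev ∧ (N - 1 - P) / N = -(P / N) :=
    idx_eq (by
      have := ediv_mul_add_idx (N := N) P
      have hlt := (idx N P).2
      rw [Fin.val_rev, neg_mul]; omega)
  have hs : antisym ε r (el q (idx N P) (idx N P) 0 n)
      = -(((q ^ n : ℂˣ) : ℂ) • antisym ε r (el q (idx N P).rev (idx N P).rev 0 (-n))) := by
    rw [← map_smul, ← map_neg]
    have he : ((q ^ n : ℂˣ) : ℂ) • el q (idx N P).rev (idx N P).rev 0 (-n)
        = sigma ε r (el q (idx N P) (idx N P) 0 n) := by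
      rw [sigma_el]; simp
    rw [he]
    refine ext ?_ (by rw [central_antisym, central_antisym])
    rw [op_antisym, op_antisym, map_neg, sigma_sigma]
    abel
  rw [diagSeq, diagSeq, h.1, h.2, hs, map_neg, map_smul, smul_eq_mul]
  have h1 : ((q ^ (-(-(P / N) * -n)) : ℂˣ) : ℂ)
      = ((q ^ (-n) : ℂˣ) : ℂ) * ((q ^ (-(P / N * n)) : ℂˣ) : ℂ) * ((q ^ n : ℂˣ) : ℂ) := by
    rw [← Units.val_mul, ← Units.val_mul, ← zpow_add, ← zpow_add]; congr 2; ring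
  rw [h1]
  by_cases hn : n = 0
  · subst hn
    simp
    ring
  · rw [if_neg hn, if_neg (neg_ne_zero.2 hn)]
    ring

theorem rootSeq_reflect (P n : ℤ) :
    rootSeq ℓ (N - 2 - P) (-n) = ((q ^ (-n) : ℂˣ) : ℂ) * rootSeq ℓ P n := by
  have h1 : (N : ℤ) - 2 - P + 1 = N - 1 - P := by ring
  have h2 : (N : ℤ) - 2 - P = N - 1 - (P + 1) := by ring
  rw [rootSeq, h1, h2, diagSeq_reflect, diagSeq_reflect, rootSeq]
  ring

theorem mem_annIdeal_diagSeq_sub {y : ℂ[T;T⁻¹]} {P : ℤ} (j : ℕ)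
    (h : ∀ p, P ≤ p → p < P + j → y ∈ annIdeal (rootSeq ℓ p)) :
    y ∈ annIdeal fun n => diagSeq ℓ (P + j) n - diagSeq ℓ P n := by
  induction j with
  | zero =>
    intro z
    rw [lin_sub, Nat.cast_zero, add_zero, sub_self]
    rfl
  | succ j ih =>
    have h1 := ih fun p hp hp' => h p hp (by push_cast; omega)
    have h2 := h (P + j) (by omega) (by push_cast; omega)
    intro z
    have hs : (fun n => diagSeq ℓ (P + ((j + 1 : ℕ) : ℤ)) n - diagSeq ℓ P n)
        = fun n => rootSeq ℓ (P + j) n - (diagSeq ℓ P n - diagSeq ℓ (P + j) n) := by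
      ext n
      rw [rootSeq]
      push_cast
      rw [add_assoc P]
      ring
    have h1' := h1 z
    rw [lin_sub, LinearMap.sub_apply] at h1'
    rw [hs, lin_sub, lin_sub, LinearMap.sub_apply, LinearMap.sub_apply, h2 z]
    linear_combination h1'

/-! ### From quasifiniteness to recurrences -/

theorem coeff_ent_sigma_el {b a : Fin N} {k n : ℤ} (P Q e : ℤ) (he : -k * r - n ≠ e) :
    (ent P Q (sigma ε r (el q b a (-k) n))).coeff e = 0 := by
  rw [sigma_el, map_smul, AddMonoidAlgebra.coeff_smul_apply, ent_el]
  split_ifs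
  · rw [AddMonoidAlgebra.coeff_smul_apply, T_apply, if_neg he, smul_zero, smul_zero]
  · rw [AddMonoidAlgebra.coeff_zero, Finsupp.zero_apply, smul_zero]

/-- If an element `x` of degree `-1` has zero bracket with all elements of degree `1`, as seen by
`ℓ`, then its entries give recurrences for the sequences `rootSeq`. -/
theorem ent_mem_annIdeal {x : SHat N q ε r} (hx : x ∈ grade N q ε r (-1))
    (h : ∀ e ∈ grade N q ε r 1, ℓ ⁅e, x⁆ = 0) (b : Fin N) :
    ent ((b : ℕ) : ℤ) (((b : ℕ) : ℤ) + 1) (op x) ∈ annIdeal (rootSeq ℓ ((b : ℕ) : ℤ)) := by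
  refine mem_annIdeal.2 fun m => ?_
  set a := idx N (((b : ℕ) : ℤ) + 1) with ha
  set k := (((b : ℕ) : ℤ) + 1) / N with hk
  have hdeg : k * N + ((a : ℕ) : ℤ) - ((b : ℕ) : ℤ) = 1 := by
    have := ediv_mul_add_idx (N := N) (((b : ℕ) : ℤ) + 1)
    rw [← hk, ← ha] at this
    omega
  have hidx : ∀ c : Fin N, idx N ((c : ℕ) : ℤ) = c ∧ ((c : ℕ) : ℤ) / N = 0 := fun c =>
    idx_eq (by rw [zero_mul, zero_add])
  have hE : el q a b k m ∈ hom N q 1 := el_mem_hom m hdeg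
  have h1 := h _ (antisym_mem_grade (ε := ε) (r := r) hE)
  rw [apply_lie_antisym, apply_lie_eq_sum ℓ hE (mem_grade.1 hx).1, Finset.sum_eq_single b] at h1
  · rwa [ent_el, if_pos ⟨ha, (hidx b).1.symm, by rw [(hidx b).2, sub_zero]⟩, (hidx b).2, zero_mul,
      zpow_zero, Units.val_one, one_smul] at h1
  · intro c _ hc
    rw [ent_el, if_neg fun h => hc (by rw [h.2.1, (hidx c).1]), zero_mul, map_zero]
  · intro h
    exact absurd (Finset.mem_univ b) h

/-- In degree `-1`, the place `(b, b + 1)` is occupied by infinitely many independent elements, and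
quasifiniteness gives a relation between their images of the highest weight vector. -/
theorem hasRec_of_isQuasifinite {lam : Module.Dual ℂ (grade N q ε r 0)}
    (hfin : HighestWeight.IsQuasifinite (grade N q ε r) lam) (b : Fin N) :
    HasRec (rootSeq (HighestWeight.extend isLieGrading lam) ((b : ℕ) : ℤ)) := by
  set a := idx N (((b : ℕ) : ℤ) + 1) with ha
  set k := (((b : ℕ) : ℤ) + 1) / N with hk
  have hN : (0 : ℤ) < N := by exact_mod_cast NeZero.pos N
  have hak := ediv_mul_add_idx (N := N) (((b : ℕ) : ℤ) + 1)
  rw [← hk, ← ha] at hak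
  have hdeg : -k * N + ((b : ℕ) : ℤ) - ((a : ℕ) : ℤ) = -1 := by rw [neg_mul]; omega
  have hidx : idx N ((b : ℕ) : ℤ) = b ∧ ((b : ℕ) : ℤ) / N = 0 :=
    idx_eq (by rw [zero_mul, zero_add])
  have hk0 : 0 ≤ k := Int.ediv_nonneg (by omega) hN.le
  have hk1 : k ≤ 1 := by
    have := b.2
    rw [hk, Int.ediv_le_iff_le_mul hN]
    omega
  -- exponents so large that the images under `σ` of these elements have other exponents
  let f : ℕ → ℤ := fun n => |r| + 1 + n
  have hf : ∀ n m, -k * r - f n ≠ f m := by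
    intro n m
    have h1 : -k * r ≤ |r| := by
      rcases (by omega : k = 0 ∨ k = 1) with h | h <;> rw [h]
      · simp
      · rw [neg_mul, one_mul]; exact neg_le_abs r
    have := abs_nonneg r
    simp only [f]
    omega
  obtain ⟨c, hc, hc'⟩ := hfin.exists_combination lam isLieGrading
    (x := fun n => antisym ε r (el q b a (-k) (f n)))
    (fun n => antisym_mem_grade (el_mem_hom _ hdeg))
  refine ⟨_, ent_mem_annIdeal _ ?_ hc' b, fun h0 => hc ?_⟩
  · rw [Finsupp.linearCombination_apply]
    exact Submodule.sum_mem _ fun n _ => Submodule.smul_mem _ _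
      (antisym_mem_grade (el_mem_hom _ hdeg))
  · ext n
    have h1 := congrArg (fun y : ℂ[T;T⁻¹] => y.coeff (f n)) h0
    simp only [AddMonoidAlgebra.coeff_zero, Finsupp.zero_apply] at h1
    rw [← opLin_apply, Finsupp.linearCombination_apply, Finsupp.sum, map_sum, map_sum,
      AddMonoidAlgebra.coeff_sum, Finsupp.finsetSum_apply, Finset.sum_eq_single n] at h1
    · rw [map_smul, map_smul, AddMonoidAlgebra.coeff_smul_apply, opLin_apply, op_antisym, map_sub,
        AddMonoidAlgebra.coeff_sub, Finsupp.sub_apply,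
        coeff_ent_sigma_el _ _ _ (hf n n), ent_el,
        if_pos ⟨hidx.1.symm, ha, by rw [hidx.2, zero_sub]⟩, AddMonoidAlgebra.coeff_smul_apply,
        T_apply, if_pos rfl, sub_zero, smul_eq_mul, smul_eq_mul, mul_one] at h1
      exact (mul_eq_zero.1 h1).resolve_right (Units.ne_zero _)
    · intro m _ hm
      rw [map_smul, map_smul, AddMonoidAlgebra.coeff_smul_apply, opLin_apply, op_antisym, map_sub,
        AddMonoidAlgebra.coeff_sub, Finsupp.sub_apply,
        coeff_ent_sigma_el _ _ _ (hf m n), ent_el,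
        if_pos ⟨hidx.1.symm, ha, by rw [hidx.2, zero_sub]⟩, AddMonoidAlgebra.coeff_smul_apply,
        T_apply, if_neg (by simp only [f]; omega), sub_zero, smul_zero, smul_zero]
    · intro hn
      rw [Finsupp.notMem_support_iff.1 hn, zero_smul, map_zero, map_zero]
      rfl

/-! ### From recurrences to quasifiniteness -/

/-- The elements `x` of degree `-j` all of whose entries, at the places `(P, P + j)`, are
recurrences for the sequences `rootSeq` with index in `[P, P + j)`. -/
def recSet (ℓ : SHat N q ε r →ₗ[ℂ] ℂ) (j : ℤ) : Set (SHat N q ε r) :=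
  {x | x ∈ grade N q ε r (-j) ∧ ∀ P p, P ≤ p → p < P + j →
    ent P (P + j) (op x) ∈ annIdeal (rootSeq ℓ p)}

theorem lie_mem_recSet {i j : ℤ} (hi : 0 ≤ i) {e x : SHat N q ε r}
    (he : e ∈ grade N q ε r i) (hx : x ∈ recSet ℓ j) : ⁅e, x⁆ ∈ recSet ℓ (j - i) := by
  obtain ⟨hxg, hx⟩ := hx
  refine ⟨?_, fun P p hP hp => ?_⟩
  · have := isLieGrading.lie_mem he hxg
    rwa [show i + -j = -(j - i) by ring] at this
  · rw [op_lie, Ring.lie_def, map_sub, ent_mul _ (mem_grade.1 hxg).1, ent_mul _ (mem_grade.1 he).1]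
    refine sub_mem (Ideal.mul_mem_left _ _ ?_) (Ideal.mul_mem_right _ _ ?_)
    · have := hx (P - i) p (by omega) (by omega)
      rwa [show P - i + j = P + (j - i) by ring, show P - i = P + (j - i) + -j by ring] at this
    · have := hx P p hP (by omega)
      rwa [show P + j = P + (j - i) + i by ring] at this

theorem apply_lie_recSet {j : ℤ} (hj : 0 < j) {e x : SHat N q ε r} (he : e ∈ grade N q ε r j)
    (hx : x ∈ recSet ℓ j) : ℓ ⁅e, x⁆ = 0 := by
  obtain ⟨hxg, hx⟩ := hx
  rw [mem_grade] at he hxg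
  obtain ⟨n, rfl⟩ := Int.eq_ofNat_of_zero_le hj.le
  rw [eq_antisym e, he.2 hj.ne', zero_smul, add_zero, smul_lie, map_smul, apply_lie_antisym,
    apply_lie_eq_sum ℓ he.1 hxg.1, Finset.sum_eq_zero, smul_zero]
  intro b _
  exact mem_annIdeal_diagSeq_sub ℓ n (hx ((b : ℕ) : ℤ)) _

/-- The map whose kernel consists of elements of `recSet`: by periodicity it suffices to consider
the rows `P = 0, …, N - 1`. -/
def recMap (j : ℕ) : grade N q ε r (-j) →ₗ[ℂ]
    ((b : Fin N) → (p : Fin j) →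
      ℂ[T;T⁻¹] ⧸ annIdeal (rootSeq ℓ (((b : ℕ) : ℤ) + ((p : ℕ) : ℤ)))) :=
  LinearMap.pi fun b => LinearMap.pi fun p =>
    (Ideal.Quotient.mkₐ ℂ (annIdeal (rootSeq ℓ (((b : ℕ) : ℤ) + ((p : ℕ) : ℤ))))).toLinearMap
      ∘ₗ ent ((b : ℕ) : ℤ) (((b : ℕ) : ℤ) + j) ∘ₗ opLin ∘ₗ (grade N q ε r (-j)).subtype

theorem mem_recSet_of_recMap {j : ℕ} {x : grade N q ε r (-j)} (hx : recMap ℓ j x = 0) :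
    (x : SHat N q ε r) ∈ recSet ℓ j := by
  have h : ∀ (b : Fin N) (p : Fin j), ent ((b : ℕ) : ℤ) (((b : ℕ) : ℤ) + j) (op (x : SHat N q ε r))
      ∈ annIdeal (rootSeq ℓ (((b : ℕ) : ℤ) + ((p : ℕ) : ℤ))) := fun b p =>
    Ideal.Quotient.eq_zero_iff_mem.1 (congrFun (congrFun hx b) p)
  refine ⟨x.2, fun P p hP hp => ?_⟩
  have hPb := ediv_mul_add_idx (N := N) P
  obtain ⟨i, hi⟩ := Int.eq_ofNat_of_zero_le (sub_nonneg.2 hP)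
  have h1 := h (idx N P) ⟨i, by omega⟩
  have hP' : P = ((idx N P : ℕ) : ℤ) + P / N * N := by omega
  have hPj : P + j = ((idx N P : ℕ) : ℤ) + j + P / N * N := by omega
  have hp' : p = ((idx N P : ℕ) : ℤ) + (i : ℤ) + P / N * N := by omega
  have h2 : ent P (P + j) (op (x : SHat N q ε r)) = twist (q ^ (P / N))
      (ent ((idx N P : ℕ) : ℤ) (((idx N P : ℕ) : ℤ) + j) (op (x : SHat N q ε r))) := by
    rw [← ent_translate, ← hPj, ← hP']
  rw [h2]
  refine twist_mem_annIdeal ?_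
  have h3 : (fun n => (((q ^ (P / N)) ^ n : ℂˣ) : ℂ) * rootSeq ℓ p n)
      = rootSeq ℓ (((idx N P : ℕ) : ℤ) + (i : ℤ)) := by
    ext n
    rw [hp', rootSeq_translate, ← mul_assoc, ← Units.val_mul, ← zpow_mul, ← zpow_add,
      add_neg_cancel, zpow_zero, Units.val_one, one_mul]
  rw [h3]
  exact h1

theorem finiteDimensional_map_of_ker_le {M V W : Type*} [AddCommGroup M] [Module ℂ M]
    [AddCommGroup V] [Module ℂ V] [AddCommGroup W] [Module ℂ W] [FiniteDimensional ℂ W]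
    (S : Submodule ℂ M) (f : M →ₗ[ℂ] V) (g : S →ₗ[ℂ] W)
    (h : ∀ x : S, g x = 0 → f x = 0) : FiniteDimensional ℂ (S.map f) := by
  have hle : LinearMap.ker g ≤ LinearMap.ker (f ∘ₗ S.subtype) := h
  have : FiniteDimensional ℂ (S ⧸ LinearMap.ker g) :=
    Module.Finite.equiv g.quotKerEquivRange.symm
  refine Submodule.finiteDimensional_of_le
    (S₂ := LinearMap.range ((LinearMap.ker g).liftQ (f ∘ₗ S.subtype) hle)) ?_
  rintro _ ⟨x, hx, rfl⟩
  exact ⟨(LinearMap.ker g).mkQ ⟨x, hx⟩, rfl⟩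

theorem isQuasifinite_of_hasRec {lam : Module.Dual ℂ (grade N q ε r 0)}
    (h : ∀ P, HasRec (rootSeq (HighestWeight.extend isLieGrading lam) P)) :
    HighestWeight.IsQuasifinite (grade N q ε r) lam := by
  refine HighestWeight.isQuasifinite_of_orbit isLieGrading lam fun d hd => ?_
  obtain ⟨j, hj⟩ := Int.eq_ofNat_of_zero_le (neg_nonneg.2 hd.le)
  obtain rfl : d = -j := by omega
  have := fun P => finite_quotient (h P)
  refine finiteDimensional_map_of_ker_le _ _
    (recMap (HighestWeight.extend isLieGrading lam) j) fun x hx => ?_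
  have hmem := HighestWeight.smul_hwVector_mem_maxProper lam isLieGrading
    (K := recSet (HighestWeight.extend isLieGrading lam))
    (fun j _ x hx => hx.1) (fun i j hi _ e he x hx => lie_mem_recSet _ hi he hx)
    (fun j hj e he x hx => apply_lie_recSet _ hj he hx) (j := j) (by omega)
    (mem_recSet_of_recMap _ hx)
  rw [HighestWeight.orbitMap_apply, ← map_smul]
  exact (Submodule.Quotient.mk_eq_zero _).2 hmem

/-! ### Labels -/

theorem pos_eq_idx {i : ℕ} (h1 : 1 ≤ i) (hi : i ≤ N) :
    pos N i = idx N ((i : ℤ) - 1) ∧ ((i : ℤ) - 1) / N = 0 := by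
  have hval : ((pos N i : ℕ) : ℤ) = (i : ℤ) - 1 := by
    simp only [pos, Fin.val_ofNat]
    rw [Nat.mod_eq_of_lt (by omega)]
    omega
  have := idx_eq (N := N) (κ := 0) (a := pos N i) (P := (i : ℤ) - 1) (by rw [hval]; ring)
  exact ⟨this.1.symm, this.2⟩

theorem label_eq_diagSeq {s : ℂˣ} (hs : s ^ 2 = q) (lam : Module.Dual ℂ (grade N q ε r 0)) {i : ℕ}
    (h1 : 1 ≤ i) (hi : i ≤ N) (l : ℤ) :
    label hs lam i l = ((s ^ (-l) : ℂˣ) : ℂ) *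
      diagSeq (HighestWeight.extend isLieGrading lam) ((i : ℤ) - 1) l := by
  obtain ⟨hp, h0⟩ := pos_eq_idx h1 hi
  have hc : mk ⟨cartan N q s i l, cartan_mem hs ε r i l⟩ 0
      = ((s ^ (-l) : ℂˣ) : ℂ) • antisym ε r (el q (pos N i) (pos N i) 0 l) := by
    rw [← map_smul]
    refine ext ?_ ?_
    · rw [op_mk, op_antisym, map_smul, sigma_el]
      change cartan N q s i l = _
      rw [cartan, single_mono, single_mono, smul_smul]
      have h2 : ((s ^ (-l) : ℂˣ) : ℂ) * ((q ^ l : ℂˣ) : ℂ) = ((s ^ l : ℂˣ) : ℂ) := by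
        rw [← Units.val_mul, ← hs, ← zpow_natCast, ← zpow_mul, ← zpow_add]
        congr 2; push_cast; ring
      simp only [zpow_zero, Units.val_one, Int.cast_one, one_mul, zero_mul, zero_sub, sub_zero,
        Int.zero_ediv, mul_zero, zero_add, h2]
    · rw [central_mk, central_antisym]
  have hl : label hs lam i l = HighestWeight.extend isLieGrading lam
      (mk ⟨cartan N q s i l, cartan_mem hs ε r i l⟩ 0) :=
    (HighestWeight.extend_zero isLieGrading lam (cartanElt hs ε r i l)).symm
  rw [hl, hc, map_smul, smul_eq_mul, diagSeq, h0, ← hp]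
  simp

theorem label_succ_sub {s : ℂˣ} (hs : s ^ 2 = q) (lam : Module.Dual ℂ (grade N q ε r 0)) {i : ℕ}
    (h1 : 1 ≤ i) (hi : i + 1 ≤ N) (l : ℤ) :
    label hs lam (i + 1) l - label hs lam i l = (((s⁻¹) ^ l : ℂˣ) : ℂ) *
      rootSeq (HighestWeight.extend isLieGrading lam) ((i : ℤ) - 1) l := by
  rw [label_eq_diagSeq hs lam (by omega) hi, label_eq_diagSeq hs lam h1 (by omega), rootSeq,
    inv_zpow, zpow_neg]
  push_cast
  rw [sub_add_cancel, add_sub_cancel_right]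
  ring

theorem charge_eq (lam : Module.Dual ℂ (grade N q ε r 0)) :
    charge lam = HighestWeight.extend isLieGrading lam (mk 0 1) :=
  (HighestWeight.extend_zero isLieGrading lam (centralElt N q ε r)).symm

/-- As the positions `0` and `N` differ by one period, the central charge enters the difference of
the diagonal sequences there. -/
theorem labelN_sub (lam : Module.Dual ℂ (grade N q ε r 0)) (l : ℤ) :
    labelN lam l - (if l = 0 then 2 * charge lam else 0)
      = -rootSeq (HighestWeight.extend isLieGrading lam) ((N : ℤ) - 1) l := by
  have hN := NeZero.pos N
  obtain ⟨hp1, h01⟩ := pos_eq_idx (N := N) le_rfl hN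
  obtain ⟨hpN, h0N⟩ := pos_eq_idx (N := N) hN le_rfl
  have hr : (pos N 1).rev = pos N N := by rw [← pos_rev, Fin.rev_rev]
  have hc : mk ⟨cartanN N q l, cartanN_mem q ε r l⟩ 0
      = antisym ε r (el q (pos N N) (pos N N) 0 l)
        - ((q ^ (-l) : ℂˣ) : ℂ) • antisym ε r (el q (pos N 1) (pos N 1) 0 l) := by
    rw [← map_smul, ← map_sub]
    refine ext ?_ ?_
    · rw [op_mk, op_antisym, map_sub, map_smul, sigma_el, sigma_el]
      change cartanN N q l = _
      rw [cartanN, Matrix.single_add, Matrix.single_add, single_mono, single_mono, single_mono,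
        single_mono, smul_smul, pos_rev, hr]
      have h2 : ((q ^ (-l) : ℂˣ) : ℂ) * ((q ^ l : ℂˣ) : ℂ) = 1 := by
        rw [← Units.val_mul, ← zpow_add, neg_add_cancel, zpow_zero, Units.val_one]
      simp only [zpow_zero, Units.val_one, Int.cast_one, one_mul, zero_mul, zero_sub, sub_zero,
        Int.zero_ediv, mul_zero, zero_add, h2, one_smul]
      abel
    · rw [central_mk, central_antisym]
  have hl : labelN lam l = HighestWeight.extend isLieGrading lam
      (mk ⟨cartanN N q l, cartanN_mem q ε r l⟩ 0) :=
    (HighestWeight.extend_zero isLieGrading lam (cartanNElt N q ε r l)).symm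
  have hP : (N : ℤ) - 1 + 1 = 0 + 1 * N := by ring
  rw [hl, hc, map_sub, map_smul, smul_eq_mul, charge_eq, rootSeq, hP, diagSeq_translate, diagSeq,
    diagSeq, h0N, ← hpN]
  rw [Nat.cast_one, sub_self] at hp1
  rw [← hp1]
  by_cases hl0 : l = 0
  · subst hl0
    simp
    ring
  · simp [hl0]

end SHat

/-! ### The equivalence -/

namespace SHat

open LinRec

variable {N : ℕ} {q : ℂˣ} {ε : ℤˣ} {r : ℤ} [NeZero N]

theorem hasRec_label_sub_iff {s : ℂˣ} (hs : s ^ 2 = q) (lam : Module.Dual ℂ (grade N q ε r 0))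
    {i : ℕ} (h1 : 1 ≤ i) (hi : i + 1 ≤ N) :
    HasRec (label hs lam (i + 1) - label hs lam i)
      ↔ HasRec (rootSeq (HighestWeight.extend isLieGrading lam) ((i : ℤ) - 1)) := by
  rw [← hasRec_twist (u := s⁻¹)
    (f := rootSeq (HighestWeight.extend isLieGrading lam) ((i : ℤ) - 1))]
  exact iff_of_eq (congrArg HasRec (funext fun l => label_succ_sub hs lam h1 hi l))

theorem hasRec_labelN_iff (lam : Module.Dual ℂ (grade N q ε r 0)) :
    HasRec (fun l => labelN lam l - if l = 0 then 2 * charge lam else 0)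
      ↔ HasRec (rootSeq (HighestWeight.extend isLieGrading lam) ((N : ℤ) - 1)) := by
  have h : (fun l => labelN lam l - if l = 0 then 2 * charge lam else 0)
      = -rootSeq (HighestWeight.extend isLieGrading lam) ((N : ℤ) - 1) :=
    funext fun l => labelN_sub lam l
  rw [h]
  exact ⟨fun h => by simpa using h.neg, HasRec.neg⟩

theorem labelN_neg (lam : Module.Dual ℂ (grade N q ε r 0)) (l : ℤ) :
    labelN lam (-l) = labelN lam l := by
  have h : cartanN N q (-l) = cartanN N q l := by
    rw [cartanN, cartanN, neg_neg, add_comm, add_comm (QDiff.mono q 0 (-l) _)]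
  have hmk : ∀ (a b : QMat.fixed N q ε r) (ha : mk a 0 ∈ grade N q ε r 0)
      (hb : mk b 0 ∈ grade N q ε r 0), a = b →
      (⟨mk a 0, ha⟩ : grade N q ε r 0) = ⟨mk b 0, hb⟩ := by
    rintro a _ _ _ rfl
    rfl
  exact congrArg lam (hmk _ _ _ _ (Subtype.ext h))

/-- For even `N`, the difference of the two middle labels is an even sequence. -/
theorem label_sub_neg {s : ℂˣ} (hs : s ^ 2 = q) (lam : Module.Dual ℂ (grade N q ε r 0))
    (hN : Even N) (l : ℤ) :
    label hs lam (N / 2 + 1) (-l) - label hs lam (N / 2) (-l)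
      = label hs lam (N / 2 + 1) l - label hs lam (N / 2) l := by
  have hpos := NeZero.pos N
  obtain ⟨m, hm⟩ := hN
  rw [label_succ_sub hs lam (by omega) (by omega), label_succ_sub hs lam (by omega) (by omega)]
  have h := rootSeq_reflect (HighestWeight.extend isLieGrading lam) (((N / 2 : ℕ) : ℤ) - 1) l
  rw [show (N : ℤ) - 2 - (((N / 2 : ℕ) : ℤ) - 1) = ((N / 2 : ℕ) : ℤ) - 1 by omega] at h
  rw [h, ← mul_assoc, ← Units.val_mul]
  congr 3
  rw [← hs, ← zpow_natCast, ← zpow_mul, inv_zpow', inv_zpow', ← zpow_add]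
  congr 1
  push_cast
  ring

/-- Recurrences for the labels of the statement suffice: the symmetries of the sequences `rootSeq`
relate any index to one of those. -/
theorem hasRec_rootSeq (ℓ : SHat N q ε r →ₗ[ℂ] ℂ)
    (h : ∀ i : ℕ, 1 ≤ i → i ≤ N / 2 → HasRec (rootSeq ℓ ((i : ℤ) - 1)))
    (hN : HasRec (rootSeq ℓ ((N : ℤ) - 1))) (P : ℤ) : HasRec (rootSeq ℓ P) := by
  have hpos : (0 : ℤ) < N := by exact_mod_cast NeZero.pos N
  have h0 := Int.emod_nonneg P hpos.ne'
  have h1 := Int.emod_lt_of_pos P hpos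
  have hP : P = P % N + P / N * N := by rw [mul_comm]; exact (Int.emod_add_mul_ediv P N).symm
  have htrans : HasRec (rootSeq ℓ (P % N)) → HasRec (rootSeq ℓ P) := by
    intro h
    have h2 := (hasRec_twist (u := q ^ (-(P / N)))).2 h
    have h3 : (fun n => (((q ^ (-(P / N))) ^ n : ℂˣ) : ℂ) * rootSeq ℓ (P % N) n) = rootSeq ℓ P := by
      funext n
      conv_rhs => rw [hP]
      rw [rootSeq_translate, ← zpow_mul, neg_mul]
    rwa [h3] at h2
  apply htrans
  generalize P % N = R at h0 h1
  rcases eq_or_ne R (N - 1) with rfl | hR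
  · exact hN
  rcases le_or_gt (R + 1) (N / 2) with hR2 | hR2
  · have := h (R + 1).toNat (by omega) (by omega)
    rwa [show (((R + 1).toNat : ℕ) : ℤ) - 1 = R by omega] at this
  · have := h ((N : ℤ) - 1 - R).toNat (by omega) (by omega)
    rw [show ((((N : ℤ) - 1 - R).toNat : ℕ) : ℤ) - 1 = N - 2 - R by omega] at this
    have h2 := this.comp_neg
    simp only [rootSeq_reflect] at h2
    have h3 := (hasRec_twist (u := q⁻¹) (f := rootSeq ℓ R)).1
    simp only [inv_zpow'] at h3
    exact h3 h2

theorem isQuasifinite_iff_hasRec {s : ℂˣ} (hs : s ^ 2 = q)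
    (lam : Module.Dual ℂ (grade N q ε r 0)) :
    HighestWeight.IsQuasifinite (grade N q ε r) lam ↔
      (∀ i : ℕ, 1 ≤ i → i ≤ N / 2 - (if Even N then 1 else 0) →
        HasRec (label hs lam (i + 1) - label hs lam i)) ∧
      HasRec (fun l => labelN lam l - if l = 0 then 2 * charge lam else 0) ∧
      (Even N → HasRec (label hs lam (N / 2 + 1) - label hs lam (N / 2))) := by
  have hpos := NeZero.pos N
  constructor
  · intro hfin
    have h := hasRec_of_isQuasifinite hfin
    have hi : ∀ i : ℕ, 1 ≤ i → i + 1 ≤ N → HasRec (label hs lam (i + 1) - label hs lam i) := by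
      intro i h1 hi
      rw [hasRec_label_sub_iff hs lam h1 hi]
      have := h ⟨i - 1, by omega⟩
      rwa [show (((⟨i - 1, by omega⟩ : Fin N) : ℕ) : ℤ) = (i : ℤ) - 1 by simp only; omega] at this
    refine ⟨fun i h1 h2 => hi i h1 ?_, (hasRec_labelN_iff lam).2 ?_, fun he => hi _ ?_ ?_⟩
    · split_ifs at h2 with he
      · omega
      · obtain ⟨m, hm⟩ := Nat.not_even_iff_odd.1 he
        omega
    · have := h ⟨N - 1, by omega⟩
      rwa [show (((⟨N - 1, by omega⟩ : Fin N) : ℕ) : ℤ) = (N : ℤ) - 1 by simp only; omega] at this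
    · obtain ⟨m, hm⟩ := he; omega
    · obtain ⟨m, hm⟩ := he; omega
  · rintro ⟨h1, h2, h3⟩
    refine isQuasifinite_of_hasRec (hasRec_rootSeq _ (fun i hi hi' => ?_)
      ((hasRec_labelN_iff lam).1 h2))
    by_cases he : Even N
    · have h4 := h3 he
      obtain ⟨m, hm⟩ := id he
      rw [if_pos he] at h1
      rw [← hasRec_label_sub_iff hs lam hi (by omega)]
      rcases eq_or_ne i (N / 2) with rfl | hne
      · exact h4
      · exact h1 i hi (by omega)
    · obtain ⟨m, hm⟩ := Nat.not_even_iff_odd.1 he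
      rw [if_neg he] at h1
      rw [← hasRec_label_sub_iff hs lam hi (by omega)]
      exact h1 i hi (by omega)

end SHat

namespace LinRec

/-- The part of the equivalence that concerns only sequences: `a i` and `A` stand for the labels,
and `K` for a condition equivalent to the existence of recurrences. -/
theorem tfae_hasRec {q : ℂˣ} (hq : ‖(q : ℂ)‖ ≠ 1) (N : ℕ) (a : ℕ → ℤ → ℂ) (A : ℤ → ℂ) (c : ℂ)
    {K : Prop} (hA : ∀ n, A (-n) = A n)
    (ha : Even N → ∀ n, a (N / 2 + 1) (-n) - a (N / 2) (-n) = a (N / 2 + 1) n - a (N / 2) n)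
    (hK : K ↔ (∀ i : ℕ, 1 ≤ i → i ≤ N / 2 - (if Even N then 1 else 0) →
        HasRec (a (i + 1) - a i)) ∧ HasRec (fun l => A l - if l = 0 then 2 * c else 0) ∧
      (Even N → HasRec (a (N / 2 + 1) - a (N / 2)))) :
    List.TFAE [
      K,
      (∀ i : ℕ, 1 ≤ i → i ≤ N / 2 - (if Even N then 1 else 0) →
          ∃ b : Polynomial ℂ, b.Monic ∧
            polyMulSeries b (genSeries (a (i + 1)) - genSeries (a i)) = 0) ∧
        (∃ b : Polynomial ℂ, b.Monic ∧
          polyMulSeries b (genSeries A - Pi.single 0 (2 * c)) = 0) ∧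
        (Even N → ∃ b : Polynomial ℂ, b.Monic ∧
          polyMulSeries b (genSeries (a (1 + N / 2)) - genSeries (a (N / 2))) = 0),
      (∀ i : ℕ, 1 ≤ i → i ≤ N / 2 - (if Even N then 1 else 0) →
          ∃ P : ℂ → ℂ, IsQuasipolynomial q P ∧ ∀ n : ℤ, P n = a i n - a (i + 1) n) ∧
        (∃ P : ℂ → ℂ, IsEvenQuasipolynomial q P ∧
          (∀ n : ℤ, n ≠ 0 → P n = A n) ∧ P 0 = A 0 - 2 * c) ∧
        (Even N → ∃ P : ℂ → ℂ, IsEvenQuasipolynomial q P ∧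
          ∀ n : ℤ, P n = a (N / 2) n - a (N / 2 + 1) n),
      (∀ i : ℕ, 1 ≤ i → i ≤ N / 2 - (if Even N then 1 else 0) →
          ∃ P : ℂ → ℂ, IsQuasipolynomial q P ∧ ∀ n : ℤ, P n = a i n - a (i + 1) n) ∧
        (∃ P : ℂ → ℂ, IsEvenQuasipolynomial q P ∧ (∀ x, P (-x) = P x) ∧
          (∀ n : ℤ, n ≠ 0 → P n = A n) ∧ P 0 = A 0 - 2 * c) ∧
        (Even N → ∃ P : ℂ → ℂ, IsEvenQuasipolynomial q P ∧ (∀ x, P (-x) = P x) ∧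
          ∀ n : ℤ, P n = a (N / 2) n - a (N / 2 + 1) n)] := by
  set A' : ℤ → ℂ := fun l => A l - if l = 0 then 2 * c else 0 with hA'
  have hser : genSeries A - Pi.single 0 (2 * c) = genSeries A' := by
    funext n
    by_cases hn : n = 0
    · simp [genSeries, hA', hn]
    · simp [genSeries, hA', hn]
  have hiff : ∀ P : ℂ → ℂ, ((∀ n : ℤ, n ≠ 0 → P n = A n) ∧ P 0 = A 0 - 2 * c) ↔
      ∀ n : ℤ, P n = A' n := by
    intro P
    constructor
    · rintro ⟨h, h0⟩ n
      by_cases hn : n = 0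
      · subst hn; simpa [hA'] using h0
      · simp [hA', hn, h n hn]
    · intro h
      exact ⟨fun n hn => by simp [h n, hA', hn], by simpa [hA'] using h 0⟩
  have heven : ∀ n, A' (-n) = A' n := fun n => by simp only [hA', hA, neg_eq_zero]
  have hneg : ∀ i, HasRec (fun n => a i n - a (i + 1) n) ↔ HasRec (a (i + 1) - a i) := fun i => by
    have h : (fun n => a i n - a (i + 1) n) = -(a (i + 1) - a i) := by funext n; simp
    rw [h]
    exact ⟨fun h => by simpa using h.neg, HasRec.neg⟩
  tfae_have 1 → 2 := by
    intro h
    obtain ⟨h1, h2, h3⟩ := hK.1 h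
    refine ⟨fun i hi hi' => hasRec_iff_exists_monic.1 (h1 i hi hi'), ?_, fun he => ?_⟩
    · rw [hser]
      exact hasRec_iff_exists_monic.1 h2
    · rw [add_comm 1]
      exact hasRec_iff_exists_monic.1 (h3 he)
  tfae_have 2 → 4 := by
    rintro ⟨h1, h2, h3⟩
    rw [hser] at h2
    rw [add_comm 1] at h3
    refine ⟨fun i hi hi' => ((hneg i).2
      (hasRec_iff_exists_monic.2 (h1 i hi hi'))).exists_isQuasipolynomial hq, ?_, fun he => ?_⟩
    · obtain ⟨P, hP, hP', hPA⟩ := (hasRec_iff_exists_monic.2 h2).exists_even hq heven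
      exact ⟨P, hP, hP', (hiff P).2 hPA⟩
    · refine ((hneg (N / 2)).2 (hasRec_iff_exists_monic.2 (h3 he))).exists_even hq fun n => ?_
      linear_combination -ha he n
  tfae_have 4 → 3 := by
    rintro ⟨h1, ⟨P, hP, -, hPA⟩, h3⟩
    refine ⟨h1, ⟨P, hP, hPA⟩, fun he => ?_⟩
    obtain ⟨Q, hQ, -, hQA⟩ := h3 he
    exact ⟨Q, hQ, hQA⟩
  tfae_have 3 → 1 := by
    rintro ⟨h1, ⟨P, hP, hPA⟩, h3⟩
    refine hK.2 ⟨fun i hi hi' => (hneg i).1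
      ((hasRec_iff_exists_isQuasipolynomial hq).2 (h1 i hi hi')),
      (hasRec_iff_exists_isQuasipolynomial hq).2 ⟨P, hP.1, (hiff P).1 hPA⟩, fun he => ?_⟩
    obtain ⟨Q, hQ, hQA⟩ := h3 he
    exact (hneg (N / 2)).1 ((hasRec_iff_exists_isQuasipolynomial hq).2 ⟨Q, hQ.1, hQA⟩)
  tfae_finish

end LinRec

end

theorem mainTheorem2 (N : ℕ) [NeZero N] (q : ℂˣ) (hq : ‖(q : ℂ)‖ ≠ 1) (s : ℂˣ) (hs : s ^ 2 = q)
    (ε : ℤˣ) (r : ℤ) (lam : Module.Dual ℂ (SHat.grade N q ε r 0)) :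
    List.TFAE [
      -- `L(lam)` is quasifinite
      HighestWeight.IsQuasifinite (SHat.grade N q ε r) lam,
      -- annihilating polynomials
      (∀ i : ℕ, 1 ≤ i → i ≤ N / 2 - (if Even N then 1 else 0) →
          ∃ b : Polynomial ℂ, b.Monic ∧
            polyMulSeries b
              (genSeries (SHat.label hs lam (i + 1)) - genSeries (SHat.label hs lam i)) = 0) ∧
        (∃ b : Polynomial ℂ, b.Monic ∧
          polyMulSeries b (genSeries (SHat.labelN lam) - Pi.single 0 (2 * SHat.charge lam)) = 0) ∧
        (Even N → ∃ b : Polynomial ℂ, b.Monic ∧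
          polyMulSeries b
            (genSeries (SHat.label hs lam (1 + N / 2)) - genSeries (SHat.label hs lam (N / 2))) = 0),
      -- interpolating quasipolynomials
      (∀ i : ℕ, 1 ≤ i → i ≤ N / 2 - (if Even N then 1 else 0) →
          ∃ P : ℂ → ℂ, IsQuasipolynomial q P ∧
            ∀ n : ℤ, P n = SHat.label hs lam i n - SHat.label hs lam (i + 1) n) ∧
        (∃ P : ℂ → ℂ, IsEvenQuasipolynomial q P ∧
          (∀ n : ℤ, n ≠ 0 → P n = SHat.labelN lam n) ∧ P 0 = SHat.labelN lam 0 - 2 * SHat.charge lam) ∧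
        (Even N → ∃ P : ℂ → ℂ, IsEvenQuasipolynomial q P ∧
          ∀ n : ℤ, P n = SHat.label hs lam (N / 2) n - SHat.label hs lam (N / 2 + 1) n),
      -- the same, with the even quasipolynomials being moreover even functions
      (∀ i : ℕ, 1 ≤ i → i ≤ N / 2 - (if Even N then 1 else 0) →
          ∃ P : ℂ → ℂ, IsQuasipolynomial q P ∧
            ∀ n : ℤ, P n = SHat.label hs lam i n - SHat.label hs lam (i + 1) n) ∧
        (∃ P : ℂ → ℂ, IsEvenQuasipolynomial q P ∧ (∀ x, P (-x) = P x) ∧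
          (∀ n : ℤ, n ≠ 0 → P n = SHat.labelN lam n) ∧ P 0 = SHat.labelN lam 0 - 2 * SHat.charge lam) ∧
        (Even N → ∃ P : ℂ → ℂ, IsEvenQuasipolynomial q P ∧ (∀ x, P (-x) = P x) ∧
          ∀ n : ℤ, P n = SHat.label hs lam (N / 2) n - SHat.label hs lam (N / 2 + 1) n)] :=
  LinRec.tfae_hasRec hq N (SHat.label hs lam) (SHat.labelN lam) (SHat.charge lam)
    (SHat.labelN_neg lam) (SHat.label_sub_neg hs lam) (SHat.isQuasifinite_iff_hasRec hs lam)
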